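/- Conventions. Graphs are simple and undirected. For a graph $G$ of bounded valency and an integer $k\ge 0$, the Følner function is $$Fol_G(k)=\min\{|U| : U\subset V(G)\text{ finite and non-empty},\ k\,|\partial_G U|\le |U|\},$$ where $\partial_G U$ is the set of pairs $(x,y)$ of adjacent vertices with $x\in U$, $y\notin U$. $p^G_n(x,y)$ denotes the $n$-step transition probability of the lazy simple random walk on $G$, which jumps uniformly to one of the $\nu(x)+1$ points formed by the current vertex $x$ and its $\nu(x)$ neighbours. For real sequences, $a\preceq b$ means that there are constants $c_1,c_2>0$ with $a_n\le c_1 b_{\lfloor c_2 n\rfloor}$ for all $n\ge 0$, and $a\approx b$ means $a\preceq b$ and $b\preceq a$. Let $A$ be a graph, $\varphi:V(A)\to L$ a map to a set $L$ of lamps, and $(B_z)_{z\in L}$ graphs with a chosen rest vertex in each. The generalized wreath product has as vertices the pairs $(a,f)$ with $a\in V(A)$ and $f$ a choice of a vertex $f(z)\in B_z$ for every $z\in L$, equal to the rest vertex for all but finitely many $z$; $(a,f)$ and $(b,g)$ are adjacent if either $f=g$ and $a,b$ are adjacent in $A$, or $a=b$, $f$ and $g$ agree off $\varphi(a)$, and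 $f(\varphi(a)),g(\varphi(a))$ are adjacent in $B_{\varphi(a)}$. (So lamps are identified along the partition of $V(A)$ into the fibres of $\varphi$.) For $L=V(A)$ and $\varphi=\mathrm{id}$ this is the wreath product $A\wr B_z$. Below, $\mathbb Z$ and $\mathbb Z/2\mathbb Z$ stand for their Cayley graphs with generator $1$. Theorem. Let $\alpha\in[0,1)$, $\beta=\frac{2\alpha}{1-\alpha}$ and $F(x)=\exp(x^{\beta})$. There are an infinite graph $D_F$ of bounded valency, connected if $\alpha>0$, and a vertex $d_0$ of $D_F$ such that $Fol_{D_F}$ is finite for every $k$, and (i) $Fol_{D_F}(k)\approx F(k)$; (ii) $p^{D_F}_n(d_0,d_0)\approx e^{-n^{\alpha}}$. Moreover: (a) If $\alpha\ge 1/3$, then $D_F$ can be taken to be a wreath product of $\mathbb Z$ with fibres $(B_z)_{z\in\mathbb Z}$, where $B_z$ is a finite connected graph with exactly $\lfloor F(|z|+1)/F(|z|)\rfloor$ vertices and the valencies of all the $B_z$ are bounded by one constant; and $d_0=(0,\text{all lamps at rest})$. (b) If $0<\alpha\le 1/3$, then $D_F$ can be taken to be a generalized wreath product of $\mathbb Z$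 by $\mathbb Z/2\mathbb Z$ along a surjective map $\varphi:\mathbb Z\to\mathbb Z$ for which there are constants $c,C>0$ with $c\,m^{\beta}\le |\varphi(\{k,k+1,\dots,k+m\})|\le C\,m^{\beta}$ for all $k\in\mathbb Z$ and all integers $m\ge 1$; and $d_0=(0,\text{all lamps at rest})$. -/

import Mathlib

/-- The number `ν(x)` of neighbours of the vertex `x` in the graph `G`. -/
noncomputable def valency {V : Type} (G : SimpleGraph V) (x : V) : ℕ :=
  (G.neighborSet x).ncard

/-- Bounded valency: the neighbourhoods are finite, of uniformly bounded size. -/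
def BoundedValency {V : Type} (G : SimpleGraph V) : Prop :=
  ∃ D : ℕ, ∀ x : V, (G.neighborSet x).encard ≤ (D : ℕ∞)

/-- The edge boundary `∂_G U = {(x, y) ∈ E(G) ; x ∈ U, y ∉ U}`. -/
def edgeBoundary {V : Type} (G : SimpleGraph V) (U : Finset V) : Set (V × V) :=
  {e | G.Adj e.1 e.2 ∧ e.1 ∈ U ∧ e.2 ∉ U}

/-- The non-empty finite sets `U` of vertices with `|∂_G U| / |U| ≤ 1 / k`
(no condition other than non-emptiness for `k = 0`). -/
def folnerSets {V : Type} (G : SimpleGraph V) (k : ℕ) : Set (Finset V) :=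
  {U | U.Nonempty ∧ k * (edgeBoundary G U).ncard ≤ U.card}

/-- The Følner function `Fol_G(k) = min {|U| ; U ∈ folnerSets G k}`. (It is used together with
the requirement that `folnerSets G k` is non-empty for every `k`.) -/
noncomputable def folner {V : Type} (G : SimpleGraph V) (k : ℕ) : ℕ :=
  sInf (Finset.card '' folnerSets G k)

open Classical in
/-- One step of the lazy simple random walk: from `x` the walk jumps uniformly on the set formed by
`x` and its neighbours. -/
noncomputable def walkStep {V : Type} (G : SimpleGraph V) (x y : V) : ℝ :=
  if x = y ∨ G.Adj x y then 1 / ((valency G x : ℝ) + 1) else 0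

open Classical in
/-- The `n`-step transition probabilities `p_n(x, y)` of the lazy simple random walk
(the `n`-th power of the one-step matrix; on a graph of bounded valency all sums are finite). -/
noncomputable def transProb {V : Type} (G : SimpleGraph V) : ℕ → V → V → ℝ
  | 0, x, y => if x = y then 1 else 0
  | n + 1, x, y => ∑' z, walkStep G x z * transProb G n z y

/-- `a ≼ b`: there are constants `c₁, c₂ > 0` with `a_n ≤ c₁ b_{c₂ n}` for all `n ≥ 0`
(the index `c₂ n` being rounded down to an integer). -/
def Dominated (a b : ℕ → ℝ) : Prop :=
  ∃ c₁ : ℝ, 0 < c₁ ∧ ∃ c₂ : ℝ, 0 < c₂ ∧ ∀ n : ℕ, a n ≤ c₁ * b ⌊c₂ * (n : ℝ)⌋₊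

/-- `a ≈ b`: both `a ≼ b` and `b ≼ a`. -/
def Comparable (a b : ℕ → ℝ) : Prop :=
  Dominated a b ∧ Dominated b a

/-- `F(x) = exp(x ^ (2α / (1 - α)))`. -/
noncomputable def profileF (α x : ℝ) : ℝ :=
  Real.exp (x ^ (2 * α / (1 - α)))

/-- `G` has bounded valency, its Følner function is finite and `≈ F`, and the return probability
of the lazy simple random walk at `d₀` is `≈ exp(-n ^ α)`. -/
def HasExpectedDecay {V : Type} (α : ℝ) (G : SimpleGraph V) (d₀ : V) : Prop :=
  BoundedValency G ∧
  (∀ k : ℕ, (folnerSets G k).Nonempty) ∧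
  Comparable (fun k => (folner G k : ℝ)) (fun k => profileF α (k : ℝ)) ∧
  Comparable (fun n => transProb G n d₀ d₀) (fun n => Real.exp (-((n : ℝ) ^ α)))

/-- Lamp configurations: `f z ∈ W z` for every `z`, and `f z` is the rest state `o z` for all but
finitely many `z`. -/
def LampConfig {L : Type} (W : L → Type) (o : ∀ z, W z) : Type :=
  {f : ∀ z, W z // {z | f z ≠ o z}.Finite}

/-- The configuration in which every lamp is at rest. -/
def LampConfig.rest {L : Type} (W : L → Type) (o : ∀ z, W z) : LampConfig W o :=
  ⟨o, by simp⟩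

/-- The generalized wreath product of the base graph `A` by the fibres `B z` along the lamp map `φ`:
a vertex is a position `a` of the walker in `A` and a configuration of the lamps; an edge either
moves the walker along an edge of `A`, or changes the state of the single lamp `φ a` along an
edge of the fibre of that lamp. Positions with the same image under `φ` share one lamp, so the
lamps are identified along the partition of the base into the sets `φ⁻¹ {i}`. -/
def generalizedWreath {V L : Type} (A : SimpleGraph V) (φ : V → L) (W : L → Type)
    (B : ∀ z, SimpleGraph (W z)) (o : ∀ z, W z) : SimpleGraph (V × LampConfig W o) where
  Adj u v :=
    (A.Adj u.1 v.1 ∧ u.2 = v.2) ∨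
    (u.1 = v.1 ∧ (∀ x, x ≠ φ u.1 → u.2.1 x = v.2.1 x) ∧
      (B (φ u.1)).Adj (u.2.1 (φ u.1)) (v.2.1 (φ u.1)))
  symm := ⟨by
    rintro u v (⟨h, h'⟩ | ⟨h, h', h''⟩)
    · exact Or.inl ⟨h.symm, h'.symm⟩
    · refine Or.inr ⟨h.symm, ?_, ?_⟩
      · intro x hx
        exact (h' x (by rw [h]; exact hx)).symm
      · rw [← h]
        exact h''.symm⟩
  loopless := ⟨by
    rintro u (⟨h, _⟩ | ⟨_, _, h⟩)
    · exact A.loopless.irrefl _ h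
    · exact (B (φ u.1)).loopless.irrefl _ h⟩

/-- The wreath product `A ≀ B_z`: one lamp, with fibre `B z`, at each vertex `z` of `A`. -/
def wreath {V : Type} (A : SimpleGraph V) (W : V → Type)
    (B : ∀ z, SimpleGraph (W z)) (o : ∀ z, W z) : SimpleGraph (V × LampConfig W o) :=
  generalizedWreath A id W B o

/-- The Cayley graph of `ℤ` with generator `1`. -/
def intGraph : SimpleGraph ℤ := SimpleGraph.circulantGraph {1}

/-- The Cayley graph of `ℤ / 2ℤ` with generator `1`. -/
def zmodTwoGraph : SimpleGraph (ZMod 2) := SimpleGraph.circulantGraph {1}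

/-- The fibre size `l(z) = F(|z| + 1) / F(|z|)`, rounded down to an integer. -/
noncomputable def fibreSize (α : ℝ) (z : ℤ) : ℕ :=
  ⌊profileF α (|(z : ℝ)| + 1) / profileF α |(z : ℝ)|⌋₊

/-!
Write `β = 2 * α / (1 - α)`. Cheeger's inequality, applied to the truncations of `x ↦ p_n(x, d₀)`,
turns the isoperimetric inequality `Fol(k) ≽ exp (k ^ β)` into `p_n(d₀, d₀) ≼ exp (-n ^ α)`.
Conversely, let the tube of radius `m` in a wreath product over `ℤ` consist of the vertices with
position in `[-m, m]` and arbitrary lamps visited from there. If it has about `exp (m ^ β)`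
vertices, it shows that `Fol(m) ≼ exp (m ^ β)`, and, since the walk stays in it up to time `n` with
probability at least about `exp (-n / m ^ 2)` (use a cosine of the position as test function),
Cauchy–Schwarz gives `p_n(d₀, d₀) ≽ exp (-n ^ α)` for the `m` which balances `n / m ^ 2` against
`m ^ β`.

For the isoperimetric inequality in the wreath product, cut `ℤ` into windows of length `k`. A set
`U` with few boundary edges over its size fills, for most of its points, the whole window around
them, so some window carries a set of configurations which, at most of them and in the direction of
most lamps of the window, has a slice with a small boundary. If the fibres expand, each such slice
has size at least a power of the fibre, and Han's inequality multiplies these sizes up to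
`exp (c * k ^ β)`, provided that every positive proportion of a window of length `k` sees lamps of
total entropy `≽ k ^ β`.

For `β ≥ 1` one lamp of size `F(|z| + 1) / F(|z|)` at each `z` has this property, and random
permutations give fibres that expand. For `0 < β ≤ 1` the lamps have two states, and the lamp at
`a` is labelled by the binary digits of `a` whose positions lie in a set of density `β`. For `α = 0`
a graph without edges will do.
-/

section Markov

variable {V : Type*} (G : SimpleGraph V)

/-- The finite set `T` contains the closed neighbourhood of the support of `u`. Sums over `T` of
quantities of range one in `u` then agree with the sums over all vertices. -/
def SupportNbhdSubset (u : V → ℝ) (T : Finset V) : Prop :=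
  ∀ x, u x ≠ 0 → x ∈ T ∧ ∀ y, G.Adj x y → y ∈ T

namespace SupportNbhdSubset

variable {G} {u : V → ℝ} {S T : Finset V} {x : V}

theorem eq_zero (h : SupportNbhdSubset G u T) (hx : x ∉ T) : u x = 0 :=
  not_not.1 fun h0 => hx (h x h0).1

theorem eq_zero_of_adj (h : SupportNbhdSubset G u T) {y : V} (hxy : G.Adj x y) (hy : y ∉ T) :
    u x = 0 :=
  not_not.1 fun h0 => hy ((h x h0).2 y hxy)

theorem mono (h : SupportNbhdSubset G u S) (hST : S ⊆ T) : SupportNbhdSubset G u T :=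
  fun x hx => ⟨hST (h x hx).1, fun y hy => hST ((h x hx).2 y hy)⟩

theorem posPart_sub (hu : SupportNbhdSubset G u T) {t : ℝ} (ht : 0 ≤ t) :
    SupportNbhdSubset G (fun x => max (u x - t) 0) T :=
  fun x hx => hu x fun h0 => hx (max_eq_right (by linarith))

end SupportNbhdSubset

variable [G.LocallyFinite]

/-- The Markov operator of the lazy simple random walk, acting on functions. -/
noncomputable def markov (f : V → ℝ) (x : V) : ℝ :=
  (f x + ∑ y ∈ G.neighborFinset x, f y) / (G.degree x + 1)

/-- The function `x ↦ p_n(x, x₀)`, as an iterate of the Markov operator. -/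
noncomputable def heat (x₀ : V) (n : ℕ) : V → ℝ :=
  (markov G)^[n] (({x₀} : Set V).indicator 1)

/-- The inner product with respect to the reversible measure `x ↦ ν(x) + 1` of the walk. The sum
runs over a finite set `T`, meant to contain the support of one of the two functions. -/
noncomputable def walkInner (T : Finset V) (f g : V → ℝ) : ℝ :=
  ∑ x ∈ T, ((G.degree x : ℝ) + 1) * (f x * g x)

/-- The Dirichlet energy over the pairs of adjacent vertices with first vertex in `T`. -/
noncomputable def dirichletEnergy (T : Finset V) (u : V → ℝ) : ℝ :=
  ∑ x ∈ T, ∑ y ∈ G.neighborFinset x, (u x - u y) ^ 2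

variable {G}

theorem degree_add_one_mul_markov (f : V → ℝ) (x : V) :
    ((G.degree x : ℝ) + 1) * markov G f x = f x + ∑ y ∈ G.neighborFinset x, f y :=
  mul_div_cancel₀ _ (by positivity)

theorem heat_zero_self (x₀ : V) : heat G x₀ 0 x₀ = 1 := by simp [heat]

theorem heat_zero_of_ne {x₀ x : V} (hx : x ≠ x₀) : heat G x₀ 0 x = 0 := by simp [heat, hx]

theorem heat_succ (x₀ : V) (n : ℕ) : heat G x₀ (n + 1) = markov G (heat G x₀ n) := by
  rw [heat, heat, Function.iterate_succ_apply']

theorem heat_nonneg (x₀ : V) (n : ℕ) (x : V) : 0 ≤ heat G x₀ n x := by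
  induction n generalizing x with
  | zero => exact Set.indicator_nonneg (fun _ _ => zero_le_one) x
  | succ n ih =>
    rw [heat_succ, markov]
    exact div_nonneg (add_nonneg (ih x) (Finset.sum_nonneg fun y _ => ih y)) (by positivity)

theorem SupportNbhdSubset.markov_eq_zero {u : V → ℝ} {T : Finset V} {x : V}
    (h : SupportNbhdSubset G u T) (hx : x ∉ T) : markov G u x = 0 := by
  have hnbhd : ∑ y ∈ G.neighborFinset x, u y = 0 := Finset.sum_eq_zero fun y hy =>
    h.eq_zero_of_adj ((G.mem_neighborFinset _ _).1 hy).symm hx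
  rw [markov, hnbhd, h.eq_zero hx, add_zero, zero_div]

theorem exists_supportNbhdSubset (S : Finset V) :
    ∃ T, S ⊆ T ∧ ∀ u : V → ℝ, (∀ x ∉ S, u x = 0) → SupportNbhdSubset G u T := by
  classical
  refine ⟨S ∪ S.biUnion fun x => G.neighborFinset x, Finset.subset_union_left, fun u hu x hx => ?_⟩
  have hxS : x ∈ S := not_not.1 (mt (hu x) hx)
  exact ⟨Finset.mem_union_left _ hxS, fun y hy => Finset.mem_union_right _
    (Finset.mem_biUnion.2 ⟨x, hxS, (G.mem_neighborFinset _ _).2 hy⟩)⟩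

theorem exists_supportNbhdSubset_heat (x₀ : V) (N : ℕ) :
    ∃ T, x₀ ∈ T ∧ ∀ n ≤ N, SupportNbhdSubset G (heat G x₀ n) T := by
  induction N with
  | zero =>
    obtain ⟨T, hT, h⟩ := exists_supportNbhdSubset (G := G) {x₀}
    refine ⟨T, hT (Finset.mem_singleton_self _), fun n hn => ?_⟩
    obtain rfl : n = 0 := by omega
    exact h _ fun x hx => heat_zero_of_ne (mt Finset.mem_singleton.2 hx)
  | succ N ih =>
    obtain ⟨S, hS, h⟩ := ih
    obtain ⟨T, hT, h'⟩ := exists_supportNbhdSubset (G := G) S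
    refine ⟨T, hT hS, fun n hn => ?_⟩
    rcases Nat.le_succ_iff.1 hn with hn | rfl
    · exact (h n hn).mono hT
    · exact h' _ fun x hx => heat_succ (G := G) x₀ N ▸ (h N le_rfl).markov_eq_zero hx

theorem sum_neighbor_eq_sum_ite [DecidableRel G.Adj] {T : Finset V} (F : V → V → ℝ)
    (hF : ∀ x ∈ T, ∀ y, G.Adj x y → y ∉ T → F x y = 0) :
    ∑ x ∈ T, ∑ y ∈ G.neighborFinset x, F x y =
      ∑ x ∈ T, ∑ y ∈ T, if G.Adj x y then F x y else 0 := by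
  refine Finset.sum_congr rfl fun x hx => ?_
  rw [← Finset.sum_filter]
  refine (Finset.sum_subset (fun y hy => ?_) fun y hy hy' => ?_).symm
  · simpa using (Finset.mem_filter.1 hy).2
  · rw [SimpleGraph.mem_neighborFinset] at hy
    exact hF x hx y hy fun h => hy' (Finset.mem_filter.2 ⟨h, hy⟩)

theorem sum_neighbor_comm {T : Finset V} (F : V → V → ℝ)
    (hF : ∀ x ∈ T, ∀ y, G.Adj x y → y ∉ T → F x y = 0)
    (hF' : ∀ x ∈ T, ∀ y, G.Adj x y → y ∉ T → F y x = 0) :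
    ∑ x ∈ T, ∑ y ∈ G.neighborFinset x, F x y =
      ∑ x ∈ T, ∑ y ∈ G.neighborFinset x, F y x := by
  classical
  rw [sum_neighbor_eq_sum_ite F hF, sum_neighbor_eq_sum_ite (fun x y => F y x) hF',
    Finset.sum_comm]
  simp only [G.adj_comm]

theorem SupportNbhdSubset.sum_neighbor_comp {u : V → ℝ} {T : Finset V}
    (h : SupportNbhdSubset G u T) {φ : ℝ → ℝ} (hφ : φ 0 = 0) :
    ∑ x ∈ T, ∑ y ∈ G.neighborFinset x, φ (u y) = ∑ x ∈ T, G.degree x * φ (u x) := by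
  rw [← sum_neighbor_comm (fun x _ => φ (u x))
    (fun x _ y hxy hy => by simp only [h.eq_zero_of_adj hxy hy, hφ])
    (fun x _ y _ hy => by simp only [h.eq_zero hy, hφ])]
  simp only [Finset.sum_const, SimpleGraph.card_neighborFinset_eq_degree, nsmul_eq_mul]

theorem walkInner_self_nonneg (T : Finset V) (u : V → ℝ) : 0 ≤ walkInner G T u u :=
  Finset.sum_nonneg fun _ _ => mul_nonneg (by positivity) (mul_self_nonneg _)

theorem dirichletEnergy_nonneg (T : Finset V) (u : V → ℝ) : 0 ≤ dirichletEnergy G T u :=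
  Finset.sum_nonneg fun _ _ => Finset.sum_nonneg fun _ _ => sq_nonneg _

theorem two_mul_walkInner_le (T : Finset V) (f g : V → ℝ) :
    2 * walkInner G T f g ≤ walkInner G T f f + walkInner G T g g := by
  simp only [walkInner, Finset.mul_sum, ← Finset.sum_add_distrib]
  refine Finset.sum_le_sum fun x _ => ?_
  have hx : (0 : ℝ) ≤ G.degree x + 1 := by positivity
  linarith [mul_nonneg hx (sq_nonneg (f x - g x))]

theorem walkInner_markov_left {T : Finset V} {f g : V → ℝ} (hf : ∀ x ∉ T, f x = 0)
    (hg : ∀ x ∉ T, g x = 0) :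
    walkInner G T (markov G f) g = walkInner G T f (markov G g) := by
  have hleft : ∀ x, ((G.degree x : ℝ) + 1) * (markov G f x * g x) =
      f x * g x + ∑ y ∈ G.neighborFinset x, f y * g x := fun x => by
    rw [← mul_assoc, degree_add_one_mul_markov, add_mul, Finset.sum_mul]
  have hright : ∀ x, ((G.degree x : ℝ) + 1) * (f x * markov G g x) =
      f x * g x + ∑ y ∈ G.neighborFinset x, f x * g y := fun x => by
    rw [mul_left_comm, degree_add_one_mul_markov, mul_add, Finset.mul_sum]
  simp only [walkInner, hleft, hright, Finset.sum_add_distrib]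
  congr 1
  exact sum_neighbor_comm (fun x y => f y * g x)
    (fun x _ y _ hy => by rw [hf y hy, zero_mul]) (fun x _ y _ hy => by rw [hg y hy, mul_zero])

theorem SupportNbhdSubset.walkInner_one_markov {u : V → ℝ} {T : Finset V}
    (h : SupportNbhdSubset G u T) : walkInner G T 1 (markov G u) = walkInner G T 1 u := by
  have hswap := h.sum_neighbor_comp (φ := id) rfl
  simp only [id_eq] at hswap
  simp only [walkInner, Pi.one_apply, one_mul, degree_add_one_mul_markov, Finset.sum_add_distrib,
    hswap]
  simp only [add_mul, one_mul, Finset.sum_add_distrib, add_comm]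

section HeatSums

variable {x₀ : V} {N : ℕ} {T : Finset V}

theorem walkInner_heat_zero_right (hx₀ : x₀ ∈ T) (f : V → ℝ) :
    walkInner G T f (heat G x₀ 0) = ((G.degree x₀ : ℝ) + 1) * f x₀ := by
  rw [walkInner, Finset.sum_eq_single_of_mem x₀ hx₀ fun x _ hx => by simp [heat_zero_of_ne hx],
    heat_zero_self, mul_one]

theorem walkInner_heat_heat (hx₀ : x₀ ∈ T) (hT : ∀ n ≤ N, SupportNbhdSubset G (heat G x₀ n) T)
    (a b : ℕ) (hab : a + b ≤ N) :
    walkInner G T (heat G x₀ a) (heat G x₀ b) =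
      ((G.degree x₀ : ℝ) + 1) * heat G x₀ (a + b) x₀ := by
  induction b generalizing a with
  | zero => exact walkInner_heat_zero_right hx₀ _
  | succ b ih =>
    rw [heat_succ, ← walkInner_markov_left (fun x => (hT a (by omega)).eq_zero)
      (fun x => (hT b (by omega)).eq_zero), ← heat_succ, ih (a + 1) (by omega),
      Nat.add_right_comm, Nat.add_assoc]

theorem walkInner_one_heat (hx₀ : x₀ ∈ T) (hT : ∀ n ≤ N, SupportNbhdSubset G (heat G x₀ n) T)
    {n : ℕ} (hn : n ≤ N) : walkInner G T 1 (heat G x₀ n) = G.degree x₀ + 1 := by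
  induction n with
  | zero => rw [walkInner_heat_zero_right hx₀, Pi.one_apply, mul_one]
  | succ n ih => rw [heat_succ, (hT n (by omega)).walkInner_one_markov, ih (by omega)]

end HeatSums

/-- Both sides are `ν(x) + 1` times the variance of `u` on the closed neighbourhood of `x`, since
`markov G u x` is its mean there. -/
theorem add_sum_sq_sub_markov (u : V → ℝ) (x : V) :
    (u x - markov G u x) ^ 2 + ∑ y ∈ G.neighborFinset x, (u y - markov G u x) ^ 2 =
      u x ^ 2 + ∑ y ∈ G.neighborFinset x, u y ^ 2 -
        ((G.degree x : ℝ) + 1) * (markov G u x * markov G u x) := by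
  have hmean := degree_add_one_mul_markov (G := G) u x
  set μ := markov G u x
  have hexpand : ∀ y, (u y - μ) ^ 2 = u y ^ 2 - 2 * μ * u y + μ ^ 2 := fun y => by ring
  simp only [hexpand, Finset.sum_add_distrib, Finset.sum_sub_distrib, ← Finset.mul_sum,
    Finset.sum_const, SimpleGraph.card_neighborFinset_eq_degree, nsmul_eq_mul]
  linear_combination 2 * μ * hmean

theorem SupportNbhdSubset.walkInner_self_eq {u : V → ℝ} {T : Finset V}
    (h : SupportNbhdSubset G u T) :
    walkInner G T u u = ∑ x ∈ T, (u x ^ 2 + ∑ y ∈ G.neighborFinset x, u y ^ 2) := by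
  rw [Finset.sum_add_distrib, h.sum_neighbor_comp (φ := (· ^ 2)) (by norm_num), walkInner,
    ← Finset.sum_add_distrib]
  exact Finset.sum_congr rfl fun x _ => by ring

theorem sum_neighbor_sq_sub_le {D : ℕ} (hD1 : 1 ≤ D) {x : V} (hD : G.degree x ≤ D) (u : V → ℝ)
    (μ : ℝ) :
    ∑ y ∈ G.neighborFinset x, (u x - u y) ^ 2 ≤
      2 * D * ((u x - μ) ^ 2 + ∑ y ∈ G.neighborFinset x, (u y - μ) ^ 2) := by
  have hdeg : (G.degree x : ℝ) ≤ D := mod_cast hD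
  have hD1' : (1 : ℝ) ≤ D := mod_cast hD1
  have hsum : 0 ≤ ∑ y ∈ G.neighborFinset x, (u y - μ) ^ 2 :=
    Finset.sum_nonneg fun y _ => sq_nonneg _
  calc ∑ y ∈ G.neighborFinset x, (u x - u y) ^ 2
      ≤ ∑ y ∈ G.neighborFinset x, (2 * (u x - μ) ^ 2 + 2 * (u y - μ) ^ 2) :=
        Finset.sum_le_sum fun y _ => by nlinarith [sq_nonneg (u x - μ + (u y - μ))]
    _ = 2 * ((G.degree x : ℝ) * (u x - μ) ^ 2) + 2 * ∑ y ∈ G.neighborFinset x, (u y - μ) ^ 2 := by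
        rw [Finset.sum_add_distrib, Finset.sum_const, G.card_neighborFinset_eq_degree,
          nsmul_eq_mul, Finset.mul_sum]
        ring
    _ ≤ 2 * D * ((u x - μ) ^ 2 + ∑ y ∈ G.neighborFinset x, (u y - μ) ^ 2) := by
        nlinarith [mul_le_mul_of_nonneg_right hdeg (sq_nonneg (u x - μ)),
          mul_le_mul_of_nonneg_right hD1' hsum]

theorem SupportNbhdSubset.dirichletEnergy_le {D : ℕ} (hD : ∀ x, G.degree x ≤ D) (hD1 : 1 ≤ D)
    {T : Finset V} {u : V → ℝ} (h : SupportNbhdSubset G u T) :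
    dirichletEnergy G T u ≤
      2 * D * (walkInner G T u u - walkInner G T (markov G u) (markov G u)) := by
  rw [h.walkInner_self_eq, walkInner, ← Finset.sum_sub_distrib, Finset.mul_sum]
  simp only [← add_sum_sq_sub_markov]
  exact Finset.sum_le_sum fun x _ => sum_neighbor_sq_sub_le hD1 (hD x) u _

theorem SupportNbhdSubset.walkInner_markov_self_le {D : ℕ} (hD : ∀ x, G.degree x ≤ D)
    (hD1 : 1 ≤ D) {T : Finset V} {u : V → ℝ} (h : SupportNbhdSubset G u T) :
    walkInner G T (markov G u) (markov G u) ≤ walkInner G T u u := by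
  have hD0 : (0 : ℝ) < 2 * D := by positivity
  exact sub_nonneg.1 (nonneg_of_mul_nonneg_right
    ((dirichletEnergy_nonneg T u).trans (h.dirichletEnergy_le hD hD1)) hD0)

end Markov

section IsoperimetryAndDecay

variable {V : Type} {G : SimpleGraph V} [G.LocallyFinite]

theorem valency_eq_degree (x : V) : valency G x = G.degree x := by
  rw [valency, Set.ncard_eq_toFinset_card', ← SimpleGraph.card_neighborFinset_eq_degree]
  rfl

theorem transProb_eq_heat (n : ℕ) (x y : V) : transProb G n x y = heat G y n x := by
  classical
  induction n generalizing x with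
  | zero => simp [transProb, heat, Pi.single_apply]
  | succ n ih =>
    rw [heat_succ, transProb, tsum_eq_sum (s := insert x (G.neighborFinset x)),
      Finset.sum_insert (G.notMem_neighborFinset_self x), markov, add_div, Finset.sum_div]
    · congr 1
      · rw [walkStep, if_pos (.inl rfl), ih, valency_eq_degree, one_div_mul_eq_div]
      · refine Finset.sum_congr rfl fun z hz => ?_
        rw [walkStep, if_pos (.inr ((G.mem_neighborFinset _ _).1 hz)), ih, valency_eq_degree,
          one_div_mul_eq_div]
    · intro z hz
      simp only [Finset.mem_insert, SimpleGraph.mem_neighborFinset, not_or] at hz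
      rw [walkStep, if_neg (not_or.2 ⟨Ne.symm hz.1, hz.2⟩), zero_mul]

open Classical in
theorem ncard_edgeBoundary_eq_sum (U : Finset V) :
    (edgeBoundary G U).ncard = ∑ x ∈ U, ((G.neighborFinset x).filter (· ∉ U)).card := by
  have himage : edgeBoundary G U =
      ((U.sigma fun x => (G.neighborFinset x).filter (· ∉ U)).image fun p => (p.1, p.2) :) := by
    ext ⟨x, y⟩
    simp only [edgeBoundary, Set.mem_ofPred_eq, Finset.coe_image, Set.mem_image, Finset.mem_coe,
      Finset.mem_sigma, Finset.mem_filter, SimpleGraph.mem_neighborFinset, Sigma.exists,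
      Prod.mk.injEq, exists_eq_right_right, exists_eq_right]
    tauto
  rw [himage, Set.ncard_coe_finset, Finset.card_image_of_injective, Finset.card_sigma]
  rintro ⟨a, b⟩ ⟨c, d⟩ h
  simp_all

theorem sum_neighbor_posPart_sub_eq {S : Finset V} {g : V → ℝ} {c : ℝ} (hc : 0 ≤ c)
    (hcg : ∀ x ∈ S, c ≤ g x) (hgS : ∀ x ∉ S, g x = 0) :
    ∑ x ∈ S, ∑ y ∈ G.neighborFinset x, max (g x - g y) 0 =
      ∑ x ∈ S, ∑ y ∈ G.neighborFinset x, max (max (g x - c) 0 - max (g y - c) 0) 0 +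
        (edgeBoundary G S).ncard * c := by
  classical
  simp only [ncard_edgeBoundary_eq_sum, Finset.card_filter]
  push_cast
  simp only [Finset.sum_mul, ← Finset.sum_add_distrib]
  refine Finset.sum_congr rfl fun x hx => Finset.sum_congr rfl fun y _ => ?_
  have hgx := hcg x hx
  rw [max_eq_left (sub_nonneg.2 hgx)]
  by_cases hy : y ∈ S
  · simp [hy, max_eq_left (sub_nonneg.2 (hcg y hy))]
  · simp [hy, hgS y hy, hc, hgx, hc.trans hgx]

/-- Induction on the number of level sets: the boundary of `{g > 0}` accounts for the change of both
sides when the least positive value of `g` is subtracted. -/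
theorem sum_le_mul_sum_posPart_of_isoperimetry (K : ℝ) (S : Finset V) (g : V → ℝ)
    (hS : ∀ U ⊆ S, (U.card : ℝ) ≤ K * (edgeBoundary G U).ncard) (hg : ∀ x, 0 ≤ g x)
    (hgS : ∀ x ∉ S, g x = 0) :
    ∑ x ∈ S, g x ≤ K * ∑ x ∈ S, ∑ y ∈ G.neighborFinset x, max (g x - g y) 0 := by
  classical
  induction S using Finset.strongInduction generalizing g with
  | H S ih =>
    rcases S.eq_empty_or_nonempty with rfl | hne
    · simp only [Finset.sum_empty, mul_zero, le_refl]
    obtain ⟨x₀, hx₀, hmin⟩ := S.exists_min_image g hne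
    set g' : V → ℝ := fun x => max (g x - g x₀) 0 with hg'
    have hg'x₀ : g' x₀ = 0 := by simp [hg']
    have hg'0 : ∀ x, 0 ≤ g' x := fun x => le_max_right _ _
    have hg'S : ∀ x ∉ S.erase x₀, g' x = 0 := fun x hx => by
      by_cases hxx : x = x₀
      · rw [hxx, hg'x₀]
      · have hxS : x ∉ S := fun h => hx (Finset.mem_erase.2 ⟨hxx, h⟩)
        exact max_eq_right (by linarith [hgS x hxS, hg x₀])
    have hih := ih (S.erase x₀) (Finset.erase_ssubset hx₀) g'
      (fun U hU => hS U (hU.trans (Finset.erase_subset _ _))) hg'0 hg'S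
    have hx₀sum : ∑ y ∈ G.neighborFinset x₀, max (g' x₀ - g' y) 0 = 0 :=
      Finset.sum_eq_zero fun y _ => max_eq_right (by rw [hg'x₀]; linarith [hg'0 y])
    rw [Finset.sum_erase S hg'x₀, Finset.sum_erase S hx₀sum] at hih
    have hsum : ∑ x ∈ S, g x = ∑ x ∈ S, g' x + S.card * g x₀ := by
      rw [← nsmul_eq_mul, ← Finset.sum_const, ← Finset.sum_add_distrib]
      exact Finset.sum_congr rfl fun x hx => by
        simp only [hg', max_eq_left (sub_nonneg.2 (hmin x hx)), sub_add_cancel]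
    rw [hsum, sum_neighbor_posPart_sub_eq (hg x₀) hmin hgS, mul_add, ← mul_assoc]
    exact add_le_add hih (mul_le_mul_of_nonneg_right (hS S subset_rfl) (hg x₀))

theorem SupportNbhdSubset.sum_neighbor_add_sq_le {D : ℕ} (hD : ∀ x, G.degree x ≤ D)
    {T : Finset V} {v : V → ℝ} (hv : SupportNbhdSubset G v T) :
    ∑ x ∈ T, ∑ y ∈ G.neighborFinset x, (v x + v y) ^ 2 ≤ 4 * D * ∑ x ∈ T, v x ^ 2 :=
  calc ∑ x ∈ T, ∑ y ∈ G.neighborFinset x, (v x + v y) ^ 2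
      ≤ ∑ x ∈ T, ∑ y ∈ G.neighborFinset x, (2 * v x ^ 2 + 2 * v y ^ 2) :=
        Finset.sum_le_sum fun x _ => Finset.sum_le_sum fun y _ => by
          nlinarith [sq_nonneg (v x - v y)]
    _ = 4 * ∑ x ∈ T, (G.degree x : ℝ) * v x ^ 2 := by
        have hswap := hv.sum_neighbor_comp (φ := (· ^ 2)) (zero_pow two_ne_zero)
        simp only [Finset.sum_add_distrib, ← Finset.mul_sum, hswap, Finset.sum_const,
          SimpleGraph.card_neighborFinset_eq_degree, nsmul_eq_mul]
        ring
    _ ≤ 4 * ∑ x ∈ T, (D : ℝ) * v x ^ 2 := by gcongr; exact hD _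
    _ = 4 * D * ∑ x ∈ T, v x ^ 2 := by rw [← Finset.mul_sum, mul_assoc]

theorem SupportNbhdSubset.sum_neighbor_posPart_sq_le {D : ℕ} (hD : ∀ x, G.degree x ≤ D)
    {T : Finset V} {v : V → ℝ} (hv0 : ∀ x, 0 ≤ v x) (hv : SupportNbhdSubset G v T) :
    (∑ x ∈ T, ∑ y ∈ G.neighborFinset x, max (v x ^ 2 - v y ^ 2) 0) ^ 2 ≤
      dirichletEnergy G T v * (4 * D * ∑ x ∈ T, v x ^ 2) := by
  have hfactor : ∀ x y, max (v x ^ 2 - v y ^ 2) 0 ≤ |v x - v y| * (v x + v y) := fun x y => by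
    have hsum := add_nonneg (hv0 x) (hv0 y)
    refine max_le ?_ (mul_nonneg (abs_nonneg _) hsum)
    rw [sq_sub_sq, mul_comm]
    exact mul_le_mul_of_nonneg_right (le_abs_self _) hsum
  calc (∑ x ∈ T, ∑ y ∈ G.neighborFinset x, max (v x ^ 2 - v y ^ 2) 0) ^ 2
      ≤ (∑ x ∈ T, ∑ y ∈ G.neighborFinset x, |v x - v y| * (v x + v y)) ^ 2 :=
        pow_le_pow_left₀ (Finset.sum_nonneg fun _ _ => Finset.sum_nonneg fun _ _ =>
          le_max_right _ _) (Finset.sum_le_sum fun x _ => Finset.sum_le_sum fun y _ =>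
          hfactor x y) 2
    _ ≤ dirichletEnergy G T v * ∑ x ∈ T, ∑ y ∈ G.neighborFinset x, (v x + v y) ^ 2 := by
        have hcs := Finset.sum_mul_sq_le_sq_mul_sq (T.sigma fun x => G.neighborFinset x)
          (fun p => |v p.1 - v p.2|) (fun p => v p.1 + v p.2)
        simpa only [Finset.sum_sigma, sq_abs, dirichletEnergy] using hcs
    _ ≤ dirichletEnergy G T v * (4 * D * ∑ x ∈ T, v x ^ 2) :=
        mul_le_mul_of_nonneg_left (hv.sum_neighbor_add_sq_le hD) (dirichletEnergy_nonneg T v)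

theorem SupportNbhdSubset.cheeger_inequality {D : ℕ} (hD : ∀ x, G.degree x ≤ D) {K : ℝ}
    (hK : 0 ≤ K) {S T : Finset V} (hST : S ⊆ T)
    (hS : ∀ U ⊆ S, (U.card : ℝ) ≤ K * (edgeBoundary G U).ncard) {v : V → ℝ}
    (hv0 : ∀ x, 0 ≤ v x) (hvS : ∀ x ∉ S, v x = 0) (hv : SupportNbhdSubset G v T) :
    ∑ x ∈ T, v x ^ 2 ≤ 4 * D * K ^ 2 * dirichletEnergy G T v := by
  set N := ∑ x ∈ T, v x ^ 2
  set X := ∑ x ∈ T, ∑ y ∈ G.neighborFinset x, max (v x ^ 2 - v y ^ 2) 0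
  have hE0 : 0 ≤ dirichletEnergy G T v := dirichletEnergy_nonneg T v
  have hN0 : 0 ≤ N := Finset.sum_nonneg fun x _ => sq_nonneg _
  have hNX : N ≤ K * X :=
    calc N = ∑ x ∈ S, v x ^ 2 := (Finset.sum_subset hST fun x _ hx => by
          rw [hvS x hx, zero_pow two_ne_zero]).symm
      _ ≤ K * ∑ x ∈ S, ∑ y ∈ G.neighborFinset x, max (v x ^ 2 - v y ^ 2) 0 :=
          sum_le_mul_sum_posPart_of_isoperimetry K S _ hS (fun x => sq_nonneg _)
            fun x hx => by rw [hvS x hx, zero_pow two_ne_zero]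
      _ ≤ K * X := mul_le_mul_of_nonneg_left (Finset.sum_le_sum_of_subset_of_nonneg hST
          fun x _ _ => Finset.sum_nonneg fun y _ => le_max_right _ _) hK
  have hsq : N * N ≤ 4 * D * K ^ 2 * dirichletEnergy G T v * N :=
    calc N * N = N ^ 2 := (sq N).symm
      _ ≤ (K * X) ^ 2 := pow_le_pow_left₀ hN0 hNX 2
      _ = K ^ 2 * X ^ 2 := mul_pow K X 2
      _ ≤ K ^ 2 * (dirichletEnergy G T v * (4 * D * N)) :=
          mul_le_mul_of_nonneg_left (hv.sum_neighbor_posPart_sq_le hD hv0) (sq_nonneg K)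
      _ = 4 * D * K ^ 2 * dirichletEnergy G T v * N := by ring
  rcases hN0.eq_or_lt with hN | hN
  · rw [← hN]; positivity
  · exact le_of_mul_le_mul_right hsq hN

theorem dirichletEnergy_posPart_sub_le (T : Finset V) (u : V → ℝ) (t : ℝ) :
    dirichletEnergy G T (fun x => max (u x - t) 0) ≤ dirichletEnergy G T u :=
  Finset.sum_le_sum fun x _ => Finset.sum_le_sum fun y _ => by
    rw [sq_le_sq]
    exact (abs_max_sub_max_le_abs _ _ _).trans_eq (by rw [sub_sub_sub_cancel_right])

theorem walkInner_self_le_posPart_sub {T : Finset V} {u : V → ℝ} (hu0 : ∀ x, 0 ≤ u x) (t : ℝ) :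
    walkInner G T u u ≤ walkInner G T (fun x => max (u x - t) 0) (fun x => max (u x - t) 0) +
      2 * t * walkInner G T 1 u := by
  simp only [walkInner, Finset.mul_sum, ← Finset.sum_add_distrib, Pi.one_apply, one_mul]
  refine Finset.sum_le_sum fun x _ => ?_
  have hpt : u x * u x ≤ max (u x - t) 0 * max (u x - t) 0 + 2 * t * u x := by
    rcases le_total (u x) t with h | h
    · rw [max_eq_right (sub_nonpos.2 h)]; nlinarith [hu0 x]
    · rw [max_eq_left (sub_nonneg.2 h)]; nlinarith [sq_nonneg t]
  have hdeg : (0 : ℝ) ≤ G.degree x + 1 := by positivity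
  linarith [mul_le_mul_of_nonneg_left hpt hdeg]

theorem walkInner_self_le_mul_sum_sq {D : ℕ} (hD : ∀ x, G.degree x ≤ D) (T : Finset V)
    (u : V → ℝ) : walkInner G T u u ≤ (D + 1) * ∑ x ∈ T, u x ^ 2 := by
  rw [walkInner, Finset.mul_sum]
  refine Finset.sum_le_sum fun x _ => ?_
  rw [← sq]
  gcongr
  exact hD x

open Classical in
theorem card_filter_lt_mul_le (T : Finset V) {u : V → ℝ} (hu0 : ∀ x, 0 ≤ u x) (t : ℝ) :
    (T.filter (t < u ·)).card * t ≤ walkInner G T 1 u := by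
  rw [← nsmul_eq_mul]
  calc (T.filter (t < u ·)).card • t
      ≤ ∑ x ∈ T.filter (t < u ·), u x :=
        Finset.card_nsmul_le_sum _ _ _ fun x hx => (Finset.mem_filter.1 hx).2.le
    _ ≤ ∑ x ∈ T, u x :=
        Finset.sum_le_sum_of_subset_of_nonneg (Finset.filter_subset _ _) fun x _ _ => hu0 x
    _ ≤ walkInner G T 1 u := Finset.sum_le_sum fun x _ => by
        rw [Pi.one_apply, one_mul, add_mul, one_mul]
        exact le_add_of_nonneg_left (mul_nonneg (Nat.cast_nonneg _) (hu0 x))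

/-- Truncating `u` at a quarter of the quotient of energy and mass keeps half of the energy, and
leaves a function supported in few vertices, to which Cheeger's inequality applies. -/
theorem SupportNbhdSubset.walkInner_self_le_dirichletEnergy {D : ℕ} (hD : ∀ x, G.degree x ≤ D)
    {K A : ℝ} (hK : 0 ≤ K)
    (hiso : ∀ U : Finset V, (U.card : ℝ) < A → (U.card : ℝ) ≤ K * (edgeBoundary G U).ncard)
    {T : Finset V} {u : V → ℝ} (hu0 : ∀ x, 0 ≤ u x) (hu : SupportNbhdSubset G u T)
    (hmass : 0 < walkInner G T 1 u)
    (hbig : 4 * walkInner G T 1 u ^ 2 < walkInner G T u u * A) :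
    walkInner G T u u ≤ 8 * D * (D + 1) * K ^ 2 * dirichletEnergy G T u := by
  classical
  set m := walkInner G T 1 u
  set E := walkInner G T u u
  have hE0 : 0 < E := (walkInner_self_nonneg T u).lt_of_ne fun h => by
    rw [show E = 0 from h.symm, zero_mul] at hbig
    linarith [pow_pos hmass 2]
  set t : ℝ := E / (4 * m) with ht
  have ht0 : 0 < t := by positivity
  set v : V → ℝ := fun x => max (u x - t) 0
  set S := T.filter (t < u ·)
  have hScard : (S.card : ℝ) < A := by
    have hSm : S.card * t ≤ m := card_filter_lt_mul_le T hu0 t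
    rw [ht, mul_div_assoc', div_le_iff₀ (by positivity)] at hSm
    exact lt_of_mul_lt_mul_left (by linarith) hE0.le
  have hvS : ∀ x ∉ S, v x = 0 := fun x hx => max_eq_right <| by
    by_contra! hlt
    exact hx (Finset.mem_filter.2 ⟨(hu x (by linarith)).1, by linarith⟩)
  have hcheeger := (hu.posPart_sub ht0.le).cheeger_inequality hD hK (Finset.filter_subset _ T)
    (fun U hU => hiso U (lt_of_le_of_lt (mod_cast Finset.card_le_card hU) hScard))
    (fun x => le_max_right _ _) hvS
  have hhalf : E / 2 ≤ walkInner G T v v := by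
    have htm : 2 * t * m = E / 2 := by rw [ht]; field_simp; norm_num
    linarith [walkInner_self_le_posPart_sub (G := G) (T := T) hu0 t]
  calc E = 2 * (E / 2) := by ring
    _ ≤ 2 * ((D + 1) * ∑ x ∈ T, v x ^ 2) := by
        gcongr
        exact hhalf.trans (walkInner_self_le_mul_sum_sq hD T v)
    _ ≤ 2 * ((D + 1) * (4 * D * K ^ 2 * dirichletEnergy G T u)) := by
        gcongr
        exact hcheeger.trans (mul_le_mul_of_nonneg_left
          (dirichletEnergy_posPart_sub_le T u t) (by positivity))
    _ = 8 * D * (D + 1) * K ^ 2 * dirichletEnergy G T u := by ring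

theorem SupportNbhdSubset.walkInner_markov_self_le_of_isoperimetry {D : ℕ}
    (hD : ∀ x, G.degree x ≤ D) (hD1 : 1 ≤ D) {K A : ℝ} (hK : 0 < K)
    (hiso : ∀ U : Finset V, (U.card : ℝ) < A → (U.card : ℝ) ≤ K * (edgeBoundary G U).ncard)
    {T : Finset V} {u : V → ℝ} (hu0 : ∀ x, 0 ≤ u x) (hu : SupportNbhdSubset G u T)
    (hmass : 0 < walkInner G T 1 u)
    (hbig : 4 * walkInner G T 1 u ^ 2 < walkInner G T u u * A) :
    walkInner G T (markov G u) (markov G u) ≤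
      (1 - 1 / (16 * D ^ 2 * (D + 1) * K ^ 2)) * walkInner G T u u := by
  have hE := hu.walkInner_self_le_dirichletEnergy hD hK.le hiso hu0 hmass hbig
  have hdiss := hu.dirichletEnergy_le hD hD1
  have hpos : (0 : ℝ) < 16 * D ^ 2 * (D + 1) * K ^ 2 := by positivity
  have hgap : walkInner G T u u ≤ 16 * D ^ 2 * (D + 1) * K ^ 2 *
      (walkInner G T u u - walkInner G T (markov G u) (markov G u)) :=
    calc walkInner G T u u ≤ 8 * D * (D + 1) * K ^ 2 * dirichletEnergy G T u := hE
      _ ≤ 8 * D * (D + 1) * K ^ 2 *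
          (2 * D * (walkInner G T u u - walkInner G T (markov G u) (markov G u))) := by gcongr
      _ = _ := by ring
  have hquot := (div_le_iff₀' hpos).2 hgap
  rw [sub_mul, one_mul, one_div_mul_eq_div]
  linarith

theorem walkInner_heat_self_le_of_isoperimetry {D : ℕ} (hD : ∀ x, G.degree x ≤ D) (hD1 : 1 ≤ D)
    {K A : ℝ} (hK : 0 < K) (hA : 0 < A)
    (hiso : ∀ U : Finset V, (U.card : ℝ) < A → (U.card : ℝ) ≤ K * (edgeBoundary G U).ncard)
    {x₀ : V} {N : ℕ} {T : Finset V} (hx₀ : x₀ ∈ T)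
    (hT : ∀ n ≤ N, SupportNbhdSubset G (heat G x₀ n) T) {n : ℕ} (hn : n ≤ N) :
    walkInner G T (heat G x₀ n) (heat G x₀ n) ≤ max (4 * (D + 1) ^ 2 / A)
      ((D + 1) * Real.exp (-(n / (16 * D ^ 2 * (D + 1) * K ^ 2)))) := by
  have hm₀ : (G.degree x₀ : ℝ) + 1 ≤ D + 1 := by gcongr; exact hD x₀
  induction n with
  | zero =>
    rw [walkInner_heat_zero_right hx₀, heat_zero_self, mul_one, Nat.cast_zero, zero_div, neg_zero,
      Real.exp_zero, mul_one]
    exact le_max_of_le_right hm₀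
  | succ n ih =>
    have hTn := hT n (by omega)
    rw [heat_succ]
    rcases le_or_gt (walkInner G T (heat G x₀ n) (heat G x₀ n)) (4 * (D + 1) ^ 2 / A) with h | h
    · exact le_max_of_le_left ((hTn.walkInner_markov_self_le hD hD1).trans h)
    have hmass : walkInner G T 1 (heat G x₀ n) = G.degree x₀ + 1 :=
      walkInner_one_heat hx₀ hT (by omega)
    have hstep := hTn.walkInner_markov_self_le_of_isoperimetry hD hD1 hK hiso (heat_nonneg x₀ n)
      (by rw [hmass]; positivity)
      (((div_lt_iff₀ hA).1 h).trans_le' (by rw [hmass]; gcongr))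
    have hprev := (le_max_iff.1 (ih (by omega))).resolve_left (not_le.2 h)
    set c : ℝ := 16 * D ^ 2 * (D + 1) * K ^ 2
    refine le_max_of_le_right (hstep.trans ?_)
    calc (1 - 1 / c) * walkInner G T (heat G x₀ n) (heat G x₀ n)
        ≤ Real.exp (-(1 / c)) * ((D + 1) * Real.exp (-(n / c))) :=
          mul_le_mul (Real.one_sub_le_exp_neg _) hprev (walkInner_self_nonneg T _) (by positivity)
      _ = (D + 1) * Real.exp (-((n + 1 : ℕ) / c)) := by
          rw [mul_left_comm, ← Real.exp_add]
          congr 2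
          push_cast
          ring

theorem heat_self_le_walkInner_half {D : ℕ} (hD : ∀ x, G.degree x ≤ D) (hD1 : 1 ≤ D) {x₀ : V}
    {n : ℕ} {T : Finset V} (hx₀ : x₀ ∈ T) (hT : ∀ j ≤ n, SupportNbhdSubset G (heat G x₀ j) T) :
    heat G x₀ n x₀ ≤ walkInner G T (heat G x₀ (n / 2)) (heat G x₀ (n / 2)) := by
  have hmono := (hT (n / 2) (by omega)).walkInner_markov_self_le hD hD1
  rw [← heat_succ] at hmono
  calc heat G x₀ n x₀ ≤ ((G.degree x₀ : ℝ) + 1) * heat G x₀ n x₀ :=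
        le_mul_of_one_le_left (heat_nonneg _ _ _) (le_add_of_nonneg_left (Nat.cast_nonneg _))
    _ ≤ walkInner G T (heat G x₀ (n / 2)) (heat G x₀ (n / 2)) := by
        rcases Nat.even_or_odd' n with ⟨j, rfl | rfl⟩
        · rw [Nat.mul_div_cancel_left j two_pos, walkInner_heat_heat hx₀ hT j j (by omega), two_mul]
        · rw [show (2 * j + 1) / 2 = j by omega] at hmono ⊢
          rw [show 2 * j + 1 = j + (j + 1) by omega,
            ← walkInner_heat_heat hx₀ hT j (j + 1) (by omega)]
          linarith [two_mul_walkInner_le (G := G) T (heat G x₀ j) (heat G x₀ (j + 1))]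

theorem heat_self_le_of_isoperimetry {D : ℕ} (hD : ∀ x, G.degree x ≤ D) (hD1 : 1 ≤ D) {K A : ℝ}
    (hK : 1 ≤ K) (hA : 0 < A)
    (hiso : ∀ U : Finset V, (U.card : ℝ) < A → (U.card : ℝ) ≤ K * (edgeBoundary G U).ncard)
    (x₀ : V) (n : ℕ) :
    heat G x₀ n x₀ ≤ max (4 * (D + 1) ^ 2 / A)
      ((D + 1) * Real.exp (1 - n / (32 * D ^ 2 * (D + 1) * K ^ 2))) := by
  obtain ⟨T, hx₀, hT⟩ := exists_supportNbhdSubset_heat (G := G) x₀ n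
  refine (heat_self_le_walkInner_half hD hD1 hx₀ hT).trans <|
    (walkInner_heat_self_le_of_isoperimetry hD hD1 (by linarith) hA hiso hx₀ hT
      (Nat.div_le_self n 2)).trans ?_
  have hD1' : (1 : ℝ) ≤ D := mod_cast hD1
  have hc : 1 ≤ 16 * (D : ℝ) ^ 2 * (D + 1) * K ^ 2 := by
    have hprod : 1 * 1 ≤ 16 * (D : ℝ) ^ 2 * (D + 1) * K ^ 2 :=
      mul_le_mul (by nlinarith [one_le_pow₀ hD1' (n := 2)]) (one_le_pow₀ hK) zero_le_one
        (by positivity)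
    linarith
  have hfloor : (n : ℝ) ≤ 2 * ((n / 2 : ℕ) : ℝ) + 1 := by
    exact_mod_cast (by omega : n ≤ 2 * (n / 2) + 1)
  rw [show 32 * (D : ℝ) ^ 2 * (D + 1) * K ^ 2 = 2 * (16 * (D : ℝ) ^ 2 * (D + 1) * K ^ 2) by ring]
  set c := 16 * (D : ℝ) ^ 2 * (D + 1) * K ^ 2
  have hexponent : -(((n / 2 : ℕ) : ℝ) / c) ≤ 1 - n / (2 * c) := by
    rw [neg_le_sub_iff_le_add, ← sub_le_iff_le_add', sub_le_iff_le_add,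
      div_add' _ _ _ (by positivity), div_le_div_iff₀ (by positivity) (by positivity)]
    nlinarith
  gcongr

end IsoperimetryAndDecay

section Asymptotics

theorem exists_nat_rpow_ge {β : ℝ} (hβ : 0 < β) (c : ℝ) : ∃ M : ℕ, 0 < M ∧ c ≤ (M : ℝ) ^ β := by
  have h := ((tendsto_rpow_atTop hβ).comp tendsto_natCast_atTop_atTop).eventually_ge_atTop c
  obtain ⟨M, hle, hpos⟩ := (h.and (Filter.eventually_gt_atTop 0)).exists
  exact ⟨M, hpos, hle⟩

theorem dominated_exp_rpow {β : ℝ} (hβ : 0 < β) {a : ℕ → ℝ} {C c : ℝ} (hC : 0 < C)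
    (h : ∀ k : ℕ, a k ≤ C * Real.exp (c * (k : ℝ) ^ β)) :
    Dominated a fun k => Real.exp ((k : ℝ) ^ β) := by
  obtain ⟨M, hM, hcM⟩ := exists_nat_rpow_ge hβ c
  refine ⟨C, hC, M, mod_cast hM, fun k => (h k).trans ?_⟩
  beta_reduce
  rw [← Nat.cast_mul, Nat.floor_natCast, Nat.cast_mul,
    Real.mul_rpow (Nat.cast_nonneg _) (Nat.cast_nonneg _)]
  gcongr

theorem exp_rpow_dominated {β : ℝ} (hβ : 0 < β) {a : ℕ → ℝ} {C c : ℝ} (hC : 0 < C) (hc : 0 < c)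
    (h : ∀ k : ℕ, C * Real.exp (c * (k : ℝ) ^ β) ≤ a k) :
    Dominated (fun k => Real.exp ((k : ℝ) ^ β)) a := by
  obtain ⟨M, hM, hcM⟩ := exists_nat_rpow_ge hβ (1 / c)
  refine ⟨1 / C, by positivity, M, mod_cast hM, fun k => ?_⟩
  beta_reduce
  rw [← Nat.cast_mul, Nat.floor_natCast, one_div_mul_eq_div, le_div_iff₀' hC]
  refine le_trans ?_ (h (M * k))
  rw [Nat.cast_mul, Real.mul_rpow (Nat.cast_nonneg _) (Nat.cast_nonneg _), ← mul_assoc]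
  gcongr
  exact le_mul_of_one_le_left (by positivity) ((div_le_iff₀' hc).1 hcM)

theorem dominated_exp_neg_rpow {α : ℝ} (hα : 0 < α) {a : ℕ → ℝ} {C c : ℝ} (hC : 0 < C)
    (hc : 0 < c) (h : ∀ n : ℕ, a n ≤ C * Real.exp (-(c * (n : ℝ) ^ α))) :
    Dominated a fun n => Real.exp (-((n : ℝ) ^ α)) := by
  refine ⟨C, hC, c ^ (1 / α), by positivity, fun n => (h n).trans ?_⟩
  beta_reduce
  gcongr
  calc ((⌊c ^ (1 / α) * (n : ℝ)⌋₊ : ℕ) : ℝ) ^ α ≤ (c ^ (1 / α) * (n : ℝ)) ^ α := by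
        gcongr
        exact Nat.floor_le (by positivity)
    _ = c * (n : ℝ) ^ α := by
        rw [Real.mul_rpow (by positivity) (by positivity), ← Real.rpow_mul hc.le,
          one_div_mul_cancel hα.ne', Real.rpow_one]

theorem exp_neg_rpow_dominated {α : ℝ} (hα : 0 < α) {a : ℕ → ℝ} {C c : ℝ} (hC : 0 < C)
    (hc : 0 < c) (h : ∀ n : ℕ, C * Real.exp (-(c * (n : ℝ) ^ α)) ≤ a n) :
    Dominated (fun n => Real.exp (-((n : ℝ) ^ α))) a := by
  refine ⟨1 / C, by positivity, (1 / c) ^ (1 / α), by positivity, fun n => ?_⟩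
  rw [one_div_mul_eq_div, le_div_iff₀' hC]
  refine le_trans ?_ (h _)
  beta_reduce
  gcongr
  calc c * ((⌊(1 / c) ^ (1 / α) * (n : ℝ)⌋₊ : ℕ) : ℝ) ^ α
      ≤ c * ((1 / c) ^ (1 / α) * (n : ℝ)) ^ α := by
        gcongr
        exact Nat.floor_le (by positivity)
    _ = (n : ℝ) ^ α := by
        rw [Real.mul_rpow (by positivity) (by positivity), ← Real.rpow_mul (by positivity),
          one_div_mul_cancel hα.ne', Real.rpow_one, ← mul_assoc, mul_one_div_cancel hc.ne', one_mul]

/-- Both bounds on the return probability balance the number `exp (k ^ β)` of vertices of a set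
against the time `k ^ 2` to leave it: `n / k ^ 2` is of the order of `k ^ β`. -/
theorem exists_balanced_scale {β : ℝ} (hβ : 0 < β) {n : ℕ} (hn : 0 < n) :
    ∃ k : ℕ, 1 ≤ k ∧ (n : ℝ) ^ (β / (β + 2)) ≤ (k : ℝ) ^ β ∧
      (k : ℝ) ^ β ≤ 2 ^ β * (n : ℝ) ^ (β / (β + 2)) ∧
      n ≤ (k : ℝ) ^ 2 * (n : ℝ) ^ (β / (β + 2)) ∧
      (k : ℝ) ^ 2 * (n : ℝ) ^ (β / (β + 2)) ≤ 4 * n := by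
  set s : ℝ := (n : ℝ) ^ (1 / (β + 2))
  have hs : 1 ≤ s := Real.one_le_rpow (mod_cast hn) (by positivity)
  have hsβ : (n : ℝ) ^ (β / (β + 2)) = s ^ β := by
    rw [← Real.rpow_mul (Nat.cast_nonneg n), one_div_mul_eq_div]
  have hsn : (n : ℝ) = s ^ 2 * s ^ β := by
    rw [← Real.rpow_natCast, ← Real.rpow_add (by positivity),
      ← Real.rpow_mul (Nat.cast_nonneg n), Nat.cast_ofNat, add_comm (2 : ℝ),
      one_div_mul_cancel (by positivity), Real.rpow_one]
  have hsk : s ≤ ⌈s⌉₊ := Nat.le_ceil s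
  have hks : (⌈s⌉₊ : ℝ) ≤ 2 * s := by linarith [Nat.ceil_lt_add_one (zero_le_one.trans hs)]
  rw [hsβ]
  refine ⟨⌈s⌉₊, Nat.one_le_ceil_iff.2 (zero_lt_one.trans_le hs), by gcongr, ?_, ?_, ?_⟩
  · rw [← Real.mul_rpow two_pos.le (by positivity)]
    gcongr
  · rw [hsn]
    gcongr
  · rw [hsn]
    calc (⌈s⌉₊ : ℝ) ^ 2 * s ^ β ≤ (2 * s) ^ 2 * s ^ β := by gcongr
      _ = 4 * (s ^ 2 * s ^ β) := by ring

theorem heat_self_le_of_card_ge {V : Type} {G : SimpleGraph V} [G.LocallyFinite]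
    {D : ℕ} (hD : ∀ x, G.degree x ≤ D) (hD1 : 1 ≤ D) {β c : ℝ} (hc : 0 < c)
    (h : ∀ k : ℕ, ∀ U ∈ folnerSets G k, c * Real.exp (c * (k : ℝ) ^ β) ≤ U.card)
    {k : ℕ} (hk : 1 ≤ k) (x₀ : V) (n : ℕ) :
    heat G x₀ n x₀ ≤ max (4 * (D + 1) ^ 2 / c * Real.exp (-(c * (k : ℝ) ^ β)))
      ((D + 1) * Real.exp (1 - n / (32 * D ^ 2 * (D + 1) * (k : ℝ) ^ 2))) := by
  rw [Real.exp_neg, ← div_eq_mul_inv, div_div]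
  refine heat_self_le_of_isoperimetry hD hD1 (mod_cast hk) (by positivity) (fun U hU => ?_) x₀ n
  rcases U.eq_empty_or_nonempty with rfl | hne
  · simpa using mul_nonneg (Nat.cast_nonneg k) (Nat.cast_nonneg _)
  · by_contra! hcon
    exact hU.not_ge (h k U ⟨hne, mod_cast hcon.le⟩)

/-- The isoperimetric inequality equivalent to a lower bound `≽ exp (k ^ β)` on the Følner
function: the members of `folnerSets G k` have at least `c * exp (c * k ^ β)` elements. -/
def ExpIsoperimetry {V : Type} (G : SimpleGraph V) (β : ℝ) : Prop :=
  ∃ c : ℝ, 0 < c ∧ ∀ k : ℕ, ∀ U ∈ folnerSets G k, c * Real.exp (c * (k : ℝ) ^ β) ≤ U.card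

namespace ExpIsoperimetry

variable {V : Type} {G : SimpleGraph V} {β : ℝ}

theorem exp_rpow_dominated_folner (h : ExpIsoperimetry G β) (hβ : 0 < β)
    (hne : ∀ k, (folnerSets G k).Nonempty) :
    Dominated (fun k => Real.exp ((k : ℝ) ^ β)) fun k => (folner G k : ℝ) := by
  obtain ⟨c, hc, h⟩ := h
  refine exp_rpow_dominated hβ hc hc fun k => ?_
  obtain ⟨U, hU, hcard⟩ := Nat.sInf_mem ((hne k).image Finset.card)
  rw [folner, ← hcard]
  exact h k U hU

theorem transProb_dominated [G.LocallyFinite] {D : ℕ} (hD : ∀ x, G.degree x ≤ D) (hD1 : 1 ≤ D)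
    (h : ExpIsoperimetry G β) (hβ : 0 < β) (x₀ : V) :
    Dominated (fun n => transProb G n x₀ x₀)
      fun n => Real.exp (-((n : ℝ) ^ (β / (β + 2)))) := by
  obtain ⟨c, hc, h⟩ := h
  set d : ℝ := 32 * D ^ 2 * (D + 1)
  have hd : 0 < d := by positivity
  refine dominated_exp_neg_rpow (C := max (4 * (D + 1) ^ 2 / c) ((D + 1) * Real.exp 1))
    (c := min c (1 / (4 * d))) (by positivity) (lt_max_of_lt_right (by positivity))
    (by positivity) fun n => ?_
  rw [transProb_eq_heat]
  rcases Nat.eq_zero_or_pos n with rfl | hn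
  · rw [heat_zero_self, Nat.cast_zero, Real.zero_rpow (by positivity), mul_zero, neg_zero,
      Real.exp_zero, mul_one]
    exact le_max_of_le_right (one_le_mul_of_one_le_of_one_le
      (le_add_of_nonneg_left (Nat.cast_nonneg D)) (Real.one_le_exp zero_le_one))
  obtain ⟨k, hk, hkβ, -, -, hkn⟩ := exists_balanced_scale hβ hn
  refine (heat_self_le_of_card_ge hD hD1 hc h hk x₀ n).trans (max_le ?_ ?_)
  · gcongr
    · exact le_max_left _ _
    · exact min_le_left _ _
  · have hexponent : 1 / (4 * d) * (n : ℝ) ^ (β / (β + 2)) ≤ n / (d * (k : ℝ) ^ 2) := by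
      rw [one_div_mul_eq_div, div_le_div_iff₀ (by positivity) (by positivity)]
      linarith [mul_le_mul_of_nonneg_left hkn hd.le]
    rw [sub_eq_add_neg, Real.exp_add, ← mul_assoc]
    gcongr
    · exact le_max_right _ _
    · exact (mul_le_mul_of_nonneg_right (min_le_right _ _) (by positivity)).trans hexponent

end ExpIsoperimetry

end Asymptotics

section ReturnLowerBound

theorem walkInner_sq_le {V : Type*} {G : SimpleGraph V} [G.LocallyFinite] (T : Finset V)
    (f g : V → ℝ) : walkInner G T f g ^ 2 ≤ walkInner G T f f * walkInner G T g g :=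
  Finset.sum_sq_le_sum_mul_sum_of_sq_le_mul T
    (fun _ _ => mul_nonneg (by positivity) (mul_self_nonneg _))
    (fun _ _ => mul_nonneg (by positivity) (mul_self_nonneg _)) fun _ _ => le_of_eq (by ring)

theorem heat_self_div_le {V : Type*} {G : SimpleGraph V} [G.LocallyFinite] {D : ℕ} {x₀ : V}
    (hD : G.degree x₀ ≤ D) (n : ℕ) : heat G x₀ n x₀ / (D + 1) ≤ heat G x₀ (n + 1) x₀ := by
  have hsum : 0 ≤ ∑ y ∈ G.neighborFinset x₀, heat G x₀ n y :=
    Finset.sum_nonneg fun y _ => heat_nonneg x₀ n y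
  rw [heat_succ, markov]
  gcongr
  · exact add_nonneg (heat_nonneg _ _ _) hsum
  · exact le_add_of_nonneg_right hsum

variable {V : Type*} {G : SimpleGraph V} [G.LocallyFinite] {ψ : V → ℝ} {x₀ : V} {l : ℝ}

theorem pow_le_walkInner_heat (hl : 0 ≤ l) (hψ : ∀ x, l * ψ x ≤ markov G ψ x) (hψx₀ : ψ x₀ = 1)
    {N : ℕ} {T : Finset V} (hx₀ : x₀ ∈ T) (hT : ∀ n ≤ N, SupportNbhdSubset G (heat G x₀ n) T)
    (hψT : ∀ x ∉ T, ψ x = 0) {n : ℕ} (hn : n ≤ N) :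
    ((G.degree x₀ : ℝ) + 1) * l ^ n ≤ walkInner G T (heat G x₀ n) ψ := by
  induction n with
  | zero =>
    rw [walkInner, Finset.sum_eq_single_of_mem x₀ hx₀ fun x _ hx => by simp [heat_zero_of_ne hx],
      heat_zero_self, hψx₀, pow_zero, one_mul]
  | succ n ih =>
    rw [heat_succ, walkInner_markov_left (fun x => (hT n (by omega)).eq_zero) hψT]
    calc ((G.degree x₀ : ℝ) + 1) * l ^ (n + 1) = l * (((G.degree x₀ : ℝ) + 1) * l ^ n) := by ring
      _ ≤ l * walkInner G T (heat G x₀ n) ψ := mul_le_mul_of_nonneg_left (ih (by omega)) hl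
      _ ≤ walkInner G T (heat G x₀ n) (markov G ψ) := by
        rw [walkInner, walkInner, Finset.mul_sum]
        refine Finset.sum_le_sum fun x _ => ?_
        have hmass : 0 ≤ ((G.degree x : ℝ) + 1) * heat G x₀ n x :=
          mul_nonneg (by positivity) (heat_nonneg x₀ n x)
        linarith [mul_le_mul_of_nonneg_left (hψ x) hmass]

theorem walkInner_self_le_card {D : ℕ} (hD : ∀ x, G.degree x ≤ D) {T U : Finset V} (hUT : U ⊆ T)
    (hψU : ∀ x ∉ U, ψ x = 0) (hψ0 : ∀ x, 0 ≤ ψ x) (hψ1 : ∀ x, ψ x ≤ 1) :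
    walkInner G T ψ ψ ≤ (D + 1) * U.card := by
  rw [walkInner, ← Finset.sum_subset hUT fun x _ hx => by simp [hψU x hx], mul_comm,
    ← nsmul_eq_mul]
  refine Finset.sum_le_card_nsmul _ _ _ fun x _ => ?_
  have hDx : (G.degree x : ℝ) ≤ D := mod_cast hD x
  calc ((G.degree x : ℝ) + 1) * (ψ x * ψ x) ≤ (D + 1) * (1 * 1) := by
        gcongr
        · exact mul_self_nonneg _
        exacts [hψ0 x, hψ1 x, hψ1 x]
    _ = D + 1 := by ring

theorem pow_le_heat_two_mul_self {D : ℕ} (hD : ∀ x, G.degree x ≤ D) {U : Finset V} (hl : 0 ≤ l)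
    (hψ0 : ∀ x, 0 ≤ ψ x) (hψ1 : ∀ x, ψ x ≤ 1) (hψU : ∀ x ∉ U, ψ x = 0) (hψx₀ : ψ x₀ = 1)
    (hψ : ∀ x, l * ψ x ≤ markov G ψ x) (j : ℕ) :
    l ^ (2 * j) ≤ heat G x₀ (2 * j) x₀ * ((D + 1) * U.card) := by
  classical
  obtain ⟨S, hx₀S, hS⟩ := exists_supportNbhdSubset_heat (G := G) x₀ (2 * j)
  set T := S ∪ U
  have hx₀ : x₀ ∈ T := Finset.mem_union_left _ hx₀S
  have hT : ∀ n ≤ 2 * j, SupportNbhdSubset G (heat G x₀ n) T := fun n hn =>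
    (hS n hn).mono Finset.subset_union_left
  set m := (G.degree x₀ : ℝ) + 1
  have hm : 1 ≤ m := le_add_of_nonneg_left (Nat.cast_nonneg _)
  have hlow : m * l ^ j ≤ walkInner G T (heat G x₀ j) ψ :=
    pow_le_walkInner_heat hl hψ hψx₀ hx₀ hT
      (fun x hx => hψU x fun hxU => hx (Finset.mem_union_right _ hxU)) (by omega)
  have hsq : m * (m * l ^ (2 * j)) ≤ m * (heat G x₀ (2 * j) x₀ * ((D + 1) * U.card)) :=
    calc m * (m * l ^ (2 * j)) = (m * l ^ j) ^ 2 := by ring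
      _ ≤ walkInner G T (heat G x₀ j) ψ ^ 2 := by gcongr
      _ ≤ walkInner G T (heat G x₀ j) (heat G x₀ j) * walkInner G T ψ ψ := walkInner_sq_le T _ _
      _ ≤ m * heat G x₀ (2 * j) x₀ * ((D + 1) * U.card) := by
        rw [walkInner_heat_heat hx₀ hT j j (by omega), ← two_mul]
        exact mul_le_mul_of_nonneg_left
          (walkInner_self_le_card hD Finset.subset_union_right hψU hψ0 hψ1)
          (mul_nonneg (by positivity) (heat_nonneg _ _ _))
      _ = m * (heat G x₀ (2 * j) x₀ * ((D + 1) * U.card)) := mul_assoc _ _ _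
  exact (le_mul_of_one_le_left (by positivity) hm).trans
    (le_of_mul_le_mul_left hsq (zero_lt_one.trans_le hm))

theorem pow_div_le_heat_self {D : ℕ} (hD : ∀ x, G.degree x ≤ D) {U : Finset V} (hl0 : 0 ≤ l)
    (hl1 : l ≤ 1) (hψ0 : ∀ x, 0 ≤ ψ x) (hψ1 : ∀ x, ψ x ≤ 1) (hψU : ∀ x ∉ U, ψ x = 0)
    (hψx₀ : ψ x₀ = 1) (hψ : ∀ x, l * ψ x ≤ markov G ψ x) (n : ℕ) :
    l ^ n / ((D + 1) ^ 2 * U.card) ≤ heat G x₀ n x₀ := by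
  have hU : 0 < (U.card : ℝ) := by
    refine Nat.cast_pos.2 (Finset.card_pos.2 ⟨x₀, ?_⟩)
    by_contra hx₀
    exact one_ne_zero (hψx₀.symm.trans (hψU x₀ hx₀))
  have heven := pow_le_heat_two_mul_self hD hl0 hψ0 hψ1 hψU hψx₀ hψ
  rcases Nat.even_or_odd' n with ⟨j, rfl | rfl⟩
  · rw [div_le_iff₀ (by positivity)]
    refine (heven j).trans ?_
    gcongr
    · exact heat_nonneg _ _ _
    · exact le_self_pow₀ (by linarith [(Nat.cast_nonneg D : (0 : ℝ) ≤ D)]) two_ne_zero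
  · refine le_trans ?_ (heat_self_div_le (hD x₀) (2 * j))
    rw [div_le_div_iff₀ (by positivity) (by positivity)]
    calc l ^ (2 * j + 1) * (D + 1) ≤ l ^ (2 * j) * (D + 1) := by
          gcongr ?_ * _
          exact pow_le_pow_of_le_one hl0 hl1 (Nat.le_succ _)
      _ ≤ heat G x₀ (2 * j) x₀ * ((D + 1) * U.card) * (D + 1) := by
          gcongr
          exact heven j
      _ = heat G x₀ (2 * j) x₀ * ((D + 1) ^ 2 * U.card) := by ring

end ReturnLowerBound

section WreathTubes

theorem intGraph_adj (a b : ℤ) : intGraph.Adj a b ↔ b = a + 1 ∨ b = a - 1 := by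
  simp only [intGraph, SimpleGraph.circulantGraph, SimpleGraph.fromRel_adj, Set.mem_singleton_iff]
  omega

variable {L : Type} {W : L → Type} {o : ∀ z, W z}

/-- The generalized wreath product of `ℤ` by the fibres `B z` along `φ`. -/
abbrev intWreath (φ : ℤ → L) (B : ∀ z, SimpleGraph (W z)) (o : ∀ z, W z) :
    SimpleGraph (ℤ × LampConfig W o) :=
  generalizedWreath intGraph φ W B o

namespace LampConfig

theorem ext {f g : LampConfig W o} (h : ∀ x, f.1 x = g.1 x) : f = g :=
  Subtype.ext (funext h)

theorem finite_setOf_eq_rest [∀ z, Finite (W z)] (o : ∀ z, W z) (Λ : Finset L) :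
    {f : LampConfig W o | ∀ x ∉ Λ, f.1 x = o x}.Finite := by
  refine Set.Finite.of_finite_image (f := fun f (x : Λ) => f.1 x) (Set.toFinite _) ?_
  refine fun f hf g hg h => ext fun x => ?_
  by_cases hx : x ∈ Λ
  · exact congrFun h ⟨x, hx⟩
  · rw [hf x hx, hg x hx]

variable [DecidableEq L]

/-- The configuration `f` with the lamp `x` switched to the state `v`. -/
def switch (f : LampConfig W o) (x : L) (v : W x) : LampConfig W o :=
  ⟨Function.update f.1 x v, by
    refine (f.2.union (Set.finite_singleton x)).subset fun z hz => ?_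
    by_cases h : z = x
    · exact Or.inr h
    · left
      simpa [Function.update_of_ne h] using hz⟩

theorem switch_apply_same (f : LampConfig W o) (x : L) (v : W x) :
    (f.switch x v).1 x = v := by simp [switch]

theorem switch_apply_of_ne (f : LampConfig W o) {x y : L} (h : y ≠ x) (v : W x) :
    (f.switch x v).1 y = f.1 y := by simp [switch, h]

theorem switch_self (f : LampConfig W o) (x : L) : f.switch x (f.1 x) = f :=
  ext fun y => by simp [switch]

theorem switch_switch (f : LampConfig W o) (x : L) (v w : W x) :
    (f.switch x v).switch x w = f.switch x w :=
  ext fun y => by simp [switch]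

theorem eq_switch {f g : LampConfig W o} {x : L} (h : ∀ y, y ≠ x → f.1 y = g.1 y) :
    g = f.switch x (g.1 x) := ext fun y => by
  by_cases hy : y = x
  · subst hy
    rw [switch_apply_same]
  · rw [switch_apply_of_ne _ hy, h y hy]

end LampConfig

section Rest

variable [∀ z, Fintype (W z)]

/-- The configurations which are at rest off `Λ`. -/
noncomputable def restOff (o : ∀ z, W z) (Λ : Finset L) : Finset (LampConfig W o) :=
  (LampConfig.finite_setOf_eq_rest o Λ).toFinset

theorem mem_restOff {Λ : Finset L} {f : LampConfig W o} :
    f ∈ restOff o Λ ↔ ∀ x ∉ Λ, f.1 x = o x := by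
  simp [restOff]

theorem rest_mem_restOff (Λ : Finset L) : LampConfig.rest W o ∈ restOff o Λ :=
  mem_restOff.2 fun _ _ => rfl

theorem card_restOff_le (Λ : Finset L) :
    (restOff o Λ).card ≤ ∏ x ∈ Λ, Fintype.card (W x) := by
  classical
  rw [← Finset.prod_coe_sort Λ fun x => Fintype.card (W x), ← Fintype.card_pi, ← Finset.card_univ]
  refine Finset.card_le_card_of_injOn (fun f x => f.1 x) (fun _ _ => Finset.mem_univ _) ?_
  refine fun f hf g hg h => LampConfig.ext fun x => ?_
  by_cases hx : x ∈ Λ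
  · exact congrFun h ⟨x, hx⟩
  · rw [mem_restOff.1 hf x hx, mem_restOff.1 hg x hx]

end Rest

theorem intWreath_adj [DecidableEq L] {φ : ℤ → L} {B : ∀ z, SimpleGraph (W z)}
    (u v : ℤ × LampConfig W o) :
    (intWreath φ B o).Adj u v ↔
      (v = (u.1 + 1, u.2) ∨ v = (u.1 - 1, u.2)) ∨
      ∃ w, (B (φ u.1)).Adj (u.2.1 (φ u.1)) w ∧ v = (u.1, u.2.switch (φ u.1) w) := by
  obtain ⟨a, f⟩ := u
  obtain ⟨b, g⟩ := v
  simp only [generalizedWreath, intGraph_adj, Prod.mk.injEq]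
  refine or_congr ⟨?_, ?_⟩ ⟨?_, ?_⟩
  · rintro ⟨h | h, rfl⟩ <;> simp [h]
  · rintro (⟨h, rfl⟩ | ⟨h, rfl⟩) <;> simp [h]
  · rintro ⟨rfl, h, h'⟩
    exact ⟨_, h', rfl, LampConfig.eq_switch h⟩
  · rintro ⟨w, h, rfl, rfl⟩
    exact ⟨rfl, fun x hx => (LampConfig.switch_apply_of_ne _ hx _).symm, by
      rwa [LampConfig.switch_apply_same]⟩

theorem neighborSet_intWreath_subset [DecidableEq L] {φ : ℤ → L}
    {B : ∀ z, SimpleGraph (W z)} (u : ℤ × LampConfig W o) :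
    (intWreath φ B o).neighborSet u ⊆
      (fun w => (u.1, u.2.switch (φ u.1) w)) '' (B (φ u.1)).neighborSet (u.2.1 (φ u.1)) ∪
      {(u.1 + 1, u.2), (u.1 - 1, u.2)} := by
  intro v hv
  rcases (intWreath_adj u v).1 hv with h | ⟨w, h, rfl⟩
  · exact Or.inr h
  · exact Or.inl ⟨w, h, rfl⟩

theorem finite_neighborSet_intWreath {φ : ℤ → L} {B : ∀ z, SimpleGraph (W z)}
    [∀ z, Finite (W z)] (u : ℤ × LampConfig W o) :
    ((intWreath φ B o).neighborSet u).Finite := by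
  classical
  exact (((Set.toFinite _).image _).union (Set.toFinite _)).subset (neighborSet_intWreath_subset u)

theorem encard_neighborSet_intWreath_le {M : ℕ} {φ : ℤ → L}
    {B : ∀ z, SimpleGraph (W z)} [∀ z, Finite (W z)] (hM : ∀ z x, valency (B z) x ≤ M)
    (u : ℤ × LampConfig W o) :
    ((intWreath φ B o).neighborSet u).encard ≤ ((M + 2 : ℕ) : ℕ∞) := by
  classical
  refine (Set.encard_le_encard (neighborSet_intWreath_subset u)).trans
    ((Set.encard_union_le _ _).trans ?_)
  push_cast
  refine add_le_add ((Set.encard_image_le _ _).trans ?_) (Set.encard_insert_le _ _ |>.trans ?_)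
  · rw [← (Set.toFinite ((B (φ u.1)).neighborSet (u.2.1 (φ u.1)))).cast_ncard_eq]
    exact_mod_cast hM (φ u.1) (u.2.1 (φ u.1))
  · rw [Set.encard_singleton]
    norm_num

variable [DecidableEq L] [∀ z, Fintype (W z)] {φ : ℤ → L} {B : ∀ z, SimpleGraph (W z)}

theorem switch_mem_restOff {Λ : Finset L} {f : LampConfig W o} {x : L} (hx : x ∈ Λ) (v : W x) :
    f.switch x v ∈ restOff o Λ ↔ f ∈ restOff o Λ := by
  simp only [mem_restOff]
  exact forall₂_congr fun y hy => by
    rw [LampConfig.switch_apply_of_ne _ (ne_of_mem_of_not_mem hx hy).symm]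

/-- The positions in `[-m, m]` with all lamps visited from there in an arbitrary state. -/
noncomputable def tube (φ : ℤ → L) (o : ∀ z, W z) (m : ℕ) : Finset (ℤ × LampConfig W o) :=
  Finset.Icc (-m : ℤ) m ×ˢ restOff o ((Finset.Icc (-m : ℤ) m).image φ)

theorem mem_tube {m : ℕ} {a : ℤ} {f : LampConfig W o} :
    (a, f) ∈ tube φ o m ↔ (-(m : ℤ) ≤ a ∧ a ≤ m) ∧
      f ∈ restOff o ((Finset.Icc (-m : ℤ) m).image φ) := by
  rw [tube, Finset.mem_product, Finset.mem_Icc]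

theorem switch_mem_restOff_image_Icc {m : ℕ} {a : ℤ} {f : LampConfig W o}
    (h : (a, f) ∈ tube φ o m) (w : W (φ a)) :
    f.switch (φ a) w ∈ restOff o ((Finset.Icc (-m : ℤ) m).image φ) :=
  (switch_mem_restOff (Finset.mem_image_of_mem φ (Finset.mem_Icc.2 (mem_tube.1 h).1)) w).2
    (mem_tube.1 h).2

theorem tube_nonempty (m : ℕ) : (tube φ o m).Nonempty :=
  ⟨(0, LampConfig.rest W o), mem_tube.2 ⟨by simp, rest_mem_restOff _⟩⟩

theorem card_tube (m : ℕ) :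
    (tube φ o m).card = (2 * m + 1) * (restOff o ((Finset.Icc (-m : ℤ) m).image φ)).card := by
  rw [tube, Finset.card_product, Int.card_Icc]
  congr 1
  omega

theorem card_tube_le (m : ℕ) : ((tube φ o m).card : ℝ) ≤ (2 * m + 1) *
    ∏ x ∈ (Finset.Icc (-m : ℤ) m).image φ, (Fintype.card (W x) : ℝ) := by
  rw [card_tube]
  push_cast
  gcongr
  exact_mod_cast card_restOff_le _

theorem edgeBoundary_tube_subset (m : ℕ) :
    edgeBoundary (intWreath φ B o) (tube φ o m) ⊆
      (fun f => (((m : ℤ), f), ((m : ℤ) + 1, f))) ''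
        (restOff o ((Finset.Icc (-m : ℤ) m).image φ) : Set (LampConfig W o)) ∪
      (fun f => ((-(m : ℤ), f), (-(m : ℤ) - 1, f))) ''
        (restOff o ((Finset.Icc (-m : ℤ) m).image φ) : Set (LampConfig W o)) := by
  rintro ⟨⟨a, f⟩, v⟩ ⟨hadj, hu, hv⟩
  dsimp only at hadj hu hv
  obtain ⟨ha, hf⟩ := mem_tube.1 hu
  rcases (intWreath_adj _ _).1 hadj with (rfl | rfl) | ⟨w, -, rfl⟩
  · obtain rfl : a = m := by
      by_contra
      exact hv (mem_tube.2 ⟨⟨by omega, by omega⟩, hf⟩)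
    exact .inl ⟨f, hf, rfl⟩
  · obtain rfl : a = -m := by
      by_contra
      exact hv (mem_tube.2 ⟨⟨by omega, by omega⟩, hf⟩)
    exact .inr ⟨f, hf, rfl⟩
  · exact absurd (mem_tube.2 ⟨ha, switch_mem_restOff_image_Icc hu w⟩) hv

theorem tube_mem_folnerSets (k : ℕ) : tube φ o k ∈ folnerSets (intWreath φ B o) k := by
  refine ⟨tube_nonempty k, ?_⟩
  set R := restOff o ((Finset.Icc (-k : ℤ) k).image φ)
  have hboundary : (edgeBoundary (intWreath φ B o) (tube φ o k)).ncard ≤ R.card + R.card := by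
    refine (Set.ncard_le_ncard (edgeBoundary_tube_subset k) (Set.toFinite _)).trans
      ((Set.ncard_union_le _ _).trans ?_)
    gcongr <;> exact (Set.ncard_image_le (Set.toFinite _)).trans (Set.ncard_coe_finset R).le
  rw [card_tube]
  calc k * (edgeBoundary (intWreath φ B o) (tube φ o k)).ncard
      ≤ k * (R.card + R.card) := Nat.mul_le_mul_left _ hboundary
    _ ≤ (2 * k + 1) * R.card := by nlinarith

/-- The bound `≼ exp (m ^ β)` on the size of the tubes, expressed through the number of states of
the lamps which are visited from `[-m, m]`. -/
def TubeGrowth (φ : ℤ → L) (W : L → Type) [∀ z, Fintype (W z)] (β : ℝ) : Prop :=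
  ∃ C c : ℝ, 0 < C ∧ 0 < c ∧ ∀ m : ℕ, ((2 * m + 1) *
    ∏ x ∈ (Finset.Icc (-m : ℤ) m).image φ, (Fintype.card (W x) : ℝ)) ≤
      C * Real.exp (c * (m : ℝ) ^ β)

theorem TubeGrowth.folner_dominated {β : ℝ} (hβ : 0 < β) (h : TubeGrowth φ W β) :
    Dominated (fun k => (folner (intWreath φ B o) k : ℝ)) fun k => Real.exp ((k : ℝ) ^ β) := by
  obtain ⟨C, c, hC, -, h⟩ := h
  refine dominated_exp_rpow hβ hC fun k => le_trans ?_ ((card_tube_le (o := o) k).trans (h k))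
  exact_mod_cast Nat.sInf_le (Set.mem_image_of_mem Finset.card (tube_mem_folnerSets k))

end WreathTubes

section TubeGrowthCriterion

theorem le_factorial_mul_exp_rpow {β : ℝ} (hβ : 0 < β) {N : ℕ} (hN : 1 / β ≤ N) {x : ℝ}
    (hx : 1 ≤ x) : x ≤ N.factorial * Real.exp (x ^ β) := by
  have hx0 : 0 ≤ x := zero_le_one.trans hx
  have htaylor := Real.pow_div_factorial_le_exp (x ^ β) (by positivity) N
  rw [div_le_iff₀ (by positivity)] at htaylor
  calc x = (x ^ β) ^ (1 / β) := by
        rw [← Real.rpow_mul hx0, mul_one_div_cancel hβ.ne', Real.rpow_one]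
    _ ≤ (x ^ β) ^ (N : ℝ) := Real.rpow_le_rpow_of_exponent_le (Real.one_le_rpow hx hβ.le) hN
    _ = (x ^ β) ^ N := Real.rpow_natCast _ _
    _ ≤ N.factorial * Real.exp (x ^ β) := by linarith

theorem natCast_add_one_rpow_le {β : ℝ} (hβ : 0 ≤ β) (m : ℕ) :
    ((m : ℝ) + 1) ^ β ≤ 2 ^ β * (m : ℝ) ^ β + 2 ^ β := by
  rcases Nat.eq_zero_or_pos m with rfl | hm
  · rw [Nat.cast_zero, zero_add, Real.one_rpow]
    exact le_add_of_nonneg_of_le (by positivity) (Real.one_le_rpow one_le_two hβ)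
  · have hm1 : (1 : ℝ) ≤ m := mod_cast hm
    calc ((m : ℝ) + 1) ^ β ≤ (2 * m) ^ β := by gcongr; linarith
      _ = 2 ^ β * (m : ℝ) ^ β := Real.mul_rpow two_pos.le (by positivity)
      _ ≤ 2 ^ β * (m : ℝ) ^ β + 2 ^ β := le_add_of_nonneg_right (by positivity)

theorem tubeGrowth_of_prod_card_le {L : Type} [DecidableEq L] {W : L → Type}
    [∀ z, Fintype (W z)] {φ : ℤ → L} {β C : ℝ} (hβ : 0 < β) (hC : 0 < C)
    (h : ∀ m : ℕ, ∏ x ∈ (Finset.Icc (-m : ℤ) m).image φ, (Fintype.card (W x) : ℝ) ≤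
      Real.exp (C * ((m : ℝ) + 1) ^ β)) : TubeGrowth φ W β := by
  obtain ⟨N, hN⟩ := exists_nat_ge (1 / β)
  refine ⟨2 * N.factorial * Real.exp ((1 + C) * 2 ^ β), (1 + C) * 2 ^ β, by positivity,
    by positivity, fun m => ?_⟩
  set y : ℝ := ((m : ℝ) + 1) ^ β
  have hlength : (m : ℝ) + 1 ≤ N.factorial * Real.exp y :=
    le_factorial_mul_exp_rpow hβ hN (le_add_of_nonneg_left (Nat.cast_nonneg m))
  calc (2 * m + 1) * ∏ x ∈ (Finset.Icc (-m : ℤ) m).image φ, (Fintype.card (W x) : ℝ)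
      ≤ (2 * (N.factorial * Real.exp y)) * Real.exp (C * y) := by
        gcongr
        · linarith
        · exact h m
    _ = 2 * N.factorial * Real.exp ((1 + C) * y) := by
        rw [add_mul, Real.exp_add, one_mul]
        ring
    _ ≤ 2 * N.factorial * Real.exp ((1 + C) * (2 ^ β * (m : ℝ) ^ β + 2 ^ β)) := by
        gcongr
        exact natCast_add_one_rpow_le hβ.le m
    _ = 2 * N.factorial * Real.exp ((1 + C) * 2 ^ β) * Real.exp ((1 + C) * 2 ^ β * m ^ β) := by
        rw [mul_assoc _ (Real.exp _), ← Real.exp_add]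
        ring_nf

end TubeGrowthCriterion

section ReturnOnTubes

/-- The angle `π / (2 * (m + 1))`, chosen so that the cosine of `tubeAngle m * a` is positive on
`[-m, m]` and vanishes at `m + 1` and `-(m + 1)`. -/
noncomputable def tubeAngle (m : ℕ) : ℝ := Real.pi / (2 * (m + 1))

theorem tubeAngle_pos (m : ℕ) : 0 < tubeAngle m := div_pos Real.pi_pos (by positivity)

theorem tubeAngle_mul_add_one (m : ℕ) : tubeAngle m * (m + 1) = Real.pi / 2 := by
  rw [tubeAngle]
  field_simp

theorem tubeAngle_mul_add_one_sq_le (m : ℕ) : tubeAngle m ^ 2 * (m + 1) ^ 2 ≤ 5 / 2 := by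
  rw [← mul_pow, tubeAngle_mul_add_one]
  nlinarith [Real.pi_lt_d2, Real.pi_pos]

theorem cos_tubeAngle_mul_nonneg {m : ℕ} {a : ℤ} (ha : |a| ≤ m + 1) :
    0 ≤ Real.cos (tubeAngle m * a) := by
  have ha' : |(a : ℝ)| ≤ (m : ℝ) + 1 := mod_cast ha
  refine Real.cos_nonneg_of_mem_Icc (abs_le.1 ?_)
  rw [abs_mul, abs_of_pos (tubeAngle_pos m), ← tubeAngle_mul_add_one m]
  exact mul_le_mul_of_nonneg_left ha' (tubeAngle_pos m).le

theorem cos_tubeAngle_mul_eq_zero {m : ℕ} {a : ℤ} (ha : |a| = m + 1) :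
    Real.cos (tubeAngle m * a) = 0 := by
  have ha' : |(a : ℝ)| = (m : ℝ) + 1 := mod_cast ha
  rw [← Real.cos_abs, abs_mul, abs_of_pos (tubeAngle_pos m), ha', tubeAngle_mul_add_one,
    Real.cos_pi_div_two]

theorem exp_neg_four_mul_le_one_sub {t : ℝ} (ht0 : 0 ≤ t) (ht : t ≤ 3 / 4) :
    Real.exp (-(4 * t)) ≤ 1 - t := by
  have ht1 : 0 < 1 - t := by linarith
  rw [Real.exp_neg, inv_le_comm₀ (Real.exp_pos _) ht1]
  refine le_trans ?_ (Real.add_one_le_exp (4 * t))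
  rw [inv_le_iff_one_le_mul₀ ht1]
  nlinarith

variable {L : Type} [DecidableEq L] {W : L → Type} {o : ∀ z, W z} {φ : ℤ → L}
  {B : ∀ z, SimpleGraph (W z)} [∀ z, Fintype (W z)]

/-- The positive eigenfunction of the walk on the interval `[-m, m]` with killing at its ends,
lifted to the tube. -/
noncomputable def tubeCos (φ : ℤ → L) (o : ∀ z, W z) (m : ℕ) : ℤ × LampConfig W o → ℝ :=
  (tube φ o m : Set (ℤ × LampConfig W o)).indicator fun x => Real.cos (tubeAngle m * x.1)

theorem tubeCos_of_notMem {m : ℕ} {x : ℤ × LampConfig W o} (hx : x ∉ tube φ o m) :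
    tubeCos φ o m x = 0 :=
  Set.indicator_of_notMem (mt Finset.mem_coe.1 hx) _

theorem tubeCos_nonneg (m : ℕ) (x : ℤ × LampConfig W o) : 0 ≤ tubeCos φ o m x := by
  refine Set.indicator_nonneg (fun x hx => ?_) x
  have hbounds := (mem_tube.1 (Finset.mem_coe.1 hx)).1
  exact cos_tubeAngle_mul_nonneg (abs_le.2 ⟨by omega, by omega⟩)

theorem tubeCos_le_one (m : ℕ) (x : ℤ × LampConfig W o) : tubeCos φ o m x ≤ 1 :=
  Set.indicator_apply_le' (fun _ => Real.cos_le_one _) fun _ => zero_le_one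

theorem tubeCos_apply {m : ℕ} {a : ℤ} (ha : |a| ≤ m + 1) {f : LampConfig W o}
    (hf : f ∈ restOff o ((Finset.Icc (-m : ℤ) m).image φ)) :
    tubeCos φ o m (a, f) = Real.cos (tubeAngle m * a) := by
  by_cases hx : (a, f) ∈ tube φ o m
  · exact Set.indicator_of_mem (Finset.mem_coe.2 hx) _
  · rw [tubeCos_of_notMem hx, cos_tubeAngle_mul_eq_zero]
    by_contra hne
    exact hx (mem_tube.2 ⟨abs_le.1 (by omega), hf⟩)

theorem tubeCos_rest (m : ℕ) : tubeCos φ o m (0, LampConfig.rest W o) = 1 := by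
  rw [tubeCos_apply (by simp; omega) (rest_mem_restOff _), Int.cast_zero, mul_zero, Real.cos_zero]

variable [(intWreath φ B o).LocallyFinite]

theorem sum_neighbor_tubeCos_sub {m : ℕ} {a : ℤ} {f : LampConfig W o}
    (hx : (a, f) ∈ tube φ o m) :
    ∑ y ∈ (intWreath φ B o).neighborFinset (a, f), (tubeCos φ o m y - tubeCos φ o m (a, f)) =
      (tubeCos φ o m (a + 1, f) - tubeCos φ o m (a, f)) +
        (tubeCos φ o m (a - 1, f) - tubeCos φ o m (a, f)) := by
  classical
  obtain ⟨ha, hf⟩ := mem_tube.1 hx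
  rw [← Finset.sum_pair (f := fun y => tubeCos φ o m y - tubeCos φ o m (a, f)) (a := (a + 1, f))
    (b := (a - 1, f)) (by simp only [ne_eq, Prod.mk.injEq, and_true]; omega)]
  refine (Finset.sum_subset (fun y hy => ?_) fun y hy hy' => ?_).symm
  · rw [SimpleGraph.mem_neighborFinset, intWreath_adj]
    exact .inl (by simpa using hy)
  · rw [SimpleGraph.mem_neighborFinset, intWreath_adj] at hy
    rcases hy with h | ⟨w, -, rfl⟩
    · exact absurd (by simpa using h) hy'
    · have haabs : |a| ≤ m + 1 := abs_le.2 ⟨by omega, by omega⟩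
      rw [tubeCos_apply haabs (switch_mem_restOff_image_Icc hx w), tubeCos_apply haabs hf, sub_self]

theorem neg_sq_mul_le_sum_neighbor_tubeCos_sub {m : ℕ} {a : ℤ} {f : LampConfig W o}
    (hx : (a, f) ∈ tube φ o m) :
    -(tubeAngle m ^ 2 * tubeCos φ o m (a, f)) ≤
      ∑ y ∈ (intWreath φ B o).neighborFinset (a, f),
        (tubeCos φ o m y - tubeCos φ o m (a, f)) := by
  obtain ⟨ha, hf⟩ := mem_tube.1 hx
  have hval : tubeCos φ o m (a, f) = Real.cos (tubeAngle m * a) :=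
    tubeCos_apply (abs_le.2 ⟨by omega, by omega⟩) hf
  have hright : tubeCos φ o m (a + 1, f) = Real.cos (tubeAngle m * a + tubeAngle m) := by
    rw [tubeCos_apply (abs_le.2 ⟨by omega, by omega⟩) hf, Int.cast_add, Int.cast_one, mul_add_one]
  have hleft : tubeCos φ o m (a - 1, f) = Real.cos (tubeAngle m * a - tubeAngle m) := by
    rw [tubeCos_apply (abs_le.2 ⟨by omega, by omega⟩) hf, Int.cast_sub, Int.cast_one, mul_sub_one]
  have hpos := tubeCos_nonneg m (a, f) (φ := φ)
  have hcos := Real.one_sub_sq_div_two_le_cos (x := tubeAngle m)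
  rw [sum_neighbor_tubeCos_sub hx, hright, hleft, Real.cos_add, Real.cos_sub, ← hval]
  nlinarith

theorem one_sub_sq_mul_tubeCos_le_markov (m : ℕ) (x : ℤ × LampConfig W o) :
    (1 - tubeAngle m ^ 2) * tubeCos φ o m x ≤ markov (intWreath φ B o) (tubeCos φ o m) x := by
  by_cases hx : x ∈ tube φ o m
  · have hge := neg_sq_mul_le_sum_neighbor_tubeCos_sub (B := B) hx
    rw [Finset.sum_sub_distrib, Finset.sum_const, SimpleGraph.card_neighborFinset_eq_degree,
      nsmul_eq_mul] at hge
    have hdeg : 0 ≤ tubeAngle m ^ 2 * tubeCos φ o m x * ((intWreath φ B o).degree x : ℝ) :=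
      mul_nonneg (mul_nonneg (sq_nonneg _) (tubeCos_nonneg m x)) (Nat.cast_nonneg _)
    rw [markov, le_div_iff₀ (by positivity)]
    linarith
  · rw [tubeCos_of_notMem hx, mul_zero]
    exact div_nonneg (add_nonneg (tubeCos_nonneg m x)
      (Finset.sum_nonneg fun y _ => tubeCos_nonneg m y)) (by positivity)

theorem exp_div_le_heat_rest {D : ℕ} (hD : ∀ x, (intWreath φ B o).degree x ≤ D) {m : ℕ}
    (hm : 1 ≤ m) (n : ℕ) :
    Real.exp (-(10 * n / m ^ 2)) / ((D + 1) ^ 2 * (tube φ o m).card) ≤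
      heat (intWreath φ B o) (0, LampConfig.rest W o) n (0, LampConfig.rest W o) := by
  have hm1 : (1 : ℝ) ≤ m := mod_cast hm
  have hangle := tubeAngle_mul_add_one_sq_le m
  have hsmall : tubeAngle m ^ 2 ≤ 3 / 4 := by nlinarith [sq_nonneg (tubeAngle m)]
  refine le_trans ?_ (pow_div_le_heat_self hD (by linarith) (sub_le_self 1 (sq_nonneg _))
    (tubeCos_nonneg m) (tubeCos_le_one m) (fun _ => tubeCos_of_notMem) (tubeCos_rest m)
    (one_sub_sq_mul_tubeCos_le_markov m) n)
  gcongr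
  refine le_trans ?_ (pow_le_pow_left₀ (Real.exp_pos _).le
    (exp_neg_four_mul_le_one_sub (sq_nonneg _) hsmall) n)
  rw [← Real.exp_nat_mul]
  gcongr
  rw [mul_neg, neg_le_neg_iff, le_div_iff₀ (by positivity)]
  have hmangle : tubeAngle m ^ 2 * m ^ 2 ≤ 5 / 2 := le_trans (by gcongr; linarith) hangle
  linarith [mul_le_mul_of_nonneg_left hmangle (Nat.cast_nonneg n : (0 : ℝ) ≤ n)]

theorem TubeGrowth.dominated_transProb {D : ℕ} (hD : ∀ x, (intWreath φ B o).degree x ≤ D)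
    {β : ℝ} (hβ : 0 < β) (h : TubeGrowth φ W β) :
    Dominated (fun n => Real.exp (-((n : ℝ) ^ (β / (β + 2))))) fun n =>
      transProb (intWreath φ B o) n (0, LampConfig.rest W o) (0, LampConfig.rest W o) := by
  obtain ⟨C, c, hC, hc, h⟩ := h
  refine exp_neg_rpow_dominated (C := min (1 / ((D + 1) ^ 2 * C)) 1) (c := 10 + c * 2 ^ β)
    (by positivity) (by positivity) (by positivity) fun n => ?_
  rw [transProb_eq_heat]
  rcases Nat.eq_zero_or_pos n with rfl | hn
  · rw [heat_zero_self, Nat.cast_zero, Real.zero_rpow (by positivity), mul_zero, neg_zero,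
      Real.exp_zero, mul_one]
    exact min_le_right _ _
  obtain ⟨m, hm, -, hmβ, hnm, -⟩ := exists_balanced_scale hβ hn
  set t := (n : ℝ) ^ (β / (β + 2))
  have hcard : ((tube φ o m).card : ℝ) ≤ C * Real.exp (c * 2 ^ β * t) := by
    refine (card_tube_le (o := o) m).trans ((h m).trans ?_)
    rw [mul_assoc c]
    gcongr
  have htime : 10 * n / (m : ℝ) ^ 2 ≤ 10 * t := by
    rw [div_le_iff₀ (by positivity)]
    linarith
  have hcard0 : (0 : ℝ) < (tube φ o m).card :=
    mod_cast Finset.card_pos.2 (tube_nonempty m)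
  refine le_trans ?_ (exp_div_le_heat_rest hD hm n)
  calc min (1 / (((D : ℝ) + 1) ^ 2 * C)) 1 * Real.exp (-((10 + c * 2 ^ β) * t))
      ≤ 1 / (((D : ℝ) + 1) ^ 2 * C) * Real.exp (-((10 + c * 2 ^ β) * t)) := by
        gcongr
        exact min_le_left _ _
    _ = Real.exp (-(10 * t)) / (((D : ℝ) + 1) ^ 2 * (C * Real.exp (c * 2 ^ β * t))) := by
        rw [add_mul, neg_add, Real.exp_add, Real.exp_neg (c * 2 ^ β * t)]
        field_simp
    _ ≤ Real.exp (-(10 * n / m ^ 2)) / ((D + 1) ^ 2 * (tube φ o m).card) := by gcongr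

end ReturnOnTubes

section Entropy

open Classical in
theorem sum_card_fiber_mul_card_fiber_le {ι A A' : Type*} (F : Finset ι) (p : ι → A) (q : ι → A')
    (hpq : ∀ x ∈ F, ∀ y ∈ F, p x = p y → q x = q y → x = y) :
    ∑ f ∈ F, (F.filter fun g => p g = p f).card * (F.filter fun g => q g = q f).card ≤
      F.card * F.card := by
  simp only [← Finset.card_product, ← Finset.card_sigma]
  refine Finset.card_le_card_of_injOn Sigma.snd (fun t ht => ?_) ?_
  · simp only [Finset.coe_sigma, Set.mem_sigma_iff, Finset.mem_coe, Finset.mem_product,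
      Finset.mem_filter] at ht ⊢
    exact ⟨ht.2.1.1, ht.2.2.1⟩
  · rintro ⟨f, g, h⟩ ht ⟨f', g', h'⟩ ht' heq
    simp only [Finset.coe_sigma, Set.mem_sigma_iff, Finset.mem_coe, Finset.mem_product,
      Finset.mem_filter] at ht ht'
    obtain ⟨rfl, rfl⟩ := Prod.mk.inj heq
    obtain rfl := hpq f ht.1 f' ht'.1 (ht.2.1.2.symm.trans ht'.2.1.2)
      (ht.2.2.2.symm.trans ht'.2.2.2)
    rfl

theorem log_add_log_le_log_add_mul_div {a b n : ℝ} (ha : 0 < a) (hb : 0 < b) (hn : 0 < n) :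
    Real.log a + Real.log b ≤ Real.log n - 1 + a * b / n := by
  have h := Real.log_le_sub_one_of_pos (div_pos (mul_pos ha hb) hn)
  rw [Real.log_div (mul_pos ha hb).ne' hn.ne', Real.log_mul ha.ne' hb.ne'] at h
  linarith

open Classical in
/-- Subadditivity of entropy, `H(p, q) ≤ H(p) + H(q)`, for a uniform point of `F`. -/
theorem sum_log_card_fiber_add_le {ι A A' : Type*} (F : Finset ι) (p : ι → A) (q : ι → A')
    (hpq : ∀ x ∈ F, ∀ y ∈ F, p x = p y → q x = q y → x = y) :
    ∑ f ∈ F, (Real.log (F.filter fun g => p g = p f).card +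
      Real.log (F.filter fun g => q g = q f).card) ≤ F.card * Real.log F.card := by
  rcases F.eq_empty_or_nonempty with rfl | hne
  · simp
  have hF : (0 : ℝ) < F.card := by exact_mod_cast hne.card_pos
  have hp_pos : ∀ f ∈ F, (0 : ℝ) < (F.filter fun g => p g = p f).card := fun f hf =>
    Nat.cast_pos.2 (Finset.card_pos.2 ⟨f, Finset.mem_filter.2 ⟨hf, rfl⟩⟩)
  have hq_pos : ∀ f ∈ F, (0 : ℝ) < (F.filter fun g => q g = q f).card := fun f hf =>
    Nat.cast_pos.2 (Finset.card_pos.2 ⟨f, Finset.mem_filter.2 ⟨hf, rfl⟩⟩)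
  have hcount : (∑ f ∈ F, ((F.filter fun g => p g = p f).card : ℝ) *
      (F.filter fun g => q g = q f).card) / F.card ≤ F.card := by
    rw [div_le_iff₀ hF]
    exact_mod_cast sum_card_fiber_mul_card_fiber_le F p q hpq
  calc _ ≤ ∑ f ∈ F, (Real.log F.card - 1 + ((F.filter fun g => p g = p f).card : ℝ) *
          (F.filter fun g => q g = q f).card / F.card) :=
        Finset.sum_le_sum fun f hf =>
          log_add_log_le_log_add_mul_div (hp_pos f hf) (hq_pos f hf) hF
    _ ≤ F.card * Real.log F.card := by
        rw [Finset.sum_add_distrib, ← Finset.sum_div, Finset.sum_const, nsmul_eq_mul]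
        linarith

variable {L : Type*} {W : L → Type*} {ι : Type*} (e : ι → ∀ z, W z)

open Classical in
theorem filter_filter_eq_of_ne {F : Finset ι} {x y : L} (hxy : x ≠ y) {v : W x} {f : ι}
    (hf : e f x = v) :
    ((F.filter fun g => e g x = v).filter fun g => ∀ z, z ≠ y → e g z = e f z) =
      F.filter fun g => ∀ z, z ≠ y → e g z = e f z := by
  rw [Finset.filter_filter]
  exact Finset.filter_congr fun g _ => and_iff_right_of_imp fun h => (h x hxy).trans hf

open Classical in
theorem sum_log_card_slices_le_of_fibers (Λ : Finset L) {x : L} (hx : x ∉ Λ) (F : Finset ι)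
    (ih : ∀ v, ∑ f ∈ F.filter (fun f => e f x = v), ∑ y ∈ Λ,
      Real.log ((F.filter fun f => e f x = v).filter fun g => ∀ z, z ≠ y → e g z = e f z).card ≤
      (F.filter fun f => e f x = v).card * Real.log (F.filter fun f => e f x = v).card) :
    ∑ f ∈ F, ∑ y ∈ Λ, Real.log (F.filter fun g => ∀ z, z ≠ y → e g z = e f z).card ≤
      ∑ f ∈ F, Real.log (F.filter fun g => e g x = e f x).card := by
  have hmem : ∀ f ∈ F, e f x ∈ F.image fun f => e f x :=
    fun f hf => Finset.mem_image_of_mem (fun f => e f x) hf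
  rw [← Finset.sum_fiberwise_of_maps_to hmem, ← Finset.sum_fiberwise_of_maps_to (s := F) hmem]
  refine Finset.sum_le_sum fun v _ => ?_
  calc _ = ∑ f ∈ F.filter (fun f => e f x = v), ∑ y ∈ Λ, Real.log
        ((F.filter fun f => e f x = v).filter fun g => ∀ z, z ≠ y → e g z = e f z).card := by
        refine Finset.sum_congr rfl fun f hf => Finset.sum_congr rfl fun y hy => ?_
        have hxy : x ≠ y := fun h => hx (h ▸ hy)
        rw [filter_filter_eq_of_ne e hxy (Finset.mem_filter.1 hf).2]
    _ ≤ (F.filter fun f => e f x = v).card * Real.log (F.filter fun f => e f x = v).card := ih v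
    _ = _ := by
        rw [← nsmul_eq_mul]
        refine (Finset.sum_eq_card_nsmul fun f hf => ?_).symm
        rw [(Finset.mem_filter.1 hf).2]

open Classical in
/-- The edge-isoperimetric inequality in a product, in its entropy form (Han's inequality). -/
theorem sum_log_card_slices_le (he : Function.Injective e) (Λ : Finset L) (F : Finset ι) :
    ∑ f ∈ F, ∑ x ∈ Λ, Real.log (F.filter fun g => ∀ y, y ≠ x → e g y = e f y).card ≤
      F.card * Real.log F.card := by
  induction Λ using Finset.induction_on generalizing F with
  | empty =>
    simp only [Finset.sum_empty, Finset.sum_const_zero]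
    positivity
  | insert x Λ hx ih =>
    have hinj : ∀ f ∈ F, ∀ g ∈ F, e f x = e g x →
        (fun y : {y // y ≠ x} => e f y) = (fun y : {y // y ≠ x} => e g y) → f = g := by
      refine fun f _ g _ hp hq => he (funext fun y => ?_)
      by_cases h : y = x
      · subst h; exact hp
      · exact congrFun hq ⟨y, h⟩
    refine le_trans ?_
      (sum_log_card_fiber_add_le F (fun f => e f x) (fun f (y : {y // y ≠ x}) => e f y.1) hinj)
    simp only [Finset.sum_insert hx, Finset.sum_add_distrib, funext_iff, Subtype.forall]
    rw [add_comm]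
    gcongr ?_ + _
    exact sum_log_card_slices_le_of_fibers e Λ hx F fun v => ih _

end Entropy

section Isoperimetry

theorem exists_int_step {S : ℤ → Prop} {a b : ℤ} (hab : a ≤ b) (ha : S a) (hb : ¬S b) :
    ∃ c, a ≤ c ∧ c < b ∧ S c ∧ ¬S (c + 1) := by
  by_contra! hcon
  refine hb (Int.leInduction (m := a) (motive := fun n _ => n ≤ b → S n) (fun _ => ha)
    (fun n hn ih hn' => ?_) b hab le_rfl)
  exact hcon n hn (by lia) (ih (by lia))

theorem exists_intGraph_adj_of_not {S : ℤ → Prop} {a b : ℤ} (ha : S a) (hb : ¬S b) :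
    ∃ c d, (min a b ≤ c ∧ c ≤ max a b) ∧ intGraph.Adj c d ∧ S c ∧ ¬S d := by
  rcases le_total a b with h | h
  · obtain ⟨c, hac, hcb, hc, hc'⟩ := exists_int_step h ha hb
    exact ⟨c, c + 1, by lia, (intGraph_adj _ _).2 (Or.inl rfl), hc, hc'⟩
  · obtain ⟨c, hbc, hca, hc, hc'⟩ := exists_int_step (S := fun n => ¬S n) h hb (not_not.2 ha)
    exact ⟨c + 1, c, by lia, (intGraph_adj _ _).2 (by lia), not_not.1 hc', hc⟩

theorem ediv_eq_iff_mem_Ico {a j : ℤ} {k : ℕ} (hk : 1 ≤ k) :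
    a / (k : ℤ) = j ↔ a ∈ Finset.Ico (j * k) (j * k + k) := by
  rw [Int.ediv_eq_iff_of_pos (by lia), Finset.mem_Ico]

theorem card_Ico_mul_add (j : ℤ) (k : ℕ) : (Finset.Ico (j * k) (j * k + k)).card = k := by
  simp

variable {L : Type} {W : L → Type} {o : ∀ z, W z} {φ : ℤ → L} {B : ∀ z, SimpleGraph (W z)}

theorem finite_edgeBoundary_intWreath [∀ z, Finite (W z)] (U : Finset (ℤ × LampConfig W o)) :
    (edgeBoundary (intWreath φ B o) U).Finite := by
  refine Set.Finite.subset (Set.Finite.biUnion U.finite_toSet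
    fun x _ => (finite_neighborSet_intWreath (φ := φ) (B := B) x).image fun y => (x, y)) ?_
  rintro ⟨x, y⟩ ⟨hxy, hx, -⟩
  exact Set.mem_biUnion hx ⟨y, hxy, rfl⟩

open Classical in
/-- The pairs (window, configuration) met by `U`, where `ℤ` is cut into windows of length `k` and
the window `[j * k, j * k + k)` is represented by `j`. -/
noncomputable def windowTrace (U : Finset (ℤ × LampConfig W o)) (k : ℕ) :
    Finset (ℤ × LampConfig W o) :=
  U.image fun u => (u.1 / (k : ℤ), u.2)

/-- The window represented by `q.1` lies in `U` when the configuration is `q.2`. -/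
def IsFullWindow (U : Finset (ℤ × LampConfig W o)) (k : ℕ) (q : ℤ × LampConfig W o) : Prop :=
  ∀ a : ℤ, a / (k : ℤ) = q.1 → (a, q.2) ∈ U

open Classical in
theorem mul_card_fullWindows_le (U : Finset (ℤ × LampConfig W o)) {k : ℕ} (hk : 1 ≤ k) :
    k * ((windowTrace U k).filter (IsFullWindow U k)).card ≤ U.card := by
  rw [Finset.card_eq_sum_card_fiberwise (s := U) (f := fun u => (u.1 / (k : ℤ), u.2))
    (t := windowTrace U k) (fun u hu => Finset.mem_image_of_mem _ hu), mul_comm, ← smul_eq_mul]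
  refine le_trans (Finset.card_nsmul_le_sum _ _ _ fun q hq => ?_)
    (Finset.sum_le_sum_of_subset (Finset.filter_subset _ _))
  refine (card_Ico_mul_add q.1 k).ge.trans (Finset.card_le_card_of_injOn (fun a => (a, q.2))
    (fun a ha => ?_) (fun a _ b _ h => (Prod.mk.inj h).1))
  have haq : a / (k : ℤ) = q.1 := (ediv_eq_iff_mem_Ico hk).2 ha
  exact Finset.mem_coe.2 (Finset.mem_filter.2
    ⟨(Finset.mem_filter.1 hq).2 a haq, Prod.ext haq rfl⟩)

open Classical in
theorem card_cutWindows_le [∀ z, Finite (W z)] (U : Finset (ℤ × LampConfig W o)) {k : ℕ}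
    (hk : 1 ≤ k) :
    ((windowTrace U k).filter (¬IsFullWindow U k ·)).card ≤
      (edgeBoundary (intWreath φ B o) U).ncard := by
  have hfin := finite_edgeBoundary_intWreath (φ := φ) (B := B) U
  rw [Set.ncard_eq_toFinset_card _ hfin]
  refine Finset.card_le_card_of_surjOn (fun e => (e.1.1 / (k : ℤ), e.1.2)) ?_
  rintro ⟨j, f⟩ hq
  obtain ⟨htrace, hcut⟩ := Finset.mem_filter.1 hq
  obtain ⟨⟨a, g⟩, haU, haq⟩ := Finset.mem_image.1 htrace
  obtain ⟨ha, rfl⟩ := Prod.mk.inj haq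
  simp only [IsFullWindow, not_forall] at hcut
  obtain ⟨b, hb, hbU⟩ := hcut
  obtain ⟨c, d, hc, hcd, hcU, hdU⟩ :=
    exists_intGraph_adj_of_not (S := fun a => (a, g) ∈ U) haU hbU
  have hcj : c / (k : ℤ) = j := by
    have ha' := Finset.mem_Ico.1 ((ediv_eq_iff_mem_Ico hk).1 ha)
    have hb' := Finset.mem_Ico.1 ((ediv_eq_iff_mem_Ico hk).1 hb)
    exact (ediv_eq_iff_mem_Ico hk).2 (Finset.mem_Ico.2 (by lia))
  exact ⟨((c, g), (d, g)), hfin.coe_toFinset.symm ▸ ⟨Or.inl ⟨hcd, rfl⟩, hcU, hdU⟩, by simp [hcj]⟩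

theorem mul_card_windowTrace_le [∀ z, Finite (W z)] (U : Finset (ℤ × LampConfig W o)) {k : ℕ}
    (hk : 1 ≤ k) :
    k * (windowTrace U k).card ≤ U.card + k * (edgeBoundary (intWreath φ B o) U).ncard := by
  classical
  rw [← Finset.card_filter_add_card_filter_not (s := windowTrace U k) (IsFullWindow U k), mul_add]
  gcongr
  · exact mul_card_fullWindows_le U hk
  · exact card_cutWindows_le U hk

variable [DecidableEq L]

/-- The vertex `u` with the lamp that the walker controls put at rest: two vertices have the same
image if and only if they differ at most by the state of that lamp. -/
def restLamp (φ : ℤ → L) (u : ℤ × LampConfig W o) : ℤ × LampConfig W o :=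
  (u.1, u.2.switch (φ u.1) (o (φ u.1)))

theorem restLamp_switch (u : ℤ × LampConfig W o) (v : W (φ u.1)) :
    restLamp φ (u.1, u.2.switch (φ u.1) v) = restLamp φ u := by
  simp only [restLamp, LampConfig.switch_switch]

theorem eq_switch_of_restLamp_eq {u v : ℤ × LampConfig W o} (h : restLamp φ u = restLamp φ v) :
    ∃ w, u = (v.1, v.2.switch (φ v.1) w) := by
  obtain ⟨a, f⟩ := u
  obtain ⟨b, g⟩ := v
  obtain ⟨rfl, hfg⟩ := Prod.mk.inj h
  refine ⟨f.1 (φ a), Prod.ext rfl (LampConfig.eq_switch fun y hy => ?_)⟩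
  have hy' := congrArg (fun f => f.1 y) hfg
  simp only [LampConfig.switch_apply_of_ne _ hy] at hy'
  exact hy'.symm

variable [∀ z, Fintype (W z)]

open Classical in
/-- The states of the lamp at `u` for which the configuration remains in `U`. -/
noncomputable def lampSlice (φ : ℤ → L) (U : Finset (ℤ × LampConfig W o))
    (u : ℤ × LampConfig W o) : Finset (W (φ u.1)) :=
  Finset.univ.filter fun v => (u.1, u.2.switch (φ u.1) v) ∈ U

theorem mem_lampSlice {U : Finset (ℤ × LampConfig W o)} {u : ℤ × LampConfig W o}
    {v : W (φ u.1)} : v ∈ lampSlice φ U u ↔ (u.1, u.2.switch (φ u.1) v) ∈ U := by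
  simp [lampSlice]

theorem lampSlice_nonempty {U : Finset (ℤ × LampConfig W o)} {u : ℤ × LampConfig W o}
    (hu : u ∈ U) : (lampSlice φ U u).Nonempty :=
  ⟨u.2.1 (φ u.1), mem_lampSlice.2 (by rwa [LampConfig.switch_self])⟩

open Classical in
theorem card_filter_restLamp_eq_le (U : Finset (ℤ × LampConfig W o)) (u : ℤ × LampConfig W o) :
    (U.filter fun v => restLamp φ v = restLamp φ u).card ≤ (lampSlice φ U u).card := by
  refine Finset.card_le_card_of_surjOn (fun w => (u.1, u.2.switch (φ u.1) w)) fun v hv => ?_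
  obtain ⟨hvU, hvu⟩ := Finset.mem_filter.1 hv
  obtain ⟨w, rfl⟩ := eq_switch_of_restLamp_eq hvu
  exact ⟨w, mem_lampSlice.2 hvU, rfl⟩

open Classical in
theorem ncard_edgeBoundary_lampSlice_le {U : Finset (ℤ × LampConfig W o)}
    {E : Finset ((ℤ × LampConfig W o) × (ℤ × LampConfig W o))}
    (hE : (E : Set _) = edgeBoundary (intWreath φ B o) U) (u : ℤ × LampConfig W o) :
    (edgeBoundary (B (φ u.1)) (lampSlice φ U u)).ncard ≤
      (E.filter fun e => restLamp φ e.1 = restLamp φ u).card := by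
  obtain ⟨a, f⟩ := u
  rw [← Set.ncard_coe_finset]
  refine Set.ncard_le_ncard_of_injOn
    (fun p => ((a, f.switch (φ a) p.1), (a, f.switch (φ a) p.2))) ?_ ?_ (Set.toFinite _)
  · rintro ⟨v, w⟩ ⟨hvw, hv, hw⟩
    rw [mem_lampSlice] at hv hw
    have hadj : (intWreath φ B o).Adj (a, f.switch (φ a) v) (a, f.switch (φ a) w) :=
      (intWreath_adj _ _).2 (Or.inr ⟨w, by simpa only [LampConfig.switch_apply_same] using hvw,
        by simp only [LampConfig.switch_switch]⟩)
    exact Finset.mem_coe.2 (Finset.mem_filter.2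
      ⟨Finset.mem_coe.1 (hE ▸ ⟨hadj, hv, hw⟩), restLamp_switch (a, f) v⟩)
  · rintro ⟨v, w⟩ - ⟨v', w'⟩ - heq
    simp only [Prod.mk.injEq, true_and] at heq
    have hv := congrArg (fun g => g.1 (φ a)) heq.1
    have hw := congrArg (fun g => g.1 (φ a)) heq.2
    simp only [LampConfig.switch_apply_same] at hv hw
    rw [hv, hw]

open Classical in
/-- The points of `U` at which the slice in the direction of the lamp has a large boundary. -/
noncomputable def badPoints (φ : ℤ → L) (B : ∀ z, SimpleGraph (W z)) (h : ℝ)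
    (U : Finset (ℤ × LampConfig W o)) : Finset (ℤ × LampConfig W o) :=
  U.filter fun u => h * (lampSlice φ U u).card ≤
    (edgeBoundary (B (φ u.1)) (lampSlice φ U u)).ncard

theorem badPoints_subset (φ : ℤ → L) (B : ∀ z, SimpleGraph (W z)) (h : ℝ)
    (U : Finset (ℤ × LampConfig W o)) : badPoints φ B h U ⊆ U :=
  Finset.filter_subset _ _

theorem mul_card_badPoints_le {h : ℝ} (hh : 0 ≤ h) (U : Finset (ℤ × LampConfig W o)) :
    h * (badPoints φ B h U).card ≤ (edgeBoundary (intWreath φ B o) U).ncard := by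
  classical
  have hfin := finite_edgeBoundary_intWreath (φ := φ) (B := B) U
  set E := hfin.toFinset
  set bad := badPoints φ B h U
  have hfiber : ∀ q ∈ bad.image (restLamp φ),
      h * ((bad.filter fun u => restLamp φ u = q).card : ℝ) ≤
      ((E.filter fun e => restLamp φ e.1 = q).card : ℝ) := by
    intro q hq
    obtain ⟨u, hu, rfl⟩ := Finset.mem_image.1 hq
    calc h * ((bad.filter fun v => restLamp φ v = restLamp φ u).card : ℝ)
        ≤ h * ((lampSlice φ U u).card : ℝ) := by
          gcongr
          have hsub := Finset.filter_subset_filter (restLamp φ · = restLamp φ u)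
            (badPoints_subset φ B h U)
          exact (Finset.card_le_card hsub).trans (card_filter_restLamp_eq_le U u)
      _ ≤ (edgeBoundary (B (φ u.1)) (lampSlice φ U u)).ncard := (Finset.mem_filter.1 hu).2
      _ ≤ _ := by exact_mod_cast ncard_edgeBoundary_lampSlice_le hfin.coe_toFinset u
  calc h * (bad.card : ℝ)
      = ∑ q ∈ bad.image (restLamp φ), h * ((bad.filter fun u => restLamp φ u = q).card : ℝ) := by
        rw [← Finset.mul_sum, ← Nat.cast_sum, ← Finset.card_eq_sum_card_image]
    _ ≤ ∑ q ∈ bad.image (restLamp φ), ((E.filter fun e => restLamp φ e.1 = q).card : ℝ) :=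
        Finset.sum_le_sum hfiber
    _ ≤ E.card := by
        rw [← Nat.cast_sum, Finset.sum_card_fiberwise_eq_card_filter]
        exact_mod_cast Finset.card_filter_le _ _
    _ = _ := by rw [Set.ncard_eq_toFinset_card _ hfin]

end Isoperimetry

section WreathIsoperimetry

theorem card_le_eight_mul_card_filter {ι : Type*} {F : Finset ι} {n : ι → ℕ} {k : ℕ} (hk : 1 ≤ k)
    (hn : ∀ f ∈ F, n f ≤ k) (hsum : k * F.card ≤ 4 * ∑ f ∈ F, n f) :
    F.card ≤ 8 * (F.filter fun f => k ≤ 8 * n f).card := by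
  have hle : ∑ f ∈ F, 8 * n f ≤ ∑ f ∈ F, (k + if k ≤ 8 * n f then 8 * k else 0) := by
    refine Finset.sum_le_sum fun f hf => ?_
    have := hn f hf
    split_ifs <;> lia
  rw [Finset.sum_add_distrib, ← Finset.sum_filter, ← Finset.mul_sum] at hle
  simp only [Finset.sum_const, smul_eq_mul] at hle
  exact Nat.le_of_mul_le_mul_left (by nlinarith) hk

variable {L : Type} {W : L → Type} {o : ∀ z, W z}

open Classical in
/-- The configurations of the points of `U` with position in the window `[j * k, j * k + k)`. -/
noncomputable def windowConfigs (U : Finset (ℤ × LampConfig W o)) (k : ℕ) (j : ℤ) :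
    Finset (LampConfig W o) :=
  (U.filter fun u => u.1 / (k : ℤ) = j).image Prod.snd

theorem mem_windowConfigs {U : Finset (ℤ × LampConfig W o)} {k : ℕ} {j : ℤ}
    {f : LampConfig W o} : f ∈ windowConfigs U k j ↔ ∃ a : ℤ, a / (k : ℤ) = j ∧ (a, f) ∈ U := by
  simp [windowConfigs, and_comm]

theorem card_windowConfigs_le (U : Finset (ℤ × LampConfig W o)) (k : ℕ) (j : ℤ) :
    (windowConfigs U k j).card ≤ U.card := by
  classical
  exact Finset.card_image_le.trans (Finset.card_le_card (Finset.filter_subset _ _))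

open Classical in
theorem card_filter_windowTrace (U : Finset (ℤ × LampConfig W o)) (k : ℕ) (j : ℤ) :
    ((windowTrace U k).filter fun q => q.1 = j).card = (windowConfigs U k j).card := by
  have himage : (windowTrace U k).filter (fun q => q.1 = j) =
      (windowConfigs U k j).image fun f => (j, f) := by
    ext ⟨i, f⟩
    simp only [windowTrace, Finset.mem_filter, Finset.mem_image, mem_windowConfigs, Prod.mk.injEq,
      Prod.exists]
    grind
  rw [himage, Finset.card_image_of_injective _ (Prod.mk_right_injective j)]

open Classical in
/-- The positions in the window `[j * k, j * k + k)` of the points of `Γ` with configuration `f`. -/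
noncomputable def windowPositions (Γ : Finset (ℤ × LampConfig W o)) (k : ℕ) (j : ℤ)
    (f : LampConfig W o) : Finset ℤ :=
  (Γ.filter fun u => u.1 / (k : ℤ) = j ∧ u.2 = f).image Prod.fst

theorem mem_windowPositions {Γ : Finset (ℤ × LampConfig W o)} {k : ℕ} {j : ℤ}
    {f : LampConfig W o} {a : ℤ} :
    a ∈ windowPositions Γ k j f ↔ a / (k : ℤ) = j ∧ (a, f) ∈ Γ := by
  simp [windowPositions, and_comm]

theorem card_windowPositions_le (Γ : Finset (ℤ × LampConfig W o)) {k : ℕ} (hk : 1 ≤ k) (j : ℤ)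
    (f : LampConfig W o) : (windowPositions Γ k j f).card ≤ k := by
  have hsub : windowPositions Γ k j f ⊆ Finset.Ico (j * k) (j * k + k) := fun a ha =>
    (ediv_eq_iff_mem_Ico hk).1 (mem_windowPositions.1 ha).1
  exact (Finset.card_le_card hsub).trans_eq (card_Ico_mul_add j k)

open Classical in
theorem card_filter_window_eq_sum {U Γ : Finset (ℤ × LampConfig W o)} (hΓ : Γ ⊆ U) (k : ℕ)
    (j : ℤ) :
    (Γ.filter fun u => u.1 / (k : ℤ) = j).card =
      ∑ f ∈ windowConfigs U k j, (windowPositions Γ k j f).card := by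
  rw [Finset.card_eq_sum_card_fiberwise (f := Prod.snd) (t := windowConfigs U k j) fun u hu =>
    Finset.mem_image_of_mem _ (Finset.filter_subset_filter _ hΓ hu)]
  refine Finset.sum_congr rfl fun f _ => ?_
  rw [Finset.filter_filter]
  refine (Finset.card_image_of_injOn fun p hp q hq hpq => ?_).symm
  exact Prod.ext hpq ((Finset.mem_filter.1 hp).2.2.trans (Finset.mem_filter.1 hq).2.2.symm)

theorem exists_window {U Γ : Finset (ℤ × LampConfig W o)} {k m : ℕ} (hU : U.Nonempty)
    (hΓU : Γ ⊆ U) (hΓ : k * (windowTrace U k).card ≤ m * Γ.card) :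
    ∃ j : ℤ, (windowConfigs U k j).Nonempty ∧ k * (windowConfigs U k j).card ≤
      m * ∑ f ∈ windowConfigs U k j, (windowPositions Γ k j f).card := by
  classical
  by_contra! hcon
  set J := U.image fun u => u.1 / (k : ℤ)
  have htrace : (windowTrace U k).card = ∑ j ∈ J, (windowConfigs U k j).card := by
    simp only [← card_filter_windowTrace]
    exact Finset.card_eq_sum_card_fiberwise fun q hq => by
      obtain ⟨u, hu, rfl⟩ := Finset.mem_image.1 hq
      exact Finset.mem_image_of_mem _ hu
  have hcard : Γ.card =
      ∑ j ∈ J, ∑ f ∈ windowConfigs U k j, (windowPositions Γ k j f).card := by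
    simp only [← card_filter_window_eq_sum hΓU]
    exact Finset.card_eq_sum_card_fiberwise fun u hu => Finset.mem_image_of_mem _ (hΓU hu)
  refine hΓ.not_gt ?_
  rw [htrace, hcard, Finset.mul_sum, Finset.mul_sum]
  refine Finset.sum_lt_sum_of_nonempty (hU.image _) fun j hj => hcon j ?_
  obtain ⟨u, hu, rfl⟩ := Finset.mem_image.1 hj
  exact ⟨u.2, mem_windowConfigs.2 ⟨u.1, rfl, hu⟩⟩

/-- Sets with a small boundary in the fibre `B z` have size at least a power of `|B z|`. -/
def SmallSetExpansion [∀ z, Fintype (W z)] (B : ∀ z, SimpleGraph (W z)) (h κ : ℝ) : Prop :=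
  ∀ (z : L) (T : Finset (W z)), T.Nonempty → ((edgeBoundary (B z) T).ncard : ℝ) < h * T.card →
    κ * Real.log (Fintype.card (W z)) ≤ Real.log T.card

/-- Any positive proportion (here one eighth) of the points of a window of length `k` sees lamps
of total entropy `≽ k ^ β`. -/
def WindowEntropy [DecidableEq L] (φ : ℤ → L) (W : L → Type) [∀ z, Fintype (W z)] (β c : ℝ) :
    Prop :=
  ∀ (k : ℕ), 1 ≤ k → ∀ (j : ℤ) (S : Finset ℤ), (∀ a ∈ S, a / (k : ℤ) = j) → k ≤ 8 * S.card →
    c * (k : ℝ) ^ β ≤ ∑ x ∈ S.image φ, Real.log (Fintype.card (W x))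

variable [DecidableEq L] [∀ z, Fintype (W z)] {φ : ℤ → L} {B : ∀ z, SimpleGraph (W z)}
  {h κ β c : ℝ} {U : Finset (ℤ × LampConfig W o)} {k : ℕ}

open Classical in
theorem card_lampSlice_le {a : ℤ} (f : LampConfig W o) :
    (lampSlice φ U (a, f)).card ≤
      ((windowConfigs U k (a / (k : ℤ))).filter fun g => ∀ y, y ≠ φ a → g.1 y = f.1 y).card := by
  refine Finset.card_le_card_of_injOn (fun v => f.switch (φ a) v) (fun v hv => ?_) ?_
  · exact Finset.mem_coe.2 (Finset.mem_filter.2 ⟨mem_windowConfigs.2 ⟨a, rfl, mem_lampSlice.1 hv⟩,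
      fun y hy => LampConfig.switch_apply_of_ne _ hy _⟩)
  · intro v _ w _ hvw
    simpa only [LampConfig.switch_apply_same] using congrArg (fun g => g.1 (φ a)) hvw

open Classical in
theorem SmallSetExpansion.mul_log_card_le_log_card_slice (hB : SmallSetExpansion B h κ) {a : ℤ}
    {f : LampConfig W o} (haf : (a, f) ∈ U \ badPoints φ B h U) :
    κ * Real.log (Fintype.card (W (φ a))) ≤ Real.log
      ((windowConfigs U k (a / (k : ℤ))).filter fun g => ∀ y, y ≠ φ a → g.1 y = f.1 y).card := by
  obtain ⟨hU, hgood⟩ := Finset.mem_sdiff.1 haf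
  have hne := lampSlice_nonempty (φ := φ) hU
  have hlt : ((edgeBoundary (B (φ a)) (lampSlice φ U (a, f))).ncard : ℝ) <
      h * (lampSlice φ U (a, f)).card := by
    by_contra! hcon
    exact hgood (Finset.mem_filter.2 ⟨hU, hcon⟩)
  refine (hB (φ a) _ hne hlt).trans (Real.log_le_log (by exact_mod_cast hne.card_pos) ?_)
  exact_mod_cast card_lampSlice_le f

open Classical in
theorem mul_rpow_le_sum_log_card_slice (hκ : 0 ≤ κ) (hB : SmallSetExpansion B h κ)
    (hφ : WindowEntropy φ W β c) (hk : 1 ≤ k) {j : ℤ} {f : LampConfig W o} {Λ : Finset L}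
    (hΛ : (windowPositions (U \ badPoints φ B h U) k j f).image φ ⊆ Λ)
    (hf : k ≤ 8 * (windowPositions (U \ badPoints φ B h U) k j f).card) :
    κ * (c * (k : ℝ) ^ β) ≤ ∑ x ∈ Λ, Real.log
      ((windowConfigs U k j).filter fun g => ∀ y, y ≠ x → g.1 y = f.1 y).card := by
  set S := windowPositions (U \ badPoints φ B h U) k j f
  calc κ * (c * (k : ℝ) ^ β)
      ≤ κ * ∑ x ∈ S.image φ, Real.log (Fintype.card (W x)) := by
        gcongr
        exact hφ k hk j S (fun a ha => (mem_windowPositions.1 ha).1) hf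
    _ ≤ ∑ x ∈ S.image φ, Real.log
          ((windowConfigs U k j).filter fun g => ∀ y, y ≠ x → g.1 y = f.1 y).card := by
        rw [Finset.mul_sum]
        refine Finset.sum_le_sum fun x hx => ?_
        obtain ⟨a, ha, rfl⟩ := Finset.mem_image.1 hx
        obtain ⟨rfl, haf⟩ := mem_windowPositions.1 ha
        exact hB.mul_log_card_le_log_card_slice haf
    _ ≤ _ := Finset.sum_le_sum_of_subset_of_nonneg hΛ fun x _ _ => Real.log_natCast_nonneg _

open Classical in
theorem mul_rpow_le_log_card_windowConfigs (hκ : 0 ≤ κ) (hc : 0 ≤ c) (hB : SmallSetExpansion B h κ)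
    (hφ : WindowEntropy φ W β c) (hk : 1 ≤ k) {j : ℤ} (hne : (windowConfigs U k j).Nonempty)
    (hmany : k * (windowConfigs U k j).card ≤ 4 * ∑ f ∈ windowConfigs U k j,
      (windowPositions (U \ badPoints φ B h U) k j f).card) :
    κ * c / 8 * (k : ℝ) ^ β ≤ Real.log (windowConfigs U k j).card := by
  set F := windowConfigs U k j
  set S := windowPositions (U \ badPoints φ B h U) k j
  set Λ : Finset L := F.biUnion fun f => (S f).image φ
  set entropy : LampConfig W o → ℝ := fun f =>
    ∑ x ∈ Λ, Real.log (F.filter fun g => ∀ y, y ≠ x → g.1 y = f.1 y).card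
  have hrich : (F.card : ℝ) ≤ 8 * (F.filter fun f => k ≤ 8 * (S f).card).card := by
    exact_mod_cast card_le_eight_mul_card_filter hk (fun f _ => card_windowPositions_le _ hk j f)
      hmany
  have hsum : (F.filter fun f => k ≤ 8 * (S f).card).card * (κ * (c * (k : ℝ) ^ β)) ≤
      F.card * Real.log F.card := by
    rw [← nsmul_eq_mul]
    calc _ ≤ ∑ f ∈ F.filter (fun f => k ≤ 8 * (S f).card), entropy f := by
          refine Finset.card_nsmul_le_sum _ _ _ fun f hf => ?_
          obtain ⟨hfF, hfk⟩ := Finset.mem_filter.1 hf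
          exact mul_rpow_le_sum_log_card_slice hκ hB hφ hk
            (Finset.subset_biUnion_of_mem (fun f => (S f).image φ) hfF) hfk
      _ ≤ ∑ f ∈ F, entropy f :=
          Finset.sum_le_sum_of_subset_of_nonneg (Finset.filter_subset _ _) fun f _ _ =>
            Finset.sum_nonneg fun x _ => Real.log_natCast_nonneg _
      _ ≤ F.card * Real.log F.card :=
          sum_log_card_slices_le (fun f : LampConfig W o => f.1)
            (fun f g hfg => LampConfig.ext (congrFun hfg)) Λ F
  have hF : (0 : ℝ) < F.card := by exact_mod_cast hne.card_pos
  have hprofile : 0 ≤ κ * (c * (k : ℝ) ^ β) := by positivity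
  exact le_of_mul_le_mul_left (by nlinarith) hF

theorem two_mul_card_badPoints_le (hkh : 2 ≤ k * h)
    (hU : U ∈ folnerSets (intWreath φ B o) k) : 2 * (badPoints φ B h U).card ≤ U.card := by
  have hh : 0 ≤ h := by
    by_contra! hneg
    linarith [mul_nonpos_of_nonneg_of_nonpos (Nat.cast_nonneg (α := ℝ) k) hneg.le]
  have hreal : (2 : ℝ) * (badPoints φ B h U).card ≤ U.card :=
    calc (2 : ℝ) * (badPoints φ B h U).card ≤ k * h * (badPoints φ B h U).card := by gcongr
      _ = k * (h * (badPoints φ B h U).card) := mul_assoc _ _ _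
      _ ≤ k * (edgeBoundary (intWreath φ B o) U).ncard := by
          gcongr
          exact mul_card_badPoints_le hh U
      _ ≤ U.card := by exact_mod_cast hU.2
  exact_mod_cast hreal

theorem mul_rpow_le_log_card_of_mem_folnerSets (hκ : 0 ≤ κ) (hc : 0 ≤ c)
    (hB : SmallSetExpansion B h κ) (hφ : WindowEntropy φ W β c) (hk : 1 ≤ k) (hkh : 2 ≤ k * h)
    (hU : U ∈ folnerSets (intWreath φ B o) k) :
    κ * c / 8 * (k : ℝ) ^ β ≤ Real.log U.card := by
  classical
  have hbad := two_mul_card_badPoints_le hkh hU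
  have hgood := Finset.card_sdiff_add_card_eq_card
    (badPoints_subset φ B h U)
  have htrace := mul_card_windowTrace_le (φ := φ) (B := B) U hk
  have hboundary := hU.2
  obtain ⟨j, hne, hj⟩ := exists_window (k := k) (m := 4) (Γ := U \ badPoints φ B h U) hU.1
    Finset.sdiff_subset (by lia)
  refine (mul_rpow_le_log_card_windowConfigs hκ hc hB hφ hk hne hj).trans ?_
  exact Real.log_le_log (by exact_mod_cast hne.card_pos)
    (by exact_mod_cast card_windowConfigs_le U k j)

theorem expIsoperimetry_of_le_log_card {V : Type} {G : SimpleGraph V} {β c : ℝ} (hβ : 0 ≤ β)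
    (hc : 0 < c) (k₀ : ℕ)
    (h : ∀ k > k₀, ∀ U ∈ folnerSets G k, c * (k : ℝ) ^ β ≤ Real.log U.card) :
    ExpIsoperimetry G β := by
  set d := min (min c 1) (Real.exp (-(c * (k₀ : ℝ) ^ β)))
  have hdc : d ≤ c := (min_le_left _ _).trans (min_le_left _ _)
  have hd1 : d ≤ 1 := (min_le_left _ _).trans (min_le_right _ _)
  refine ⟨d, by positivity, fun k U hU => ?_⟩
  have hcard : (1 : ℝ) ≤ U.card := by exact_mod_cast hU.1.card_pos
  rcases le_or_gt k k₀ with hk | hk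
  · calc d * Real.exp (d * (k : ℝ) ^ β)
        ≤ Real.exp (-(c * (k₀ : ℝ) ^ β)) * Real.exp (c * (k₀ : ℝ) ^ β) := by
          gcongr
          exact min_le_right _ _
      _ = 1 := by rw [← Real.exp_add, neg_add_cancel, Real.exp_zero]
      _ ≤ U.card := hcard
  · calc d * Real.exp (d * (k : ℝ) ^ β) ≤ 1 * Real.exp (c * (k : ℝ) ^ β) := by gcongr
      _ ≤ U.card := by
          rw [one_mul, ← Real.le_log_iff_exp_le (by linarith)]
          exact h k hk U hU

theorem expIsoperimetry_intWreath (hh : 0 < h) (hκ : 0 < κ) (hc : 0 < c) (hβ : 0 ≤ β)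
    (hB : SmallSetExpansion B h κ) (hφ : WindowEntropy φ W β c) :
    ExpIsoperimetry (intWreath φ B o) β := by
  obtain ⟨k₀, hk₀⟩ := exists_nat_ge (2 / h)
  refine expIsoperimetry_of_le_log_card hβ (c := κ * c / 8) (by positivity) k₀ fun k hk U hU => ?_
  have hkh : 2 / h ≤ k := hk₀.trans (by exact_mod_cast hk.le)
  exact mul_rpow_le_log_card_of_mem_folnerSets hκ.le hc.le hB hφ (by lia)
    ((div_le_iff₀ hh).1 hkh) hU

theorem hasExpectedDecay_intWreath {α C : ℝ} {M : ℕ} (hα : 0 < α) (hα1 : α < 1)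
    (hβ : β = 2 * α / (1 - α)) (hh : 0 < h) (hκ : 0 < κ) (hc : 0 < c) (hC : 0 < C)
    (hM : ∀ z x, valency (B z) x ≤ M) (hB : SmallSetExpansion B h κ) (hφ : WindowEntropy φ W β c)
    (hgrowth : ∀ m : ℕ, ∏ x ∈ (Finset.Icc (-m : ℤ) m).image φ, (Fintype.card (W x) : ℝ) ≤
      Real.exp (C * ((m : ℝ) + 1) ^ β)) :
    HasExpectedDecay α (intWreath φ B o) (0, LampConfig.rest W o) := by
  have hα1' : 0 < 1 - α := by linarith
  have hβ0 : 0 < β := hβ ▸ by positivity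
  have hexponent : β / (β + 2) = α := by
    rw [hβ]
    field_simp
    ring
  have hvalency := encard_neighborSet_intWreath_le (φ := φ) (o := o) hM
  have : (intWreath φ B o).LocallyFinite := fun x => (finite_neighborSet_intWreath x).fintype
  have hdegree : ∀ x, (intWreath φ B o).degree x ≤ M + 2 := fun x => by
    rw [← valency_eq_degree, valency, ← Nat.cast_le (α := ℕ∞),
      (finite_neighborSet_intWreath x).cast_ncard_eq]
    exact hvalency x
  have hiso := expIsoperimetry_intWreath (o := o) hh hκ hc hβ0.le hB hφ
  have htube := tubeGrowth_of_prod_card_le hβ0 hC hgrowth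
  have hne : ∀ k, (folnerSets (intWreath φ B o) k).Nonempty := fun k =>
    ⟨_, tube_mem_folnerSets k⟩
  have hupper := hiso.transProb_dominated hdegree (by lia) hβ0 (0, LampConfig.rest W o)
  have hlower := htube.dominated_transProb hdegree hβ0
  rw [hexponent] at hupper hlower
  refine ⟨⟨M + 2, hvalency⟩, hne, ?_, hupper, hlower⟩
  simp only [profileF, ← hβ]
  exact ⟨htube.folner_dominated hβ0, hiso.exp_rpow_dominated_folner hβ0 hne⟩

end WreathIsoperimetry

section ExpandingPermutations

section Counting

variable {ι : Type*} [Fintype ι] [DecidableEq ι] (S T : Finset ι)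

theorem card_filter_perm_eqOn_le (π₀ : Equiv.Perm ι) :
    (Finset.univ.filter fun π : Equiv.Perm ι => ∀ x ∈ S, π x = π₀ x).card ≤
      (Fintype.card ι - S.card).factorial := by
  have hfix : Fintype.card {σ : Equiv.Perm ι // ∀ a, ¬a ∉ S → σ a = a} =
      (Fintype.card ι - S.card).factorial := by
    rw [← Fintype.card_congr (Equiv.Perm.subtypeEquivSubtypePerm fun a => a ∉ S),
      Fintype.card_perm, Fintype.card_subtype_compl fun a => a ∈ S, Fintype.card_coe]
  rw [← hfix, Fintype.card_subtype]
  refine Finset.card_le_card_of_injOn (fun π => π₀⁻¹ * π) (fun π hπ => ?_)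
    (fun π _ π' _ h => mul_left_cancel h)
  simp only [Finset.coe_filter, Finset.mem_univ, true_and, Set.mem_ofPred_eq] at hπ ⊢
  intro a ha
  simp [hπ a (not_not.1 ha)]

theorem card_filter_perm_mapsTo_le :
    (Finset.univ.filter fun π : Equiv.Perm ι => ∀ x ∈ S, π x ∈ T).card ≤
      (Fintype.card ι - S.card).factorial * T.card ^ S.card := by
  set A := Finset.univ.filter fun π : Equiv.Perm ι => ∀ x ∈ S, π x ∈ T
  refine (Finset.card_le_mul_card_image (f := fun (π : Equiv.Perm ι) (x : S) => π x) A
    (Fintype.card ι - S.card).factorial fun b hb => ?_).trans (Nat.mul_le_mul_left _ ?_)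
  · obtain ⟨π₀, -, rfl⟩ := Finset.mem_image.1 hb
    refine (Finset.card_le_card fun π hπ => ?_).trans (card_filter_perm_eqOn_le S π₀)
    have hrestrict := (Finset.mem_filter.1 hπ).2
    exact Finset.mem_filter.2 ⟨Finset.mem_univ _, fun x hx => congrFun hrestrict ⟨x, hx⟩⟩
  · have hcard : (Fintype.piFinset fun _ : S => T).card = T.card ^ S.card := by simp
    rw [← hcard]
    refine Finset.card_le_card fun b hb => ?_
    obtain ⟨π, hπ, rfl⟩ := Finset.mem_image.1 hb
    exact Fintype.mem_piFinset.2 fun x => (Finset.mem_filter.1 hπ).2 x x.2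

end Counting

theorem pow_mul_factorial_sub_pow_le {N s : ℕ} (hs : 1 ≤ s) (h : 512 * s ^ 4 ≤ N) :
    N ^ s * N ^ (2 * s) * ((N - s).factorial * (2 * s) ^ s) ^ 4 * 2 ^ s ≤ N.factorial ^ 4 := by
  have hs4 : s ≤ s ^ 4 := Nat.le_self_pow (by norm_num) s
  have hfactorial : (N - s).factorial * (N - s) ^ s ≤ N.factorial := by
    have := Nat.factorial_mul_pow_sub_le_factorial (Nat.sub_le N s)
    rwa [Nat.sub_sub_self (by lia)] at this
  have hbase : N ^ 3 * (2 * s) ^ 4 * 2 ≤ (N - s) ^ 4 := by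
    refine Nat.le_of_mul_le_mul_left (c := 16) ?_ (by norm_num)
    calc 16 * (N ^ 3 * (2 * s) ^ 4 * 2) = N ^ 3 * (512 * s ^ 4) := by ring
      _ ≤ N ^ 3 * N := Nat.mul_le_mul_left _ h
      _ = N ^ 4 := by ring
      _ ≤ (2 * (N - s)) ^ 4 := Nat.pow_le_pow_left (by lia) 4
      _ = 16 * (N - s) ^ 4 := by ring
  calc N ^ s * N ^ (2 * s) * ((N - s).factorial * (2 * s) ^ s) ^ 4 * 2 ^ s
      = (N - s).factorial ^ 4 * (N ^ 3 * (2 * s) ^ 4 * 2) ^ s := by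
        rw [mul_pow (N ^ 3 * (2 * s) ^ 4), mul_pow (N ^ 3), pow_right_comm (2 * s) 4 s]
        ring
    _ ≤ (N - s).factorial ^ 4 * ((N - s) ^ 4) ^ s := by gcongr
    _ = ((N - s).factorial * (N - s) ^ s) ^ 4 := by ring
    _ ≤ N.factorial ^ 4 := Nat.pow_le_pow_left hfactorial 4

theorem sum_half_pow_lt_one {I : Finset ℕ} (hI : 0 ∉ I) : ∑ s ∈ I, (1 / 2 : ℝ) ^ s < 1 := by
  obtain ⟨m, hm⟩ := Infinite.exists_notMem_finset (insert 0 I)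
  have hlt : ∑ s ∈ insert 0 I, (1 / 2 : ℝ) ^ s < ∑ s ∈ insert m (insert 0 I), (1 / 2 : ℝ) ^ s := by
    rw [Finset.sum_insert hm]
    exact lt_add_of_pos_left _ (by positivity)
  have hle := summable_geometric_two.sum_le_tsum (insert m (insert 0 I))
    fun s _ => by positivity
  rw [tsum_geometric_two] at hle
  rw [Finset.sum_insert hI, pow_zero] at hlt
  linarith

variable {N : ℕ}

/-- The points reached from `S` by one of the four permutations `π i`. -/
def permsImage (π : Fin 4 → Equiv.Perm (Fin N)) (S : Finset (Fin N)) : Finset (Fin N) :=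
  S.biUnion fun x => Finset.univ.image fun i => π i x

theorem mem_permsImage {π : Fin 4 → Equiv.Perm (Fin N)} {S : Finset (Fin N)} {y : Fin N} :
    y ∈ permsImage π S ↔ ∃ x ∈ S, ∃ i, π i x = y := by
  simp only [permsImage, Finset.mem_biUnion, Finset.mem_image, Finset.mem_univ, true_and]

/-- Four permutations of `N` points under which every set of at most `(N / 512) ^ (1 / 4)` points
more than doubles. -/
def PermsExpand (π : Fin 4 → Equiv.Perm (Fin N)) : Prop :=
  ∀ S : Finset (Fin N), S.Nonempty → 512 * S.card ^ 4 ≤ N → 2 * S.card < (permsImage π S).card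

/-- The quadruples of permutations which send some set of `s` points into a set of `2 s` points. -/
def nonExpandingPerms (N s : ℕ) : Finset (Fin 4 → Equiv.Perm (Fin N)) :=
  (Finset.powersetCard s Finset.univ).biUnion fun S =>
    (Finset.powersetCard (2 * s) Finset.univ).biUnion fun T =>
      Fintype.piFinset fun _ => Finset.univ.filter fun π : Equiv.Perm (Fin N) => ∀ x ∈ S, π x ∈ T

theorem card_nonExpandingPerms_le (N s : ℕ) :
    (nonExpandingPerms N s).card ≤
      N ^ s * N ^ (2 * s) * ((N - s).factorial * (2 * s) ^ s) ^ 4 := by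
  have hchoose : ∀ r, (Finset.powersetCard r (Finset.univ : Finset (Fin N))).card ≤ N ^ r := by
    intro r
    rw [Finset.card_powersetCard, Finset.card_univ, Fintype.card_fin]
    exact Nat.choose_le_pow _ _
  rw [mul_assoc]
  refine (Finset.card_biUnion_le_card_mul _ _
    (N ^ (2 * s) * ((N - s).factorial * (2 * s) ^ s) ^ 4) fun S hS => ?_).trans
    (Nat.mul_le_mul_right _ (hchoose s))
  refine (Finset.card_biUnion_le_card_mul _ _
    (((N - s).factorial * (2 * s) ^ s) ^ 4) fun T hT => ?_).trans
    (Nat.mul_le_mul_right _ (hchoose (2 * s)))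
  have hmapsTo := card_filter_perm_mapsTo_le S T
  rw [(Finset.mem_powersetCard.1 hS).2, (Finset.mem_powersetCard.1 hT).2,
    Fintype.card_fin] at hmapsTo
  rw [Fintype.card_piFinset, Finset.prod_const, Finset.card_univ, Fintype.card_fin]
  convert Nat.pow_le_pow_left hmapsTo 4

theorem exists_mem_nonExpandingPerms {π : Fin 4 → Equiv.Perm (Fin N)} (hπ : ¬PermsExpand π) :
    ∃ s, 1 ≤ s ∧ 512 * s ^ 4 ≤ N ∧ π ∈ nonExpandingPerms N s := by
  simp only [PermsExpand, not_forall, not_lt] at hπ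
  obtain ⟨S, hS, hSN, hcard⟩ := hπ
  have hs4 : S.card ≤ S.card ^ 4 := Nat.le_self_pow (by norm_num) _
  obtain ⟨T, hT, -, hTcard⟩ := Finset.exists_subsuperset_card_eq
    (Finset.subset_univ (permsImage π S)) hcard (by rw [Finset.card_fin]; lia)
  refine ⟨S.card, hS.card_pos, hSN, Finset.mem_biUnion.2 ⟨S, by simp,
    Finset.mem_biUnion.2 ⟨T, by simp [hTcard], Fintype.mem_piFinset.2 fun i => ?_⟩⟩⟩
  exact Finset.mem_filter.2 ⟨Finset.mem_univ _, fun x hx => hT (mem_permsImage.2 ⟨x, hx, i, rfl⟩)⟩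

theorem exists_permsExpand (N : ℕ) : ∃ π : Fin 4 → Equiv.Perm (Fin N), PermsExpand π := by
  by_contra! hcon
  set I := (Finset.range (N + 1)).filter fun s => 1 ≤ s ∧ 512 * s ^ 4 ≤ N
  have hcover : Finset.univ ⊆ I.biUnion (nonExpandingPerms N) := fun π _ => by
    obtain ⟨s, hs, hsN, hπ⟩ := exists_mem_nonExpandingPerms (hcon π)
    have hs4 : s ≤ s ^ 4 := Nat.le_self_pow (by norm_num) s
    exact Finset.mem_biUnion.2
      ⟨s, Finset.mem_filter.2 ⟨Finset.mem_range.2 (by lia), hs, hsN⟩, hπ⟩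
  have hbad : ∀ s ∈ I, ((nonExpandingPerms N s).card : ℝ) ≤
      (N.factorial : ℝ) ^ 4 * (1 / 2) ^ s := fun s hs => by
    obtain ⟨-, hs1, hsN⟩ := Finset.mem_filter.1 hs
    have hcard := (Nat.mul_le_mul_right (2 ^ s) (card_nonExpandingPerms_le N s)).trans
      (pow_mul_factorial_sub_pow_le hs1 hsN)
    rw [one_div, inv_pow, ← div_eq_mul_inv, le_div_iff₀ (by positivity)]
    exact_mod_cast hcard
  have htotal : (Finset.univ : Finset (Fin 4 → Equiv.Perm (Fin N))).card = N.factorial ^ 4 := by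
    simp [Fintype.card_perm]
  refine lt_irrefl ((N.factorial : ℝ) ^ 4) ?_
  calc (N.factorial : ℝ) ^ 4
      ≤ ∑ s ∈ I, ((nonExpandingPerms N s).card : ℝ) := by
        exact_mod_cast htotal.ge.trans
          ((Finset.card_le_card hcover).trans Finset.card_biUnion_le)
    _ ≤ ∑ s ∈ I, (N.factorial : ℝ) ^ 4 * (1 / 2) ^ s := Finset.sum_le_sum hbad
    _ = (N.factorial : ℝ) ^ 4 * ∑ s ∈ I, (1 / 2 : ℝ) ^ s := by rw [Finset.mul_sum]
    _ < (N.factorial : ℝ) ^ 4 := mul_lt_of_lt_one_right (by positivity)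
        (sum_half_pow_lt_one (by simp [I]))

end ExpandingPermutations

section ExpandingGraphs

theorem eq_univ_of_ncard_edgeBoundary_eq_zero {V : Type} [Fintype V] {G : SimpleGraph V}
    (hG : G.Connected) {T : Finset V} (hT : T.Nonempty) (h : (edgeBoundary G T).ncard = 0) :
    T = Finset.univ := by
  obtain ⟨a, ha⟩ := hT
  refine Finset.eq_univ_iff_forall.2 fun b => ?_
  by_contra hb
  obtain ⟨p⟩ := hG.preconnected a b
  obtain ⟨d, -, hfst, hsnd⟩ := p.exists_boundary_dart (T : Set V) ha hb
  exact ((Set.ncard_eq_zero (Set.toFinite _)).1 h).subset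
    (show d.toProd ∈ edgeBoundary G T from ⟨d.adj, hfst, hsnd⟩)

variable {N : ℕ} {π : Fin 4 → Equiv.Perm (Fin N)}

/-- The graph on `N` points formed by the edges `{x, π i x}`, which make it expand, and by the path
`0, 1, …, N - 1`, which makes it connected. -/
def permGraph (π : Fin 4 → Equiv.Perm (Fin N)) : SimpleGraph (Fin N) :=
  SimpleGraph.fromRel fun x y => (∃ i, π i x = y) ∨ x.val + 1 = y.val

theorem permGraph_adj {x y : Fin N} :
    (permGraph π).Adj x y ↔
      x ≠ y ∧ (((∃ i, π i x = y) ∨ x.val + 1 = y.val) ∨ (∃ i, π i y = x) ∨ y.val + 1 = x.val) := by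
  rw [permGraph, SimpleGraph.fromRel_adj]

theorem valency_permGraph_le (π : Fin 4 → Equiv.Perm (Fin N)) (x : Fin N) :
    valency (permGraph π) x ≤ 10 := by
  set A := Finset.univ.image fun i => π i x
  set A' := Finset.univ.image fun i => (π i).symm x
  set P := Finset.univ.filter fun y : Fin N => x.val + 1 = y.val ∨ y.val + 1 = x.val
  have hsub : (permGraph π).neighborSet x ⊆ ↑(A ∪ A' ∪ P) := by
    intro y hy
    simp only [Finset.coe_union, Set.mem_union, Finset.mem_coe, A, A', P, Finset.mem_image,
      Finset.mem_filter, Finset.mem_univ, true_and, Equiv.symm_apply_eq]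
    rcases (permGraph_adj.1 hy).2 with (h | h) | ⟨i, hi⟩ | h
    exacts [.inl (.inl h), .inr (.inl h), .inl (.inr ⟨i, hi.symm⟩), .inr (.inr h)]
  have hA : A.card ≤ 4 := Finset.card_image_le
  have hA' : A'.card ≤ 4 := Finset.card_image_le
  have hP : P.card ≤ 2 := by
    refine le_trans (b := (({x.val - 1, x.val + 1} : Finset ℕ)).card) ?_ Finset.card_le_two
    refine Finset.card_le_card_of_injOn Fin.val (fun y hy => ?_) Fin.val_injective.injOn
    have hy' := (Finset.mem_filter.1 hy).2
    simp only [Finset.coe_insert, Finset.coe_singleton, Set.mem_insert_iff,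
      Set.mem_singleton_iff]
    lia
  calc valency (permGraph π) x ≤ ((A ∪ A' ∪ P : Finset (Fin N)) : Set (Fin N)).ncard :=
        Set.ncard_le_ncard hsub (Finset.finite_toSet _)
    _ = (A ∪ A' ∪ P).card := Set.ncard_coe_finset _
    _ ≤ A.card + A'.card + P.card := (Finset.card_union_le _ _).trans
        (Nat.add_le_add_right (Finset.card_union_le _ _) _)
    _ ≤ 10 := by lia

theorem permGraph_connected (hN : 0 < N) (π : Fin 4 → Equiv.Perm (Fin N)) :
    (permGraph π).Connected := by
  obtain ⟨n, rfl⟩ := Nat.exists_eq_add_one.2 hN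
  refine (SimpleGraph.pathGraph_connected n).mono fun x y hxy => ?_
  exact permGraph_adj.2 ⟨hxy.ne, (SimpleGraph.pathGraph_adj.1 hxy).imp .inr .inr⟩

theorem PermsExpand.card_le_ncard_edgeBoundary (hπ : PermsExpand π) {T : Finset (Fin N)}
    (hT : T.Nonempty) (hsmall : 512 * T.card ^ 4 ≤ N) :
    T.card ≤ (edgeBoundary (permGraph π) T).ncard := by
  have hreach : ((permsImage π T \ T : Finset (Fin N)) : Set (Fin N)) ⊆
      Prod.snd '' edgeBoundary (permGraph π) T := by
    intro y hy
    obtain ⟨hyπ, hyT⟩ := Finset.mem_sdiff.1 (Finset.mem_coe.1 hy)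
    obtain ⟨x, hx, hxy⟩ := mem_permsImage.1 hyπ
    exact ⟨(x, y), ⟨permGraph_adj.2 ⟨ne_of_mem_of_not_mem hx hyT, .inl (.inl hxy)⟩, hx, hyT⟩, rfl⟩
  have hboundary := (Set.ncard_le_ncard hreach (Set.toFinite _)).trans
    (Set.ncard_image_le (Set.toFinite _))
  rw [Set.ncard_coe_finset] at hboundary
  have hexpand := hπ T hT hsmall
  have hsdiff := Finset.le_card_sdiff T (permsImage π T)
  lia

theorem log_le_thirteen_mul_log {n t : ℕ} (hn : 0 < n) (ht : 2 ≤ t) (h : n ≤ 512 * t ^ 4) :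
    Real.log n ≤ 13 * Real.log t := by
  have hpow : n ≤ t ^ 13 := calc
    n ≤ 2 ^ 9 * t ^ 4 := h
    _ ≤ t ^ 9 * t ^ 4 := by gcongr
    _ = t ^ 13 := by ring
  calc Real.log n ≤ Real.log ((t : ℝ) ^ 13) :=
        Real.log_le_log (by exact_mod_cast hn) (by exact_mod_cast hpow)
    _ = 13 * Real.log t := by rw [Real.log_pow]; norm_num

theorem smallSetExpansion_permGraph {L : Type} {n : L → ℕ}
    {π : ∀ z, Fin 4 → Equiv.Perm (Fin (n z))} (hn : ∀ z, 0 < n z) (hπ : ∀ z, PermsExpand (π z)) :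
    SmallSetExpansion (fun z => permGraph (π z)) (1 / 512) (1 / 13) := by
  intro z T hT hboundary
  have hlarge : n z < 512 * T.card ^ 4 := by
    by_contra! hsmall
    have hle : (T.card : ℝ) ≤ (edgeBoundary (permGraph (π z)) T).ncard := by
      exact_mod_cast (hπ z).card_le_ncard_edgeBoundary hT hsmall
    have : (0 : ℝ) < T.card := by exact_mod_cast hT.card_pos
    linarith
  rw [Fintype.card_fin]
  rcases (Nat.succ_le_of_lt hT.card_pos).eq_or_lt with hsingle | hcard
  · have hzero : (edgeBoundary (permGraph (π z)) T).ncard = 0 := by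
      rw [← hsingle] at hboundary
      rw [← Nat.lt_one_iff, ← Nat.cast_lt (α := ℝ)]
      push_cast at hboundary ⊢
      linarith
    have huniv := eq_univ_of_ncard_edgeBoundary_eq_zero (permGraph_connected (hn z) _) hT hzero
    have hone : n z = 1 := by rw [← Finset.card_fin (n z), ← huniv, ← hsingle]
    simp [hone, Real.log_natCast_nonneg]
  · linarith [log_le_thirteen_mul_log (hn z) hcard hlarge.le]

end ExpandingGraphs

section ExponentialFibres

theorem add_one_rpow_sub_one_le {β x : ℝ} (hβ : 1 ≤ β) (hx : 0 ≤ x) :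
    (x + 1) ^ (β - 1) ≤ (x + 1) ^ β - x ^ β := by
  have hsucc : (x + 1) ^ β = (x + 1) ^ (β - 1) * (x + 1) := by
    rw [← Real.rpow_add_one (by positivity), sub_add_cancel]
  have hle : x ^ β ≤ (x + 1) ^ (β - 1) * x := by
    rcases hx.eq_or_lt with rfl | hx
    · simp [Real.zero_rpow (by linarith : β ≠ 0)]
    · calc x ^ β = x ^ (β - 1) * x := by rw [← Real.rpow_add_one hx.ne', sub_add_cancel]
        _ ≤ (x + 1) ^ (β - 1) * x := by
          gcongr
          linarith
  linarith

theorem sum_rpow_increments {β : ℝ} (hβ : β ≠ 0) (m : ℕ) :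
    ∑ z ∈ Finset.Icc (-m : ℤ) m, ((|(z : ℝ)| + 1) ^ β - |(z : ℝ)| ^ β) =
      2 * ((m : ℝ) + 1) ^ β - 1 := by
  induction m with
  | zero => simp [Real.zero_rpow hβ]; norm_num
  | succ m ih =>
    have hIcc : Finset.Icc (-(m + 1 : ℕ) : ℤ) (m + 1 : ℕ) =
        insert ((m : ℤ) + 1) (insert (-((m : ℤ) + 1)) (Finset.Icc (-m : ℤ) m)) := by
      ext z
      simp only [Finset.mem_Icc, Finset.mem_insert]
      lia
    have habs : |(m : ℝ) + 1| = m + 1 := abs_of_nonneg (by positivity)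
    rw [hIcc, Finset.sum_insert (by simp; lia), Finset.sum_insert (by simp), ih]
    push_cast
    rw [abs_neg, habs]
    ring

section FibreSize

variable {α β : ℝ} (hαβ : β = 2 * α / (1 - α))

include hαβ

theorem fibreSize_eq (z : ℤ) :
    fibreSize α z = ⌊Real.exp ((|(z : ℝ)| + 1) ^ β - |(z : ℝ)| ^ β)⌋₊ := by
  rw [fibreSize, profileF, profileF, ← hαβ, Real.exp_sub]

theorem fibreSize_pos (hβ : 1 ≤ β) (z : ℤ) : 0 < fibreSize α z := by
  rw [fibreSize_eq hαβ, Nat.floor_pos]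
  refine Real.one_le_exp (le_trans ?_ (add_one_rpow_sub_one_le hβ (abs_nonneg _)))
  positivity

theorem prod_fibreSize_le (hβ : 0 < β) (m : ℕ) :
    ∏ z ∈ Finset.Icc (-m : ℤ) m, (fibreSize α z : ℝ) ≤ Real.exp (2 * ((m : ℝ) + 1) ^ β) := by
  calc ∏ z ∈ Finset.Icc (-m : ℤ) m, (fibreSize α z : ℝ)
      ≤ ∏ z ∈ Finset.Icc (-m : ℤ) m, Real.exp ((|(z : ℝ)| + 1) ^ β - |(z : ℝ)| ^ β) := by
        gcongr with z
        rw [fibreSize_eq hαβ]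
        exact Nat.floor_le (Real.exp_pos _).le
    _ = Real.exp (2 * ((m : ℝ) + 1) ^ β - 1) := by
        rw [← Real.exp_sum, sum_rpow_increments hβ.ne']
    _ ≤ Real.exp (2 * ((m : ℝ) + 1) ^ β) := Real.exp_le_exp.2 (by linarith)

theorem le_log_fibreSize (hβ : 1 ≤ β) (z : ℤ) :
    (|(z : ℝ)| + 1) ^ (β - 1) / 4 ≤ Real.log (fibreSize α z) := by
  have hincrement := add_one_rpow_sub_one_le hβ (abs_nonneg (z : ℝ))
  have hone : 1 ≤ (|(z : ℝ)| + 1) ^ (β - 1) :=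
    Real.one_le_rpow (by linarith [abs_nonneg (z : ℝ)]) (by linarith)
  have hpos : (1 : ℝ) ≤ fibreSize α z := by exact_mod_cast fibreSize_pos hαβ hβ z
  have hhalf : Real.exp ((|(z : ℝ)| + 1) ^ β - |(z : ℝ)| ^ β) / 2 ≤ fibreSize α z := by
    have hfloor := Nat.lt_floor_add_one (Real.exp ((|(z : ℝ)| + 1) ^ β - |(z : ℝ)| ^ β))
    rw [← fibreSize_eq hαβ] at hfloor
    linarith
  have hlog := Real.log_le_log (by positivity) hhalf
  rw [Real.log_div (Real.exp_pos _).ne' (by norm_num), Real.log_exp] at hlog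
  linarith [Real.log_two_lt_d9]

end FibreSize

theorem le_card_filter_far {k : ℕ} {S : Finset ℤ} (hS : k ≤ 8 * S.card) :
    k ≤ 16 * (S.filter fun z => (k : ℤ) < 32 * (|z| + 1)).card := by
  have hsplit := Finset.card_filter_add_card_filter_not (s := S) fun z => (k : ℤ) < 32 * (|z| + 1)
  have hnear : (S.filter fun z => ¬(k : ℤ) < 32 * (|z| + 1)) ⊆
      Finset.Icc (-((k : ℤ) / 32 - 1)) ((k : ℤ) / 32 - 1) := fun z hz => by
    have hz' := (Finset.mem_filter.1 hz).2
    have hle := le_abs_self z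
    have hge := neg_abs_le z
    rw [Finset.mem_Icc]
    lia
  have hcard := Finset.card_le_card hnear
  rw [Int.card_Icc] at hcard
  lia

theorem windowEntropy_fibreSize {α β : ℝ} (hαβ : β = 2 * α / (1 - α)) (hβ : 1 ≤ β) :
    WindowEntropy (id : ℤ → ℤ) (fun z => Fin (fibreSize α z)) β
      (1 / 64 * (1 / 32) ^ (β - 1)) := by
  intro k hk j S _ hS
  simp only [Finset.image_id, Fintype.card_fin]
  set T := S.filter fun z => (k : ℤ) < 32 * (|z| + 1)
  have hT : (k : ℝ) ≤ 16 * T.card := by exact_mod_cast le_card_filter_far hS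
  have hk0 : (0 : ℝ) < k := by exact_mod_cast hk
  calc 1 / 64 * (1 / 32) ^ (β - 1) * (k : ℝ) ^ β
      = k / 16 * (((k : ℝ) / 32) ^ (β - 1) / 4) := by
        rw [← sub_add_cancel β 1, Real.rpow_add_one hk0.ne', add_sub_cancel_right,
          div_eq_mul_one_div (k : ℝ) 32, Real.mul_rpow hk0.le (by norm_num)]
        ring
    _ ≤ T.card * (((k : ℝ) / 32) ^ (β - 1) / 4) := by
        gcongr
        linarith
    _ ≤ ∑ z ∈ T, Real.log (fibreSize α z) := by
        rw [← nsmul_eq_mul]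
        refine Finset.card_nsmul_le_sum _ _ _ fun z hz => (?_ : _ ≤ _).trans
          (le_log_fibreSize hαβ hβ z)
        have hfar : (k : ℝ) < 32 * (|(z : ℝ)| + 1) := by exact_mod_cast (Finset.mem_filter.1 hz).2
        gcongr
        linarith
    _ ≤ ∑ z ∈ S, Real.log (fibreSize α z) :=
        Finset.sum_le_sum_of_subset_of_nonneg (Finset.filter_subset _ _)
          fun z _ _ => Real.log_natCast_nonneg _

theorem exists_fibres_hasExpectedDecay {α : ℝ} (hα : 1 / 3 ≤ α) (hα1 : α < 1) :
    ∃ (B : ∀ z : ℤ, SimpleGraph (Fin (fibreSize α z))) (o : ∀ z : ℤ, Fin (fibreSize α z)),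
      (∀ z, (B z).Connected) ∧
      (∃ M : ℕ, ∀ (z : ℤ) (x : Fin (fibreSize α z)), valency (B z) x ≤ M) ∧
      HasExpectedDecay α (wreath intGraph (fun z => Fin (fibreSize α z)) B o)
        (0, LampConfig.rest (fun z => Fin (fibreSize α z)) o) := by
  have hβ : 1 ≤ 2 * α / (1 - α) := by rw [le_div_iff₀ (by linarith)]; linarith
  have hpos := fibreSize_pos rfl hβ
  choose π hπ using fun z => exists_permsExpand (fibreSize α z)
  have hvalency : ∀ z x, valency (permGraph (π z)) x ≤ 10 := fun z => valency_permGraph_le (π z)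
  refine ⟨fun z => permGraph (π z), fun z => ⟨0, hpos z⟩,
    fun z => permGraph_connected (hpos z) _, ⟨10, hvalency⟩, ?_⟩
  refine hasExpectedDecay_intWreath (by linarith) hα1 rfl (by norm_num) (by norm_num)
    (by positivity) two_pos hvalency (smallSetExpansion_permGraph hpos hπ)
    (windowEntropy_fibreSize rfl hβ) fun m => ?_
  simpa only [Finset.image_id, Fintype.card_fin] using prod_fibreSize_le rfl (by linarith) m

end ExponentialFibres

section BinaryDigits

theorem card_le_two_pow_of_bits {X ι : Type*} {A : Finset X} {I : Finset ι} (bit : X → ι → ℤ)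
    (hbit : ∀ a ∈ A, ∀ i ∈ I, bit a i ∈ ({0, 1} : Finset ℤ))
    (hinj : ∀ a ∈ A, ∀ b ∈ A, (∀ i ∈ I, bit a i = bit b i) → a = b) : A.card ≤ 2 ^ I.card := by
  classical
  have hcard : (Fintype.piFinset fun _ : I => ({0, 1} : Finset ℤ)).card = 2 ^ I.card := by
    simp [Fintype.card_piFinset]
  rw [← hcard]
  refine Finset.card_le_card_of_injOn (fun a i => bit a i)
    (fun a ha => Fintype.mem_piFinset.2 fun i => hbit a ha i i.2) fun a ha b hb hab => ?_
  exact hinj a ha b hb fun i hi => congrFun hab ⟨i, hi⟩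

theorem binaryDigit_mem (a : ℤ) (i : ℕ) : a / 2 ^ i % 2 ∈ ({0, 1} : Finset ℤ) := by
  rw [Finset.mem_insert, Finset.mem_singleton]
  lia

theorem ediv_two_pow_succ (a : ℤ) (i : ℕ) : a / 2 ^ (i + 1) = a / 2 ^ i / 2 := by
  rw [pow_succ, Int.ediv_ediv_of_nonneg (by positivity)]

theorem ediv_two_pow_eq_of_le {a b : ℤ} {i j : ℕ} (hij : i ≤ j) (h : a / 2 ^ i = b / 2 ^ i) :
    a / 2 ^ j = b / 2 ^ j := by
  induction j, hij using Nat.le_induction with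
  | base => exact h
  | succ j _ ih => rw [ediv_two_pow_succ, ediv_two_pow_succ, ih]

theorem eq_of_binaryDigits_eq {a b : ℤ} {j : ℕ} (h : ∀ i < j, a / 2 ^ i % 2 = b / 2 ^ i % 2)
    (hj : a / 2 ^ j = b / 2 ^ j) : a = b := by
  induction j with
  | zero => simpa using hj
  | succ j ih =>
    refine ih (fun i hi => h i (by lia)) ?_
    have hdigit := h j (by lia)
    rw [ediv_two_pow_succ, ediv_two_pow_succ] at hj
    lia

theorem exists_two_pow_mem_Icc {k : ℕ} (hk : 1 ≤ k) : ∃ e : ℕ, 2 ^ e ∈ Set.Icc k (2 * k) := by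
  refine ⟨Nat.log 2 k + 1, (Nat.lt_pow_succ_log_self (by norm_num) k).le, ?_⟩
  rw [pow_succ, mul_comm]
  exact Nat.mul_le_mul_left _ (Nat.pow_log_le_self 2 (by lia))

theorem ediv_two_pow_mem_of_mem_Ico {k e : ℕ} (hke : k ≤ 2 ^ e) {a₀ a : ℤ}
    (ha : a ∈ Finset.Ico a₀ (a₀ + k)) :
    a / 2 ^ e = a₀ / 2 ^ e ∨ a / 2 ^ e = a₀ / 2 ^ e + 1 := by
  rw [Finset.mem_Ico] at ha
  have hpos : (0 : ℤ) < 2 ^ e := by positivity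
  have : (k : ℤ) ≤ 2 ^ e := by exact_mod_cast hke
  have hlower := Int.ediv_le_ediv hpos ha.1
  have hupper := Int.ediv_le_ediv hpos (by linarith : a ≤ a₀ + 1 * 2 ^ e)
  rw [Int.add_mul_ediv_right _ _ hpos.ne'] at hupper
  lia

theorem two_rpow_le_two {γ : ℝ} (hγ : γ ≤ 1) : (2 : ℝ) ^ γ ≤ 2 :=
  (Real.rpow_le_rpow_of_exponent_le one_le_two hγ).trans_eq (Real.rpow_one 2)

theorem two_mul_rpow_le {γ x : ℝ} (hγ : γ ≤ 1) (hx : 0 ≤ x) : (2 * x) ^ γ ≤ 2 * x ^ γ := by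
  rw [Real.mul_rpow zero_le_two hx]
  gcongr
  exact two_rpow_le_two hγ

theorem two_pow_le_four_mul_rpow {γ : ℝ} (hγ0 : 0 ≤ γ) (hγ1 : γ ≤ 1) {e k m : ℕ}
    (he : 2 ^ e ≤ 2 * k) (hm : (m : ℝ) ≤ γ * e + 1) : (2 : ℝ) ^ m ≤ 4 * (k : ℝ) ^ γ := by
  calc (2 : ℝ) ^ m ≤ (2 : ℝ) ^ (e * γ + 1) := by
        rw [← Real.rpow_natCast]
        exact Real.rpow_le_rpow_of_exponent_le one_le_two (by linarith)
    _ = ((2 : ℝ) ^ e) ^ γ * 2 := by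
        rw [Real.rpow_add_one two_ne_zero, Real.rpow_mul zero_le_two, Real.rpow_natCast]
    _ ≤ (2 * (k : ℝ)) ^ γ * 2 := by
        gcongr
        exact_mod_cast he
    _ ≤ 4 * (k : ℝ) ^ γ := by linarith [two_mul_rpow_le hγ1 (Nat.cast_nonneg (α := ℝ) k)]

end BinaryDigits

section RetainedDigits

/-- A set of positions `i` of binary digits, of density `β`, containing `⌊β * j⌋` of the first `j`
positions. -/
def Retained (β : ℝ) (i : ℕ) : Prop := ⌊β * i⌋₊ < ⌊β * (i + 1 : ℕ)⌋₊

open Classical in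
/-- The binary digits of `n` in the retained positions, the other ones being erased. -/
noncomputable def retainedDigits (β : ℝ) (n : ℤ) (i : ℕ) : ℤ :=
  if Retained β i then n / 2 ^ i % 2 else 0

variable {β : ℝ} (hβ0 : 0 ≤ β) (hβ1 : β ≤ 1)

include hβ0 hβ1

open Classical in
theorem card_filter_retained (j : ℕ) :
    ((Finset.range j).filter (Retained β)).card = ⌊β * j⌋₊ := by
  induction j with
  | zero => simp
  | succ j ih =>
    have hmono : ⌊β * j⌋₊ ≤ ⌊β * (j + 1 : ℕ)⌋₊ := by
      gcongr
      lia
    have hle : ⌊β * (j + 1 : ℕ)⌋₊ ≤ ⌊β * j⌋₊ + 1 := by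
      rw [← Nat.floor_add_one (by positivity)]
      refine Nat.floor_mono ?_
      push_cast
      linarith
    rw [Finset.range_add_one, Finset.filter_insert]
    split_ifs with h
    · rw [Finset.card_insert_of_notMem (by simp), ih]
      exact le_antisymm (Nat.succ_le_of_lt h) hle
    · rw [ih]
      exact le_antisymm hmono (not_lt.1 h)

open Classical in
theorem floor_add_card_filter_not_retained (j : ℕ) :
    ⌊β * j⌋₊ + ((Finset.range j).filter fun i => ¬Retained β i).card = j := by
  rw [← card_filter_retained hβ0 hβ1, Finset.card_filter_add_card_filter_not, Finset.card_range]

variable {A : Finset ℤ} {j : ℕ} {q : ℤ}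

open Classical in
theorem card_image_retainedDigits_le_of_ediv_eq (hA : ∀ a ∈ A, a / 2 ^ j = q) :
    (A.image (retainedDigits β)).card ≤ 2 ^ ⌊β * j⌋₊ := by
  rw [← card_filter_retained hβ0 hβ1]
  refine card_le_two_pow_of_bits (fun f i => f i) (fun f hf i hi => ?_) fun f hf g hg hfg => ?_
  · obtain ⟨a, -, rfl⟩ := Finset.mem_image.1 hf
    rw [retainedDigits, if_pos (Finset.mem_filter.1 hi).2]
    exact binaryDigit_mem a i
  · obtain ⟨a, ha, rfl⟩ := Finset.mem_image.1 hf
    obtain ⟨b, hb, rfl⟩ := Finset.mem_image.1 hg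
    funext i
    by_cases hi : Retained β i
    · rcases Nat.lt_or_ge i j with hij | hij
      · exact hfg i (Finset.mem_filter.2 ⟨Finset.mem_range.2 hij, hi⟩)
      · rw [retainedDigits, retainedDigits,
          ediv_two_pow_eq_of_le hij ((hA a ha).trans (hA b hb).symm)]
    · rw [retainedDigits, retainedDigits, if_neg hi, if_neg hi]

theorem card_le_of_ediv_eq_of_retainedDigits_eq {f : ℕ → ℤ} (hA : ∀ a ∈ A, a / 2 ^ j = q)
    (hf : ∀ a ∈ A, retainedDigits β a = f) : A.card ≤ 2 ^ (j - ⌊β * j⌋₊) := by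
  classical
  rw [← Nat.eq_sub_of_add_eq' (floor_add_card_filter_not_retained hβ0 hβ1 j)]
  refine card_le_two_pow_of_bits (fun a i => a / 2 ^ i % 2) (fun a _ i _ => binaryDigit_mem a i)
    fun a ha b hb hab => ?_
  refine eq_of_binaryDigits_eq (j := j) (fun i hi => ?_) ((hA a ha).trans (hA b hb).symm)
  by_cases hr : Retained β i
  · have hdigit := congrFun ((hf a ha).trans (hf b hb).symm) i
    rwa [retainedDigits, retainedDigits, if_pos hr, if_pos hr] at hdigit
  · exact hab i (Finset.mem_filter.2 ⟨Finset.mem_range.2 hi, hr⟩)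

end RetainedDigits

section EvenlySpread

/-- A map on `ℤ` which takes at most `≼ k ^ β` values on every interval of length `k`, and at least
`≽ |A| / k ^ (1 - β)` values on every subset `A` of such an interval. -/
structure EvenlySpread {X : Type*} [DecidableEq X] (φ : ℤ → X) (β : ℝ) : Prop where
  card_image_le : ∀ {k : ℕ} {a₀ : ℤ} {A : Finset ℤ}, 1 ≤ k → A ⊆ Finset.Ico a₀ (a₀ + k) →
    ((A.image φ).card : ℝ) ≤ 8 * (k : ℝ) ^ β
  card_le : ∀ {k : ℕ} {a₀ : ℤ} {A : Finset ℤ}, 1 ≤ k → A ⊆ Finset.Ico a₀ (a₀ + k) →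
    (A.card : ℝ) ≤ 8 * (k : ℝ) ^ (1 - β) * (A.image φ).card

open Classical in
theorem card_image_retainedDigits_le {β : ℝ} (hβ0 : 0 ≤ β) (hβ1 : β ≤ 1) {k : ℕ} (hk : 1 ≤ k)
    {a₀ : ℤ} {A : Finset ℤ} (hA : A ⊆ Finset.Ico a₀ (a₀ + k)) :
    ((A.image (retainedDigits β)).card : ℝ) ≤ 8 * (k : ℝ) ^ β := by
  obtain ⟨e, hke, hek⟩ := exists_two_pow_mem_Icc hk
  set block : ℤ → Finset ℤ := fun q => A.filter fun a => a / 2 ^ e = q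
  have hblocks : A.image (retainedDigits β) ⊆ (block (a₀ / 2 ^ e)).image (retainedDigits β) ∪
      (block (a₀ / 2 ^ e + 1)).image (retainedDigits β) := by
    rw [← Finset.image_union, ← Finset.filter_or]
    exact Finset.image_subset_image fun a ha =>
      Finset.mem_filter.2 ⟨ha, ediv_two_pow_mem_of_mem_Ico hke (hA ha)⟩
  have hblock : ∀ q, ((block q).image (retainedDigits β)).card ≤ 2 ^ ⌊β * e⌋₊ := fun q =>
    card_image_retainedDigits_le_of_ediv_eq hβ0 hβ1 fun a ha => (Finset.mem_filter.1 ha).2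
  have hcard : (A.image (retainedDigits β)).card ≤ 2 * 2 ^ ⌊β * e⌋₊ := by
    rw [two_mul]
    exact (Finset.card_le_card hblocks).trans
      ((Finset.card_union_le _ _).trans (add_le_add (hblock _) (hblock _)))
  have hpow := two_pow_le_four_mul_rpow hβ0 hβ1 hek
    ((Nat.floor_le (by positivity)).trans (le_add_of_nonneg_right zero_le_one))
  calc ((A.image (retainedDigits β)).card : ℝ) ≤ 2 * 2 ^ ⌊β * e⌋₊ := by exact_mod_cast hcard
    _ ≤ 8 * (k : ℝ) ^ β := by linarith

open Classical in
theorem card_le_mul_card_image_retainedDigits {β : ℝ} (hβ0 : 0 ≤ β) (hβ1 : β ≤ 1) {k : ℕ}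
    (hk : 1 ≤ k) {a₀ : ℤ} {A : Finset ℤ} (hA : A ⊆ Finset.Ico a₀ (a₀ + k)) :
    (A.card : ℝ) ≤ 8 * (k : ℝ) ^ (1 - β) * (A.image (retainedDigits β)).card := by
  obtain ⟨e, hke, hek⟩ := exists_two_pow_mem_Icc hk
  set block : ℤ → (ℕ → ℤ) → Finset ℤ := fun q f =>
    A.filter fun a => a / 2 ^ e = q ∧ retainedDigits β a = f
  have hblock : ∀ q f, (block q f).card ≤ 2 ^ (e - ⌊β * e⌋₊) := fun q f =>
    card_le_of_ediv_eq_of_retainedDigits_eq hβ0 hβ1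
      (fun a ha => (Finset.mem_filter.1 ha).2.1) fun a ha => (Finset.mem_filter.1 ha).2.2
  have hfibre : ∀ f, (A.filter fun a => retainedDigits β a = f).card ≤
      2 * 2 ^ (e - ⌊β * e⌋₊) := fun f => by
    have hblocks : (A.filter fun a => retainedDigits β a = f) ⊆
        block (a₀ / 2 ^ e) f ∪ block (a₀ / 2 ^ e + 1) f := fun a ha => by
      obtain ⟨haA, haf⟩ := Finset.mem_filter.1 ha
      rw [← Finset.filter_or, Finset.mem_filter, ← or_and_right]
      exact ⟨haA, ediv_two_pow_mem_of_mem_Ico hke (hA haA), haf⟩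
    rw [two_mul]
    exact (Finset.card_le_card hblocks).trans
      ((Finset.card_union_le _ _).trans (add_le_add (hblock _ _) (hblock _ _)))
  have hexponent : ((e - ⌊β * e⌋₊ : ℕ) : ℝ) ≤ (1 - β) * e + 1 := by
    rw [Nat.cast_sub (Nat.le.intro (floor_add_card_filter_not_retained hβ0 hβ1 e))]
    linarith [Nat.lt_floor_add_one (β * e)]
  have hpow := two_pow_le_four_mul_rpow (sub_nonneg.2 hβ1) (by linarith) hek hexponent
  calc (A.card : ℝ) ≤ 2 * 2 ^ (e - ⌊β * e⌋₊) * (A.image (retainedDigits β)).card := by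
        exact_mod_cast Finset.card_le_mul_card_image A _ fun f _ => hfibre f
    _ ≤ 8 * (k : ℝ) ^ (1 - β) * (A.image (retainedDigits β)).card := by
        exact mul_le_mul_of_nonneg_right (by linarith) (Nat.cast_nonneg _)

open Classical in
theorem evenlySpread_retainedDigits {β : ℝ} (hβ0 : 0 ≤ β) (hβ1 : β ≤ 1) :
    EvenlySpread (retainedDigits β) β :=
  ⟨fun hk hA => card_image_retainedDigits_le hβ0 hβ1 hk hA,
    fun hk hA => card_le_mul_card_image_retainedDigits hβ0 hβ1 hk hA⟩

namespace EvenlySpread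

variable {X : Type*} [DecidableEq X] {φ : ℤ → X} {β : ℝ}

theorem rpow_le_card_image (hφ : EvenlySpread φ β) {k : ℕ} {a₀ : ℤ} {A : Finset ℤ} (hk : 1 ≤ k)
    (hA : A ⊆ Finset.Ico a₀ (a₀ + k)) (hkA : k ≤ 8 * A.card) :
    (k : ℝ) ^ β ≤ 64 * (A.image φ).card := by
  have hk0 : (0 : ℝ) < k := by exact_mod_cast hk
  have hkA' : (k : ℝ) ≤ 8 * A.card := by exact_mod_cast hkA
  have hsplit : (k : ℝ) ^ (1 - β) * (k : ℝ) ^ β = k := by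
    rw [← Real.rpow_add hk0, sub_add_cancel, Real.rpow_one]
  refine le_of_mul_le_mul_left ?_ (by positivity : (0 : ℝ) < (k : ℝ) ^ (1 - β))
  linarith [hφ.card_le hk hA]

theorem infinite_range (hφ : EvenlySpread φ β) (hβ : 0 < β) : (Set.range φ).Infinite := by
  intro hfin
  obtain ⟨k, hk, hcard⟩ := exists_nat_rpow_ge hβ (64 * (hfin.toFinset.card + 1))
  have himage : ((Finset.Ico 0 (0 + k : ℤ)).image φ).card ≤ hfin.toFinset.card :=
    Finset.card_le_card fun x hx => by
      obtain ⟨a, -, rfl⟩ := Finset.mem_image.1 hx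
      simp
  have himage' : (((Finset.Ico 0 (0 + k : ℤ)).image φ).card : ℝ) ≤ hfin.toFinset.card := by
    exact_mod_cast himage
  have hlower := hφ.rpow_le_card_image (a₀ := 0) hk subset_rfl (by rw [Int.card_Ico]; lia)
  linarith

theorem of_injective_comp {Y : Type*} [DecidableEq Y] {ψ : X → Y} (hψ : Function.Injective ψ)
    (h : EvenlySpread (ψ ∘ φ) β) : EvenlySpread φ β := by
  have hcard : ∀ A : Finset ℤ, (A.image (ψ ∘ φ)).card = (A.image φ).card := fun A => by
    rw [← Finset.image_image, Finset.card_image_of_injective _ hψ]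
  constructor
  · intro k a₀ A hk hA
    exact hcard A ▸ h.card_image_le hk hA
  · intro k a₀ A hk hA
    exact hcard A ▸ h.card_le hk hA

end EvenlySpread

theorem exists_surjective_evenlySpread {β : ℝ} (hβ0 : 0 < β) (hβ1 : β ≤ 1) :
    ∃ φ : ℤ → ℤ, Function.Surjective φ ∧ EvenlySpread φ β := by
  classical
  have hspread := evenlySpread_retainedDigits hβ0.le hβ1
  have : Infinite (Set.range (retainedDigits β)) := (hspread.infinite_range hβ0).to_subtype
  have : Countable (Set.range (retainedDigits β)) := (Set.countable_range _).to_subtype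
  obtain ⟨_⟩ := nonempty_denumerable (Set.range (retainedDigits β))
  let e : Set.range (retainedDigits β) ≃ ℤ := Denumerable.equiv₂ _ _
  refine ⟨e ∘ Set.rangeFactorization (retainedDigits β),
    e.surjective.comp Set.rangeFactorization_surjective, ?_⟩
  refine .of_injective_comp (Subtype.val_injective.comp e.symm.injective) ?_
  convert hspread using 1
  funext n
  simp

end EvenlySpread

section LampGroupTwo

theorem zmodTwoGraph_eq_top : zmodTwoGraph = ⊤ := by
  ext a b
  simp only [zmodTwoGraph, SimpleGraph.circulantGraph, SimpleGraph.fromRel_adj,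
    Set.mem_singleton_iff, SimpleGraph.top_adj]
  revert a b
  decide

theorem zmodTwoGraph_connected : zmodTwoGraph.Connected := by
  rw [zmodTwoGraph_eq_top]
  exact SimpleGraph.connected_top

theorem smallSetExpansion_zmodTwoGraph {L : Type} :
    SmallSetExpansion (fun _ : L => zmodTwoGraph) 1 1 := by
  intro _ T hT hboundary
  suffices T = Finset.univ by rw [this, Finset.card_univ, one_mul]
  by_contra hne
  have hcard : T.card ≤ 1 := by
    have hlt := Finset.card_lt_univ_of_notMem
      (not_forall.1 (mt Finset.eq_univ_iff_forall.2 hne)).choose_spec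
    rw [ZMod.card] at hlt
    lia
  have hzero : (edgeBoundary zmodTwoGraph T).ncard ≠ 0 :=
    fun h => hne (eq_univ_of_ncard_edgeBoundary_eq_zero zmodTwoGraph_connected hT h)
  have hcard' : (T.card : ℝ) ≤ (edgeBoundary zmodTwoGraph T).ncard := by
    exact_mod_cast hcard.trans (Nat.one_le_iff_ne_zero.2 hzero)
  linarith

namespace EvenlySpread

theorem exists_rpow_le_card_image_Icc {X : Type*} [DecidableEq X] {φ : ℤ → X} {β : ℝ}
    (hφ : EvenlySpread φ β) (hβ0 : 0 ≤ β) (hβ1 : β ≤ 1) :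
    ∃ c C : ℝ, 0 < c ∧ 0 < C ∧ ∀ (k : ℤ) (m : ℕ), 1 ≤ m →
      c * (m : ℝ) ^ β ≤ (((Finset.Icc k (k + m)).image φ).card : ℝ) ∧
      (((Finset.Icc k (k + m)).image φ).card : ℝ) ≤ C * (m : ℝ) ^ β := by
  refine ⟨1 / 64, 16, by norm_num, by norm_num, fun k m hm => ?_⟩
  have hIcc : Finset.Icc k (k + m) = Finset.Ico k (k + (m + 1 : ℕ)) := by
    ext a
    rw [Finset.mem_Icc, Finset.mem_Ico]
    lia
  rw [hIcc]
  constructor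
  · have hlower := hφ.rpow_le_card_image (k := m + 1) (by lia) (subset_refl (Finset.Ico k _))
      (by rw [Int.card_Ico]; lia)
    have hmono : (m : ℝ) ^ β ≤ ((m + 1 : ℕ) : ℝ) ^ β := by
      gcongr
      lia
    linarith
  · have hupper := hφ.card_image_le (k := m + 1) (by lia) (subset_refl (Finset.Ico k _))
    have hmono : ((m + 1 : ℕ) : ℝ) ^ β ≤ (2 * (m : ℝ)) ^ β := by
      gcongr
      exact_mod_cast (by lia : m + 1 ≤ 2 * m)
    linarith [two_mul_rpow_le hβ1 (Nat.cast_nonneg (α := ℝ) m)]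

variable {L : Type} [DecidableEq L] {φ : ℤ → L} {β : ℝ}

theorem windowEntropy_zmodTwo (hφ : EvenlySpread φ β) :
    WindowEntropy φ (fun _ => ZMod 2) β (Real.log 2 / 64) := by
  intro k hk j S hS hkS
  have hlower := hφ.rpow_le_card_image hk (fun a ha => (ediv_eq_iff_mem_Ico hk).1 (hS a ha)) hkS
  rw [Finset.sum_const, ZMod.card, nsmul_eq_mul]
  calc Real.log 2 / 64 * (k : ℝ) ^ β ≤ Real.log 2 / 64 * (64 * (S.image φ).card) := by gcongr
    _ = (S.image φ).card * Real.log 2 := by ring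

theorem prod_card_zmodTwo_le (hφ : EvenlySpread φ β) (hβ : β ≤ 1) (m : ℕ) :
    ∏ _x ∈ (Finset.Icc (-m : ℤ) m).image φ, (Fintype.card (ZMod 2) : ℝ) ≤
      Real.exp (16 * ((m : ℝ) + 1) ^ β) := by
  have hupper := hφ.card_image_le (k := 2 * (m + 1)) (a₀ := -m) (A := Finset.Icc (-m : ℤ) m)
    (by lia) fun a ha => by
      rw [Finset.mem_Icc] at ha
      rw [Finset.mem_Ico]
      lia
  push_cast at hupper
  rw [Finset.prod_const, ZMod.card, Nat.cast_two]
  calc (2 : ℝ) ^ ((Finset.Icc (-m : ℤ) m).image φ).card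
      ≤ Real.exp 1 ^ ((Finset.Icc (-m : ℤ) m).image φ).card := by
        gcongr
        linarith [Real.add_one_le_exp 1]
    _ = Real.exp ((Finset.Icc (-m : ℤ) m).image φ).card := by rw [← Real.exp_nat_mul, mul_one]
    _ ≤ Real.exp (16 * ((m : ℝ) + 1) ^ β) := Real.exp_le_exp.2 (by
        linarith [two_mul_rpow_le hβ (by positivity : (0 : ℝ) ≤ m + 1)])

end EvenlySpread

theorem exists_lampMap_hasExpectedDecay {α : ℝ} (hα : 0 < α) (hα1 : α ≤ 1 / 3) :
    ∃ φ : ℤ → ℤ, Function.Surjective φ ∧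
      (∃ c C : ℝ, 0 < c ∧ 0 < C ∧ ∀ (k : ℤ) (m : ℕ), 1 ≤ m →
        c * (m : ℝ) ^ (2 * α / (1 - α)) ≤ (((Finset.Icc k (k + m)).image φ).card : ℝ) ∧
        (((Finset.Icc k (k + m)).image φ).card : ℝ) ≤ C * (m : ℝ) ^ (2 * α / (1 - α))) ∧
      HasExpectedDecay α
        (generalizedWreath intGraph φ (fun _ : ℤ => ZMod 2) (fun _ : ℤ => zmodTwoGraph)
          (fun _ : ℤ => 0))
        (0, LampConfig.rest (fun _ : ℤ => ZMod 2) (fun _ : ℤ => 0)) := by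
  have hβ0 : 0 < 2 * α / (1 - α) := div_pos (by linarith) (by linarith)
  have hβ1 : 2 * α / (1 - α) ≤ 1 := by rw [div_le_one (by linarith)]; linarith
  obtain ⟨φ, hsurj, hφ⟩ := exists_surjective_evenlySpread hβ0 hβ1
  refine ⟨φ, hsurj, hφ.exists_rpow_le_card_image_Icc hβ0.le hβ1, ?_⟩
  have hvalency : ∀ (_ : ℤ) (x : ZMod 2), valency zmodTwoGraph x ≤ 2 := fun _ x =>
    (Set.ncard_le_card _).trans_eq (Nat.card_zmod 2)
  exact hasExpectedDecay_intWreath hα (by linarith) rfl one_pos one_pos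
    (div_pos (Real.log_pos one_lt_two) (by norm_num)) (by norm_num) hvalency
    smallSetExpansion_zmodTwoGraph hφ.windowEntropy_zmodTwo (hφ.prod_card_zmodTwo_le hβ1)

end LampGroupTwo

section Connectivity

variable {L : Type} {W : L → Type} {o : ∀ z, W z}

theorem infinite_int_prod_lampConfig : Infinite (ℤ × LampConfig W o) :=
  have : Nonempty (LampConfig W o) := ⟨LampConfig.rest W o⟩
  Prod.infinite_of_left

variable {φ : ℤ → L} {B : ∀ z, SimpleGraph (W z)}

theorem intWreath_reachable_move (a : ℤ) (f : LampConfig W o) :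
    (intWreath φ B o).Reachable (0, f) (a, f) := by
  classical
  induction a using Int.induction_on with
  | zero => exact SimpleGraph.Reachable.refl _
  | succ a ih =>
    exact ih.trans (SimpleGraph.Adj.reachable ((intWreath_adj _ _).2 (.inl (.inl rfl))))
  | pred a ih =>
    exact ih.trans (SimpleGraph.Adj.reachable ((intWreath_adj _ _).2 (.inl (.inr rfl))))

theorem intWreath_reachable_switch [DecidableEq L] (hB : ∀ z, (B z).Connected) (a : ℤ)
    (f : LampConfig W o) (v : W (φ a)) :
    (intWreath φ B o).Reachable (a, f) (a, f.switch (φ a) v) := by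
  let fibreHom : B (φ a) →g intWreath φ B o :=
    { toFun := fun w => (a, f.switch (φ a) w)
      map_rel' := fun {w w'} hww' => (intWreath_adj _ _).2 <| .inr ⟨w', by
        rwa [LampConfig.switch_apply_same], by rw [LampConfig.switch_switch]⟩ }
  have hreach := ((hB (φ a)).preconnected (f.1 (φ a)) v).map fibreHom
  have hstart : fibreHom (f.1 (φ a)) = (a, f) := congrArg (Prod.mk a) (f.switch_self (φ a))
  rwa [hstart] at hreach

theorem intWreath_reachable_rest (hφ : Function.Surjective φ) (hB : ∀ z, (B z).Connected)
    (s : Finset L) (f : LampConfig W o) (hf : ∀ z ∉ s, f.1 z = o z) :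
    (intWreath φ B o).Reachable (0, f) (0, LampConfig.rest W o) := by
  classical
  induction s using Finset.induction_on generalizing f with
  | empty =>
    rw [LampConfig.ext (f := f) (g := LampConfig.rest W o) fun z => hf z (Finset.notMem_empty z)]
  | insert x s _ ih =>
    obtain ⟨a, rfl⟩ := hφ x
    have hswitch : (intWreath φ B o).Reachable (0, f) (0, f.switch (φ a) (o (φ a))) :=
      ((intWreath_reachable_move a f).trans (intWreath_reachable_switch hB a f _)).trans
        (intWreath_reachable_move a _).symm
    refine hswitch.trans (ih _ fun z hz => ?_)
    by_cases hza : z = φ a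
    · subst hza
      exact f.switch_apply_same _ _
    · rw [f.switch_apply_of_ne hza]
      exact hf z (by simp [hza, hz])

theorem intWreath_connected (hφ : Function.Surjective φ) (hB : ∀ z, (B z).Connected) :
    (intWreath φ B o).Connected := by
  have hroot : ∀ u, (intWreath φ B o).Reachable u (0, LampConfig.rest W o) := fun ⟨a, f⟩ =>
    (intWreath_reachable_move a f).symm.trans
      (intWreath_reachable_rest hφ hB f.2.toFinset f fun z hz => by simpa using hz)
  have : Nonempty (ℤ × LampConfig W o) := ⟨(0, LampConfig.rest W o)⟩
  exact SimpleGraph.Connected.mk fun u v => (hroot u).trans (hroot v).symm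

end Connectivity

section Edgeless

variable {V : Type}

theorem singleton_mem_folnerSets_bot (k : ℕ) (x : V) :
    {x} ∈ folnerSets (⊥ : SimpleGraph V) k := by
  simp [folnerSets, edgeBoundary]

theorem folner_bot [Nonempty V] (k : ℕ) : folner (⊥ : SimpleGraph V) k = 1 := by
  obtain ⟨x⟩ := ‹Nonempty V›
  have hx := singleton_mem_folnerSets_bot k x
  refine le_antisymm (Nat.sInf_le ⟨{x}, hx, Finset.card_singleton x⟩) ?_
  obtain ⟨U, hU, hcard⟩ := Nat.sInf_mem (Set.Nonempty.image Finset.card ⟨_, hx⟩)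
  exact hU.1.card_pos.trans_eq hcard

theorem transProb_bot (n : ℕ) (x : V) : transProb (⊥ : SimpleGraph V) n x x = 1 := by
  induction n with
  | zero => simp [transProb]
  | succ n ih =>
    rw [transProb, tsum_eq_single x fun z hz => by simp [walkStep, hz.symm], ih]
    simp [walkStep, valency]

theorem comparable_const {a b : ℝ} (ha : 0 < a) (hb : 0 < b) :
    Comparable (fun _ => a) fun _ => b :=
  ⟨⟨a / b, by positivity, 1, one_pos, fun _ => (div_mul_cancel₀ a hb.ne').ge⟩,
    ⟨b / a, by positivity, 1, one_pos, fun _ => (div_mul_cancel₀ b ha.ne').ge⟩⟩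

theorem hasExpectedDecay_bot (x : V) : HasExpectedDecay 0 (⊥ : SimpleGraph V) x := by
  have : Nonempty V := ⟨x⟩
  refine ⟨⟨0, fun y => by simp⟩,
    fun k => ⟨_, singleton_mem_folnerSets_bot k x⟩, ?_, ?_⟩
  · simpa [folner_bot, profileF] using comparable_const one_pos (Real.exp_pos 1)
  · simpa [transProb_bot] using comparable_const one_pos (Real.exp_pos (-1))

end Edgeless

theorem mainTheorem1 (α : ℝ) (hα₀ : 0 ≤ α) (hα₁ : α < 1) :
    (∃ (V : Type) (D : SimpleGraph V) (d₀ : V),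
      Infinite V ∧ (0 < α → D.Connected) ∧ HasExpectedDecay α D d₀) ∧
    (1 / 3 ≤ α →
      ∃ (B : ∀ z : ℤ, SimpleGraph (Fin (fibreSize α z))) (o : ∀ z : ℤ, Fin (fibreSize α z)),
        (∀ z, (B z).Connected) ∧
        (∃ M : ℕ, ∀ (z : ℤ) (x : Fin (fibreSize α z)), valency (B z) x ≤ M) ∧
        HasExpectedDecay α (wreath intGraph (fun z => Fin (fibreSize α z)) B o)
          (0, LampConfig.rest (fun z => Fin (fibreSize α z)) o)) ∧
    (0 < α → α ≤ 1 / 3 →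
      ∃ φ : ℤ → ℤ, Function.Surjective φ ∧
        (∃ c C : ℝ, 0 < c ∧ 0 < C ∧ ∀ (k : ℤ) (m : ℕ), 1 ≤ m →
          c * (m : ℝ) ^ (2 * α / (1 - α)) ≤ (((Finset.Icc k (k + m)).image φ).card : ℝ) ∧
          (((Finset.Icc k (k + m)).image φ).card : ℝ) ≤ C * (m : ℝ) ^ (2 * α / (1 - α))) ∧
        HasExpectedDecay α
          (generalizedWreath intGraph φ (fun _ : ℤ => ZMod 2) (fun _ : ℤ => zmodTwoGraph)
            (fun _ : ℤ => 0))
          (0, LampConfig.rest (fun _ : ℤ => ZMod 2) (fun _ : ℤ => 0))) := by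
  have hfibres := fun hα => exists_fibres_hasExpectedDecay (α := α) hα hα₁
  have hlampMap := exists_lampMap_hasExpectedDecay (α := α)
  refine ⟨?_, hfibres, hlampMap⟩
  rcases hα₀.eq_or_lt with rfl | hα
  · exact ⟨ℕ, ⊥, 0, inferInstance, fun h => absurd h (lt_irrefl _), hasExpectedDecay_bot 0⟩
  rcases le_total (1 / 3) α with hlarge | hsmall
  · obtain ⟨B, o, hB, -, hdecay⟩ := hfibres hlarge
    exact ⟨_, _, _, infinite_int_prod_lampConfig,
      fun _ => intWreath_connected Function.surjective_id hB, hdecay⟩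
  · obtain ⟨φ, hφ, -, hdecay⟩ := hlampMap hα hsmall
    exact ⟨_, _, _, infinite_int_prod_lampConfig,
      fun _ => intWreath_connected hφ fun _ => zmodTwoGraph_connected, hdecay⟩
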